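/- Let $n\ge 1$ and $0\le r<R\le\infty$, and let $\mathrm{Ann}(r,R)=\{z\in\mathbb C^n: r<|z|<R\}$. For $s>0$ let $\mu_s$ be the normalized surface measure on $\{w\in\mathbb C^n:|w|=s\}$, and, with $z\cdot\bar w=\sum_j z_j\bar w_j$, put $$f\times\mu_s(z)=\int_{|w|=s} f(z-w)\,e^{\frac i2\operatorname{Im}(z\cdot\bar w)}\,d\mu_s(w),\qquad \mu_s\times f(z)=\int_{|w|=s} f(z-w)\,e^{-\frac i2\operatorname{Im}(z\cdot\bar w)}\,d\mu_s(w).$$ Let $Z^*(\mathrm{Ann}(r,R))$ be the set of continuous functions $f$ on $\mathrm{Ann}(r,R)$ such that $f\times\mu_s(z)=\mu_s\times f(z)=0$ for all $z\in\mathbb C^n$ and $s>0$ for which the sphere $\{w:|w-z|=s\}$ is contained in $\mathrm{Ann}(r,R)$ and the closed ball $\{w:|w|\le r\}$ is contained in the closed ball $\{w:|w-z|\le s\}$. For integers $p,q\ge 0$ let $H_{p,q}$ be the space of harmonic polynomials on $\mathbb C^n$ of the form $\sum_{|\alpha|=p}\sum_{|\beta|=q}c_{\alpha\beta}z^\alpha\bar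 z^\beta$, let $d(p,q)=\dim H_{p,q}$, and let $P_j^{p,q}$, $1\le j\le d(p,q)$, be a basis of $H_{p,q}$ whose restrictions $Y_j^{p,q}$ to the unit sphere $S^{2n-1}$ are orthonormal in $L^2(S^{2n-1})$ with respect to the normalized surface measure $\sigma$. For a continuous function $f$ on $\mathrm{Ann}(r,R)$ and $r<\rho<R$ put $$\tilde a_j^{p,q}(\rho)=\rho^{-(p+q)}\int_{S^{2n-1}}f(\rho\omega)\,\overline{Y_j^{p,q}(\omega)}\,d\sigma(\omega).$$ Theorem. A continuous function $f$ on $\mathrm{Ann}(r,R)$ belongs to $Z^*(\mathrm{Ann}(r,R))$ if and only if both of the following hold: (a) for all $p,q\ge 1$ and $1\le j\le d(p,q)$ there are constants $c_i,d_k\in\mathbb C$ (depending on $p,q,j$) such that for all $r<\rho<R$ $$\tilde a_j^{p,q}(\rho)=\sum_{i=1}^{\min(p,q)}c_i\,e^{\frac14\rho^2}\rho^{-2(p+q+n-i)}+\sum_{k=1}^{\min(p,q)}d_k\,e^{-\frac14\rho^2}\rho^{-2(p+q+n-k)};$$ (b) $\tilde a_j^{0,q}(\rho)=0$ for all $q\ge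 0$, $1\le j\le d(0,q)$, and $\tilde a_j^{p,0}(\rho)=0$ for all $p\ge 0$, $1\le j\le d(p,0)$, for all $r<\rho<R$. -/

import Mathlib

open MeasureTheory Metric ComplexConjugate InnerProductSpace Laplacian

noncomputable section

namespace TwistedMeans

/-- `ℂⁿ` with its Euclidean norm. -/
abbrev Cn (n : ℕ) : Type := EuclideanSpace ℂ (Fin n)

/-- The hermitian pairing `z · w̄ = ∑ z_j w̄_j`. -/
def pairing {n : ℕ} (z w : Cn n) : ℂ := ∑ j, z j * conj (w j)

/-- The open annulus `{z : r < |z| < R}`; here `R = ⊤` is allowed. -/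
def Ann (n : ℕ) (r : ℝ) (R : EReal) : Set (Cn n) := {z | r < ‖z‖ ∧ (‖z‖ : EReal) < R}

/-- The normalized surface measure of the unit sphere of `ℂⁿ`. -/
def unitSphereMeasure (n : ℕ) : Measure (sphere (0 : Cn n) 1) :=
  ((volume : Measure (Cn n)).toSphere Set.univ)⁻¹ • (volume : Measure (Cn n)).toSphere

/-- The normalized surface measure `μ_s` of `{w : |w| = s}`, as a measure on `ℂⁿ`. -/
def sphereMeasure (n : ℕ) (s : ℝ) : Measure (Cn n) :=
  (unitSphereMeasure n).map (fun ω : sphere (0 : Cn n) 1 => s • (ω : Cn n))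

/-- The twisted convolution `f × μ` of a function with a measure:
`(f × μ)(z) = ∫ f(z - w) exp((i/2) Im(z · w̄)) dμ(w)`. -/
def twistedConvRight {n : ℕ} (f : Cn n → ℂ) (μ : Measure (Cn n)) (z : Cn n) : ℂ :=
  ∫ w, f (z - w) * Complex.exp (Complex.I / 2 * ((pairing z w).im : ℂ)) ∂μ

/-- The twisted convolution `μ × f` of a measure with a function. In
`(F × G)(z) = ∫ F(z - w) G(w) exp((i/2) Im(z · w̄)) dw` the measure takes the place of `F`; with
`u = z - w` this is `∫ f(z - u) exp((i/2) Im(z · conj (z - u))) dμ(u)`, which equals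
`∫ f(z - u) exp(-(i/2) Im(z · ū)) dμ(u)`. -/
def twistedConvLeft {n : ℕ} (μ : Measure (Cn n)) (f : Cn n → ℂ) (z : Cn n) : ℂ :=
  ∫ u, f (z - u) * Complex.exp (Complex.I / 2 * ((pairing z (z - u)).im : ℂ)) ∂μ

/-- The class `Z*(Ann(r,R))`: continuous functions on the annulus whose right and left twisted
spherical means both vanish for every sphere contained in the annulus whose ball contains the
(closed) ball of radius `r` about the origin. -/
def ZStar (n : ℕ) (r : ℝ) (R : EReal) : Set (Cn n → ℂ) :=
  {f | ContinuousOn f (Ann n r R) ∧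
    ∀ (z : Cn n) (s : ℝ), 0 < s → sphere z s ⊆ Ann n r R →
      closedBall (0 : Cn n) r ⊆ closedBall z s →
      twistedConvRight f (sphereMeasure n s) z = 0 ∧
      twistedConvLeft (sphereMeasure n s) f z = 0}

/-- The space `P_{p,q}` of polynomials in `z` and `z̄` of the form
`∑_{|α| = p} ∑_{|β| = q} c_{αβ} z^α z̄^β`, as functions on `ℂⁿ`. -/
def bihomogeneous (n p q : ℕ) : Submodule ℂ (Cn n → ℂ) :=
  Submodule.span ℂ {m | ∃ α β : Fin n → ℕ, ∑ i, α i = p ∧ ∑ i, β i = q ∧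
    m = fun z => (∏ i, z i ^ α i) * ∏ i, conj (z i) ^ β i}

theorem contDiff_of_mem_bihomogeneous {n p q : ℕ} {P : Cn n → ℂ}
    (hP : P ∈ bihomogeneous n p q) : ContDiff ℝ 2 P := by
  have hz : ∀ i : Fin n, ContDiff ℝ 2 (fun z : Cn n => z i) := fun i =>
    ((EuclideanSpace.proj i : Cn n →L[ℂ] ℂ).restrictScalars ℝ).contDiff
  have hc : ∀ i : Fin n, ContDiff ℝ 2 (fun z : Cn n => conj (z i)) := fun i =>
    Complex.conjCLE.contDiff.comp (hz i)
  induction hP using Submodule.span_induction with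
  | mem m hm =>
    obtain ⟨α, β, -, -, rfl⟩ := hm
    exact (contDiff_prod fun i _ => (hz i).pow (α i)).mul
      (contDiff_prod fun i _ => (hc i).pow (β i))
  | zero => exact contDiff_const
  | add f g _ _ hf hg => exact hf.add hg
  | smul c f _ hf => exact contDiff_const.smul hf

/-- The space `H_{p,q}` of bigraded solid harmonics: the elements of `P_{p,q}` annihilated by the
standard (real) Laplacian of `ℂⁿ = ℝ²ⁿ`. -/
def solidHarmonics (n p q : ℕ) : Submodule ℂ (Cn n → ℂ) where
  carrier := {P | P ∈ bihomogeneous n p q ∧ ∀ z, Δ P z = 0}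
  zero_mem' := by
    refine ⟨Submodule.zero_mem _, fun z => ?_⟩
    exact congrFun (laplacian_const (E := Cn n) (c := (0 : ℂ))) z
  add_mem' := by
    rintro P Q ⟨hP, hP'⟩ ⟨hQ, hQ'⟩
    refine ⟨Submodule.add_mem _ hP hQ, fun z => ?_⟩
    rw [(contDiff_of_mem_bihomogeneous hP).contDiffAt.laplacian_add
      (contDiff_of_mem_bihomogeneous hQ).contDiffAt, hP', hQ', add_zero]
  smul_mem' := by
    rintro c P ⟨hP, hP'⟩
    refine ⟨Submodule.smul_mem _ c hP, fun z => ?_⟩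
    rw [laplacian_smul c (contDiff_of_mem_bihomogeneous hP).contDiffAt, hP', smul_zero]

/-- The dimension `d(p,q)` of `H_{p,q}`. -/
def dimH (n p q : ℕ) : ℕ := Module.finrank ℂ (solidHarmonics n p q)

/-- A choice, for all `p, q`, of a basis `P_1^{p,q}, …, P_{d(p,q)}^{p,q}` of `H_{p,q}`. -/
abbrev HarmonicBases (n : ℕ) : Type :=
  ∀ p q : ℕ, Module.Basis (Fin (dimH n p q)) ℂ (solidHarmonics n p q)

/-- The restrictions `Y_j^{p,q}` of the `P_j^{p,q}` to the unit sphere are orthonormal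
in `L²` of the normalized surface measure. -/
def IsOrthonormalOnSphere {n : ℕ} (P : HarmonicBases n) : Prop :=
  ∀ (p q : ℕ) (i j : Fin (dimH n p q)),
    ∫ ω, (P p q i : Cn n → ℂ) ω * conj ((P p q j : Cn n → ℂ) ω) ∂(unitSphereMeasure n)
      = if i = j then 1 else 0

/-- The coefficient `a_j^{p,q}(ρ) = ∫ f(ρω) conj(Y_j^{p,q}(ω)) dσ(ω)` of `f(ρ ·)`. -/
def sphCoeff {n : ℕ} (P : HarmonicBases n) (f : Cn n → ℂ) (p q : ℕ) (j : Fin (dimH n p q))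
    (ρ : ℝ) : ℂ :=
  ∫ ω, f (ρ • (ω : Cn n)) * conj ((P p q j : Cn n → ℂ) ω) ∂(unitSphereMeasure n)

/-- The coefficient `ã_j^{p,q}(ρ) = ρ^{-(p+q)} a_j^{p,q}(ρ)`. -/
def solidCoeff {n : ℕ} (P : HarmonicBases n) (f : Cn n → ℂ) (p q : ℕ) (j : Fin (dimH n p q))
    (ρ : ℝ) : ℂ :=
  ((ρ : ℂ) ^ (p + q))⁻¹ * sphCoeff P f p q j ρ

end TwistedMeans

end

/-! On the sphere |u - z| = s the identity z·ū + u·z̄ = |u|² + |z|² - s² turns the twisted phase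
into exp(-κ|u|²/2) exp(κ u·z̄), up to a nonzero factor depending only on z and s. Here κ = 1/2 for
the right means and κ = -1/2 for the left ones. Put F(u) = f(u) exp(-κ|u|²/2). Tested in the
variable t = s², the means vanish when ∫ F(u) φ(|u-z|²) exp(κ u·z̄) du = 0 for all test functions φ
supported in the admissible range (`integral_weak_eq_zero`, `meansVanish_of_integral_weak`).

Necessity. Take z = εζ with |ζ| = 1, absorb ε² into φ, and expand at ε = 0. The m-th coefficient is
a binomial sum of (-ζ·ū)^l (u·ζ̄)^(m-l) times (d/dt)^l (κ - d/dt)^(m-l) φ at |u|², and each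
coefficient integrates to zero against F. For m = p+q, averaging over ζ against a harmonic
polynomial h of bidegree (q,p) kills every term except l = p and reproduces h(u) there. So the
radial profile of F along h annihilates the range of (d/dt)^p (κ - d/dt)^q. It is therefore A(t) +
exp(-κt) B(t) with deg A < p and deg B < q (`integral_mixedDeriv_eq_zero`,
`exists_expPoly_of_mixedDeriv`). Passing from κ = 1/2 to κ = -1/2 exchanges the roles of the two
exponentials, and these are independent over polynomials, so both degrees are below min(p,q)
(`hasRadialForm_iff`).

Sufficiency. For a single component |u|^(-2N) (A + exp(-κ|u|²) B) h the same orthogonality and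
integration by parts kill all Taylor coefficients at ε = 0. After the substitution u = w + τz the
weak mean with centre τz is holomorphic in τ wherever |τ||z| is smaller than the radii in play.
Those radii exceed |z|, so the domain contains τ = 1 and the identity theorem gives zero there
(`integral_radComp_weak_eq_zero`). Parseval's identity on spheres then sums the components
(`meansVanish_of_hasExpPolyProfile`).

Orthogonality and completeness of the bigraded harmonics come from Gaussian integrals, for which
multiplication by z̄_j is transposed to ∂/∂z_j (`gaussInt_harm_mul_eq_zero`,
`gaussInt_harm_mul_linZ`, `isHarm_of_orthogonal`). -/

noncomputable section

namespace TwistedMeans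

/-! ### Test functions in the squared radius and Taylor expansion of a translated weight. -/

section

/-! ### Test functions on an open set of the real line -/

/-- Smooth complex-valued functions with compact support in `I`. -/
def testSpace (I : Set ℝ) : Submodule ℂ (ℝ → ℂ) where
  carrier := {φ | ContDiff ℝ (⊤ : ℕ∞) φ ∧ HasCompactSupport φ ∧ tsupport φ ⊆ I}
  zero_mem' := ⟨contDiff_const, HasCompactSupport.zero, by simp [tsupport]⟩
  add_mem' := by
    rintro f g ⟨h1, h2, h3⟩ ⟨k1, k2, k3⟩
    exact ⟨h1.add k1, h2.add k2, (tsupport_add f g).trans (Set.union_subset h3 k3)⟩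
  smul_mem' := by
    rintro c f ⟨h1, h2, h3⟩
    exact ⟨contDiff_const.smul h1, h2.smul_left (f := fun _ => c),
      (tsupport_smul_subset_right (fun _ : ℝ => c) f).trans h3⟩

variable {I : Set ℝ}

theorem testSpace_contDiff (φ : testSpace I) : ContDiff ℝ (⊤ : ℕ∞) (φ : ℝ → ℂ) := φ.2.1

theorem testSpace_continuous (φ : testSpace I) : Continuous (φ : ℝ → ℂ) := φ.2.1.continuous

theorem testSpace_hasCompactSupport (φ : testSpace I) : HasCompactSupport (φ : ℝ → ℂ) := φ.2.2.1

theorem testSpace_eq_zero (φ : testSpace I) {t : ℝ} (ht : t ∉ I) : (φ : ℝ → ℂ) t = 0 :=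
  image_eq_zero_of_notMem_tsupport fun h => ht (φ.2.2.2 h)

/-- Differentiation as an endomorphism of the space of test functions. -/
def testDeriv (I : Set ℝ) : Module.End ℂ (testSpace I) where
  toFun φ := ⟨deriv φ, (contDiff_infty_iff_deriv.1 φ.2.1).2, φ.2.2.1.deriv,
    (tsupport_deriv_subset).trans φ.2.2.2⟩
  map_add' φ ψ := by
    ext t
    exact deriv_add ((testSpace_contDiff φ).differentiable (by simp) t) ((testSpace_contDiff ψ).differentiable (by simp) t)
  map_smul' c φ := by
    ext t
    exact deriv_const_smul c ((testSpace_contDiff φ).differentiable (by simp) t)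

theorem testSpace_hasDerivAt (φ : testSpace I) (t : ℝ) :
    HasDerivAt (φ : ℝ → ℂ) ((testDeriv I φ : ℝ → ℂ) t) t :=
  ((testSpace_contDiff φ).differentiable (by simp) t).hasDerivAt

/-- The operator `κ - d/dt` on test functions. -/
def subDeriv (I : Set ℝ) (κ : ℝ) : Module.End ℂ (testSpace I) := (κ : ℂ) • 1 - testDeriv I

theorem subDeriv_apply (κ : ℝ) (φ : testSpace I) (t : ℝ) :
    (subDeriv I κ φ : ℝ → ℂ) t = κ * (φ : ℝ → ℂ) t - (testDeriv I φ : ℝ → ℂ) t := rfl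

theorem commute_testDeriv_subDeriv (κ : ℝ) : Commute (testDeriv I) (subDeriv I κ) := by
  refine LinearMap.ext fun φ => ?_
  change testDeriv I ((κ : ℂ) • φ - testDeriv I φ) =
    (κ : ℂ) • testDeriv I φ - testDeriv I (testDeriv I φ)
  rw [map_sub, map_smul]

/-- The composition `(d/dt)^p (κ - d/dt)^q`. -/
def mixedDeriv (I : Set ℝ) (κ : ℝ) (p q : ℕ) : Module.End ℂ (testSpace I) :=
  testDeriv I ^ p * subDeriv I κ ^ q

theorem mixedDeriv_succ_left (κ : ℝ) (p q : ℕ) (φ : testSpace I) :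
    mixedDeriv I κ (p + 1) q φ = testDeriv I (mixedDeriv I κ p q φ) := by
  simp [mixedDeriv, pow_succ', mul_assoc]

theorem mixedDeriv_succ_right (κ : ℝ) (p q : ℕ) (φ : testSpace I) :
    mixedDeriv I κ p (q + 1) φ = subDeriv I κ (mixedDeriv I κ p q φ) := by
  have h : mixedDeriv I κ p (q + 1) = subDeriv I κ * mixedDeriv I κ p q := by
    rw [mixedDeriv, mixedDeriv, pow_succ', ← mul_assoc, ← mul_assoc,
      ((commute_testDeriv_subDeriv κ).pow_left p).eq]
  rw [h, Module.End.mul_apply]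

/-! ### Taylor expansion -/

/-- The generator `-x d/dt + y (κ - d/dt)` of `ε ↦ φ (v - ε (x + y)) exp (κ ε y)`. -/
def genDeriv (I : Set ℝ) (κ : ℝ) (x y : ℂ) : Module.End ℂ (testSpace I) :=
  (-x) • testDeriv I + y • subDeriv I κ

/-- The `m`-th derivative at `ε = 0` of `ε ↦ φ (v - ε (x + y)) exp (κ ε y)`. -/
def taylorTerm (κ : ℝ) (φ : testSpace I) (m : ℕ) (x y : ℂ) (v : ℝ) : ℂ :=
  ∑ l ∈ Finset.range (m + 1),
    (m.choose l : ℂ) * ((-x) ^ l * y ^ (m - l)) * (mixedDeriv I κ l (m - l) φ : ℝ → ℂ) v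

/-- The two summands of the generator commute, so this is the binomial theorem in the endomorphism
ring. -/
theorem genDeriv_pow_apply (κ : ℝ) (x y : ℂ) (φ : testSpace I) (m : ℕ) (v : ℝ) :
    (((genDeriv I κ x y) ^ m) φ : ℝ → ℂ) v = taylorTerm κ φ m x y v := by
  have hc : Commute ((-x) • testDeriv I) (y • subDeriv I κ) :=
    ((commute_testDeriv_subDeriv κ).smul_left _).smul_right _
  have : (genDeriv I κ x y) ^ m = ∑ l ∈ Finset.range (m + 1),
      ((m.choose l : ℂ) * ((-x) ^ l * y ^ (m - l))) • mixedDeriv I κ l (m - l) := by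
    rw [genDeriv, hc.add_pow]
    refine Finset.sum_congr rfl fun l _ => ?_
    rw [smul_pow, smul_pow, smul_mul_smul_comm, mixedDeriv, ← Nat.cast_comm, ← nsmul_eq_mul,
      ← Nat.cast_smul_eq_nsmul ℂ, smul_smul]
  rw [this, taylorTerm, LinearMap.sum_apply, Submodule.coe_sum, Finset.sum_apply]
  rfl

/-- The derivative is -bφ' + κyφ. Since b = x + y, it splits as -xφ' + y(κφ - φ'), which separates
the dependence on ζ·ū from that on u·ζ̄. -/
theorem testSpace_hasDerivAt_shift (κ : ℝ) (φ : testSpace I) {x y : ℂ} {b : ℝ} (h : x + y = b)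
    (v ε : ℝ) :
    HasDerivAt (fun ε : ℝ => (φ : ℝ → ℂ) (v - ε * b) * Complex.exp (κ * ε * y))
      ((genDeriv I κ x y φ : ℝ → ℂ) (v - ε * b) * Complex.exp (κ * ε * y)) ε := by
  have h1 : HasDerivAt (fun ε : ℝ => v - ε * b) (-b) ε := by
    simpa using ((hasDerivAt_id ε).mul_const b).const_sub v
  have h2 := ((testSpace_hasDerivAt φ) (v - ε * b)).scomp ε h1
  have h3 : HasDerivAt (fun ε : ℝ => Complex.exp (κ * ε * y))
      (Complex.exp (κ * ε * y) * (κ * y)) ε := by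
    have h4 : HasDerivAt (fun ε : ℝ => (κ : ℂ) * ε * y) (κ * y) ε := by
      simpa using ((Complex.ofRealCLM.hasDerivAt (x := ε)).const_mul (κ : ℂ)).mul_const y
    exact h4.cexp
  refine (h2.mul h3).congr_deriv ?_
  have h5 : (genDeriv I κ x y φ : ℝ → ℂ) (v - ε * b) =
      -x * (testDeriv I φ : ℝ → ℂ) (v - ε * b) + y * (κ * (φ : ℝ → ℂ) (v - ε * b)
        - (testDeriv I φ : ℝ → ℂ) (v - ε * b)) := rfl
  rw [h5, Complex.real_smul, Complex.ofReal_neg, ← h, Function.comp_apply]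
  ring

theorem testSpace_iteratedDeriv_shift (κ : ℝ) {x y : ℂ} {b : ℝ} (h : x + y = b) (v : ℝ) (m : ℕ) :
    ∀ φ : testSpace I,
      iteratedDeriv m (fun ε : ℝ => (φ : ℝ → ℂ) (v - ε * b) * Complex.exp (κ * ε * y)) =
        fun ε : ℝ => (((genDeriv I κ x y) ^ m) φ : ℝ → ℂ) (v - ε * b) *
          Complex.exp (κ * ε * y) := by
  induction m with
  | zero => intro φ; simp
  | succ m ih =>
    intro φ
    rw [iteratedDeriv_succ', funext fun ε => (testSpace_hasDerivAt_shift κ φ h v ε).deriv, ih, pow_succ]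
    rfl

theorem testSpace_exists_bound (φ : testSpace I) : ∃ C, 0 ≤ C ∧ ∀ t, ‖(φ : ℝ → ℂ) t‖ ≤ C := by
  obtain ⟨C, hC⟩ := (testSpace_hasCompactSupport φ).exists_bound_of_continuous (testSpace_continuous φ)
  exact ⟨C, (norm_nonneg _).trans (hC 0), hC⟩

theorem exists_bound_taylorTerm (κ : ℝ) (φ : testSpace I) (m : ℕ) (B : ℝ) :
    ∃ C, 0 ≤ C ∧ ∀ (v : ℝ) (x y : ℂ), ‖x‖ ≤ B → ‖y‖ ≤ B → ‖taylorTerm κ φ m x y v‖ ≤ C := by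
  choose c hc0 hc using fun l => testSpace_exists_bound (mixedDeriv I κ l (m - l) φ)
  refine ⟨∑ l ∈ Finset.range (m + 1), (m.choose l : ℝ) * (|B| ^ l * |B| ^ (m - l)) * c l,
    Finset.sum_nonneg fun l _ => mul_nonneg (by positivity) (hc0 l), fun v x y hx hy => ?_⟩
  refine (norm_sum_le _ _).trans (Finset.sum_le_sum fun l _ => ?_)
  rw [norm_mul, norm_mul, norm_mul, norm_pow, norm_pow, norm_neg, Complex.norm_natCast]
  have hx' := hx.trans (le_abs_self B)
  have hy' := hy.trans (le_abs_self B)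
  have := hc l v
  gcongr

/-- The constant must not depend on `v`, `x` or `y`, because the estimate is integrated over u, with
`v` also allowed to move with ε. -/
theorem exists_taylor_bound (κ : ℝ) (φ : testSpace I) (N : ℕ) (B : ℝ) :
    ∃ C, 0 ≤ C ∧ ∀ (v b ε : ℝ) (x y : ℂ), x + y = b → ‖x‖ ≤ B → ‖y‖ ≤ B → 0 ≤ ε → ε ≤ 1 →
      ‖(φ : ℝ → ℂ) (v - ε * b) * Complex.exp (κ * ε * y) -
        ∑ m ∈ Finset.range (N + 1), (ε : ℂ) ^ m / (m.factorial : ℂ) * taylorTerm κ φ m x y v‖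
        ≤ C * ε ^ (N + 1) := by
  obtain ⟨C, hC0, hC⟩ := exists_bound_taylorTerm κ φ (N + 1) B
  -- The second factor bounds |exp(κ e y)| for e in [0,1].
  refine ⟨C * Real.exp (|κ| * |B|), by positivity, fun v b ε x y hxy hx hy h0 h1 => ?_⟩
  set g : ℝ → ℂ := fun ε : ℝ => (φ : ℝ → ℂ) (v - ε * b) * Complex.exp (κ * ε * y) with hg
  have hgs : ContDiff ℝ (⊤ : ℕ∞) g := by
    refine ((testSpace_contDiff φ).comp (contDiff_const.sub (contDiff_id.mul contDiff_const))).mul ?_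
    exact ((contDiff_const.mul Complex.ofRealCLM.contDiff).mul contDiff_const).cexp
  have hu := uniqueDiffOn_Icc (zero_lt_one (α := ℝ))
  have hd : ∀ (m : ℕ), ∀ e ∈ Set.Icc (0 : ℝ) 1, iteratedDerivWithin m g (Set.Icc 0 1) e =
      taylorTerm κ φ m x y (v - e * b) * Complex.exp (κ * e * y) := by
    intro m e he
    rw [iteratedDerivWithin_eq_iteratedDeriv hu
      ((hgs.of_le (by exact_mod_cast le_top)).contDiffAt) he,
      testSpace_iteratedDeriv_shift κ hxy, ← genDeriv_pow_apply]
  have key := taylor_mean_remainder_bound (f := g) (a := 0) (b := 1) (x := ε) (n := N)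
    (C := C * Real.exp (|κ| * |B|)) zero_le_one
    ((hgs.of_le (by exact_mod_cast le_top)).contDiffOn) ⟨h0, h1⟩ (by
      intro e he
      rw [hd _ e he, norm_mul]
      refine mul_le_mul (hC _ _ _ hx hy) ?_ (norm_nonneg _) hC0
      rw [Complex.norm_exp]
      refine Real.exp_le_exp.2 ((Complex.re_le_norm _).trans ?_)
      rw [norm_mul, norm_mul, Complex.norm_real, Complex.norm_real, Real.norm_eq_abs,
        Real.norm_eq_abs, abs_of_nonneg he.1]
      calc |κ| * e * ‖y‖ ≤ |κ| * 1 * |B| := by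
            gcongr
            · exact he.2
            · exact hy.trans (le_abs_self B)
        _ = _ := by ring)
  have hT : taylorWithinEval g N (Set.Icc 0 1) 0 ε =
      ∑ m ∈ Finset.range (N + 1), (ε : ℂ) ^ m / (m.factorial : ℂ) * taylorTerm κ φ m x y v := by
    rw [taylor_within_apply]
    refine Finset.sum_congr rfl fun m _ => ?_
    rw [hd m 0 ⟨le_rfl, zero_le_one⟩, Complex.real_smul]
    push_cast
    simp only [zero_mul, sub_zero, mul_zero, Complex.exp_zero, mul_one]
    ring
  rw [hT, sub_zero] at key
  refine key.trans (div_le_self (by positivity) ?_)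
  exact_mod_cast Nat.one_le_iff_ne_zero.2 (Nat.factorial_ne_zero N)

end

/-! ### Exponential polynomials as the annihilator of a constant-coefficient operator. -/

section

variable {I : Set ℝ}

/-! ### Exponential polynomials -/

/-- The exponential polynomial `A(t) + exp(-κ t) B(t)`. -/
def expPoly (κ : ℝ) (A B : Polynomial ℂ) (t : ℝ) : ℂ :=
  A.eval (t : ℂ) + Complex.exp (-(κ * t)) * B.eval (t : ℂ)

theorem hasDerivAt_expPoly (κ : ℝ) (A B : Polynomial ℂ) (t : ℝ) :
    HasDerivAt (expPoly κ A B)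
      (expPoly κ A.derivative (B.derivative - Polynomial.C (κ : ℂ) * B) t) t := by
  have h1 := (A.hasDerivAt (t : ℂ)).comp_ofReal
  have h2 := (B.hasDerivAt (t : ℂ)).comp_ofReal
  have h3 : HasDerivAt (fun t : ℝ => Complex.exp (-(κ * t)))
      (Complex.exp (-(κ * t)) * (-κ)) t := by
    have h4 : HasDerivAt (fun t : ℝ => -((κ : ℂ) * t)) (-κ) t := by
      simpa using ((Complex.ofRealCLM.hasDerivAt (x := t)).const_mul (κ : ℂ)).fun_neg
    exact h4.cexp
  refine (h1.add (h3.mul h2)).congr_deriv ?_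
  simp only [expPoly, Polynomial.eval_sub, Polynomial.eval_mul, Polynomial.eval_C]
  ring

theorem continuous_expPoly (κ : ℝ) (A B : Polynomial ℂ) : Continuous (expPoly κ A B) :=
  continuous_iff_continuousAt.2 fun t => (hasDerivAt_expPoly κ A B t).continuousAt

theorem integrable_mul_testSpace {u : ℝ → ℂ} (hu : Continuous u) (φ : testSpace I) :
    Integrable fun t => u t * (φ : ℝ → ℂ) t :=
  (hu.mul (testSpace_continuous φ)).integrable_of_hasCompactSupport
    (testSpace_hasCompactSupport φ).mul_left

theorem integral_mul_testDeriv {u u' : ℝ → ℂ} (hu : ∀ t, HasDerivAt u (u' t) t)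
    (hu' : Continuous u') (φ : testSpace I) :
    ∫ t, u t * (testDeriv I φ : ℝ → ℂ) t = -∫ t, u' t * (φ : ℝ → ℂ) t := by
  have hc : Continuous u := continuous_iff_continuousAt.2 fun t => (hu t).continuousAt
  exact integral_mul_deriv_eq_deriv_mul_of_integrable (fun t _ => hu t)
    (fun t _ => testSpace_hasDerivAt φ t)
    (integrable_mul_testSpace hc _) (integrable_mul_testSpace hu' _)
    (integrable_mul_testSpace hc _)

theorem integral_expPoly_mul_testDeriv (κ : ℝ) (A B : Polynomial ℂ) (φ : testSpace I) :
    ∫ t, expPoly κ A B t * (testDeriv I φ : ℝ → ℂ) t =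
      -∫ t, expPoly κ A.derivative (B.derivative - Polynomial.C (κ : ℂ) * B) t *
        (φ : ℝ → ℂ) t :=
  integral_mul_testDeriv (hasDerivAt_expPoly κ A B) (continuous_expPoly _ _ _) φ

theorem integral_expPoly_mul_subDeriv (κ : ℝ) (A B : Polynomial ℂ) (φ : testSpace I) :
    ∫ t, expPoly κ A B t * (subDeriv I κ φ : ℝ → ℂ) t =
      ∫ t, expPoly κ (Polynomial.C (κ : ℂ) * A + A.derivative) B.derivative t *
        (φ : ℝ → ℂ) t := by
  have h : ∀ t, expPoly κ A B t * (subDeriv I κ φ : ℝ → ℂ) t =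
      κ * (expPoly κ A B t * (φ : ℝ → ℂ) t) - expPoly κ A B t * (testDeriv I φ : ℝ → ℂ) t := by
    intro t
    rw [subDeriv_apply]
    ring
  rw [integral_congr_ae (.of_forall h), integral_sub, integral_expPoly_mul_testDeriv,
    integral_const_mul, sub_neg_eq_add, ← integral_const_mul, ← integral_add]
  · congr 1
    ext t
    simp only [expPoly, Polynomial.eval_sub, Polynomial.eval_mul, Polynomial.eval_C,
      Polynomial.eval_add]
    ring
  · exact (integrable_mul_testSpace (continuous_expPoly _ _ _) _).const_mul _
  · exact integrable_mul_testSpace (continuous_expPoly _ _ _) _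
  · exact (integrable_mul_testSpace (continuous_expPoly _ _ _) _).const_mul _
  · exact integrable_mul_testSpace (continuous_expPoly _ _ _) _

theorem derivative_mem_degreeLT {p : ℕ} {A : Polynomial ℂ}
    (hA : A ∈ Polynomial.degreeLT ℂ (p + 1)) : A.derivative ∈ Polynomial.degreeLT ℂ p := by
  rw [Polynomial.mem_degreeLT] at *
  rcases eq_or_ne A 0 with rfl | h0
  · simp
  · have h1 := Polynomial.degree_derivative_lt h0
    rw [Polynomial.degree_eq_natDegree h0] at h1 hA
    refine h1.trans_le ?_
    norm_cast at hA ⊢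
    lia

theorem derivative_mem_degreeLT' {p : ℕ} {A : Polynomial ℂ}
    (hA : A ∈ Polynomial.degreeLT ℂ p) : A.derivative ∈ Polynomial.degreeLT ℂ p := by
  rw [Polynomial.mem_degreeLT] at *
  exact (Polynomial.degree_derivative_le).trans_lt hA

theorem C_mul_mem_degreeLT {p : ℕ} {A : Polynomial ℂ} (c : ℂ)
    (hA : A ∈ Polynomial.degreeLT ℂ p) : Polynomial.C c * A ∈ Polynomial.degreeLT ℂ p := by
  rw [← Polynomial.smul_eq_C_mul]
  exact Submodule.smul_mem _ c hA

theorem degreeLT_zero_eq {A : Polynomial ℂ} (hA : A ∈ Polynomial.degreeLT ℂ 0) : A = 0 := by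
  rw [Polynomial.mem_degreeLT] at hA
  exact Polynomial.degree_eq_bot.1 (by simpa using hA)

/-- Integration by parts: exponential polynomials of small degree are orthogonal to the range of
`(d/dt)^p (κ - d/dt)^q`. -/
theorem integral_expPoly_mul_mixedDeriv (κ : ℝ) (p q : ℕ) :
    ∀ A ∈ Polynomial.degreeLT ℂ p, ∀ B ∈ Polynomial.degreeLT ℂ q, ∀ φ : testSpace I,
      ∫ t, expPoly κ A B t * (mixedDeriv I κ p q φ : ℝ → ℂ) t = 0 := by
  induction p with
  | zero =>
    induction q with
    | zero =>
      intro A hA B hB φ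
      simp [degreeLT_zero_eq hA, degreeLT_zero_eq hB, expPoly]
    | succ q ih =>
      intro A hA B hB φ
      rw [mixedDeriv_succ_right, integral_expPoly_mul_subDeriv]
      exact ih _ (Submodule.add_mem _ (C_mul_mem_degreeLT _ hA) (derivative_mem_degreeLT' hA)) _
        (derivative_mem_degreeLT hB) φ
  | succ p ih =>
    intro A hA B hB φ
    rw [mixedDeriv_succ_left, integral_expPoly_mul_testDeriv,
      ih _ (derivative_mem_degreeLT hA) _ (Submodule.sub_mem _ (derivative_mem_degreeLT' hB)
        (C_mul_mem_degreeLT _ hB)), neg_zero]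

/-- Translation preserves polynomial degrees and multiplies the exponential by a constant, so the
translated weight stays in the same annihilator. -/
theorem integral_expPoly_mul_mixedDeriv_shift (κ : ℝ) {p q : ℕ} {A B : Polynomial ℂ}
    (hA : A ∈ Polynomial.degreeLT ℂ p) (hB : B ∈ Polynomial.degreeLT ℂ q) (φ : testSpace I)
    (c : ℝ) :
    ∫ t, expPoly κ A B t * (mixedDeriv I κ p q φ : ℝ → ℂ) (t + c) = 0 := by
  have key := integral_expPoly_mul_mixedDeriv κ p q (Polynomial.taylor (-c : ℂ) A) (by
    rw [Polynomial.mem_degreeLT] at *; rwa [Polynomial.degree_taylor])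
    (Polynomial.C (Complex.exp (κ * c)) * Polynomial.taylor (-c : ℂ) B) (by
    refine C_mul_mem_degreeLT _ ?_
    rw [Polynomial.mem_degreeLT] at *; rwa [Polynomial.degree_taylor]) φ
  rw [← key]
  conv_rhs => rw [← integral_add_right_eq_self _ c]
  congr 1
  ext t
  congr 1
  simp only [expPoly, Polynomial.taylor_eval, Polynomial.eval_mul, Polynomial.eval_C]
  rw [← mul_assoc, ← Complex.exp_add]
  push_cast
  congr 1
  · congr 1; ring
  · congr 2
    · ring
    · ring

/-- On polynomials d/dx is nilpotent, so μ - d/dx is invertible. The first approximation A/μ leaves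
an error A'/μ of smaller degree. -/
theorem exists_C_mul_sub_derivative_eq {μ : ℂ} (hμ : μ ≠ 0) (p : ℕ) :
    ∀ A ∈ Polynomial.degreeLT ℂ p, ∃ Q ∈ Polynomial.degreeLT ℂ p,
      Polynomial.C μ * Q - Q.derivative = A := by
  induction p with
  | zero => intro A hA; exact ⟨0, Submodule.zero_mem _, by simp [degreeLT_zero_eq hA]⟩
  | succ p ih =>
    intro A hA
    have h1 := C_mul_mem_degreeLT μ⁻¹ (derivative_mem_degreeLT hA)
    obtain ⟨Q, hQ, hQ'⟩ := ih _ h1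
    refine ⟨Polynomial.C μ⁻¹ * A + Q, Submodule.add_mem _ (C_mul_mem_degreeLT _ hA)
      (Polynomial.degreeLT_mono (Nat.le_succ p) hQ), ?_⟩
    rw [mul_add, ← mul_assoc, ← Polynomial.C_mul, mul_inv_cancel₀ hμ, Polynomial.derivative_add,
      Polynomial.derivative_C_mul]
    linear_combination hQ' + A * (Polynomial.C_1 : Polynomial.C (1 : ℂ) = 1)

theorem exists_derivative_eq {p : ℕ} {A : Polynomial ℂ} (hA : A ∈ Polynomial.degreeLT ℂ p) :
    ∃ Q ∈ Polynomial.degreeLT ℂ (p + 1), Q.derivative = A := by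
  rcases eq_or_ne A 0 with rfl | h0
  · exact ⟨0, Submodule.zero_mem _, by simp⟩
  rw [Polynomial.mem_degreeLT] at hA
  have hs := A.as_sum_range' p ?_
  · refine ⟨∑ i ∈ Finset.range p, Polynomial.monomial (i + 1) (A.coeff i / (i + 1)),
      Submodule.sum_mem _ fun i hi => ?_, ?_⟩
    · rw [Polynomial.mem_degreeLT]
      refine (Polynomial.degree_monomial_le _ _).trans_lt ?_
      have := Finset.mem_range.1 hi
      exact_mod_cast Nat.succ_lt_succ this
    · conv_rhs => rw [hs]
      rw [Polynomial.derivative_sum]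
      refine Finset.sum_congr rfl fun i _ => ?_
      rw [Polynomial.derivative_monomial]
      congr 1
      have : (i : ℂ) + 1 ≠ 0 := by exact_mod_cast Nat.succ_ne_zero i
      push_cast
      field_simp
  · rw [Polynomial.degree_eq_natDegree h0] at hA
    exact_mod_cast hA

/-- Differentiation lowers the degree of A and replaces B by B' - κB. The latter has the degree of B
when κ ≠ 0, so it vanishes only with B. -/
theorem expPoly_eq_zero {κ : ℝ} (hκ : κ ≠ 0) {J : Set ℝ} (hJ : IsOpen J) (hne : J.Nonempty) (N : ℕ) :
    ∀ A ∈ Polynomial.degreeLT ℂ N, ∀ B : Polynomial ℂ, (∀ t ∈ J, expPoly κ A B t = 0) →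
      A = 0 ∧ B = 0 := by
  have hinf : ∀ Q : Polynomial ℂ, (∀ t ∈ J, Q.eval (t : ℂ) = 0) → Q = 0 := by
    intro Q hQ
    refine Polynomial.eq_zero_of_infinite_isRoot Q ?_
    have h1 : (((↑) : ℝ → ℂ) '' J).Infinite :=
      (Set.infinite_image_iff Complex.ofReal_injective.injOn).2
        (infinite_of_mem_nhds hne.some (hJ.mem_nhds hne.some_mem))
    refine h1.mono ?_
    rintro _ ⟨t, ht, rfl⟩
    exact hQ t ht
  induction N with
  | zero =>
    intro A hA B h
    have hA0 := degreeLT_zero_eq hA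
    refine ⟨hA0, hinf B fun t ht => ?_⟩
    simpa [expPoly, hA0, Complex.exp_ne_zero] using h t ht
  | succ N ih =>
    intro A hA B h
    have hB : B.derivative - Polynomial.C (κ : ℂ) * B = 0 := by
      refine (ih _ (derivative_mem_degreeLT hA) _ fun t ht => ?_).2
      have h1 : HasDerivAt (expPoly κ A B) 0 t := by
        refine (hasDerivAt_const t (0 : ℂ)).congr_of_eventuallyEq ?_
        filter_upwards [hJ.mem_nhds ht] with x hx using h x hx
      exact (hasDerivAt_expPoly κ A B t).unique h1
    have hB0 : B = 0 := by
      by_contra hB0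
      have h1 := Polynomial.degree_derivative_lt hB0
      rw [sub_eq_zero.1 hB, Polynomial.degree_C_mul (by exact_mod_cast hκ)] at h1
      exact lt_irrefl _ h1
    refine ⟨hinf A fun t ht => ?_, hB0⟩
    simpa [expPoly, hB0] using h t ht

/-! ### Functionals annihilating the range of a differential operator -/

/-- Variation of constants: φ(t) = -exp(κt) ∫ exp(-κs)ψ(s) ds over s < t. The integral condition
makes φ vanish to the right of the support of ψ, and order-connectedness keeps the convex hull of
that support inside `I`. -/
theorem exists_subDeriv_eq (hI : I.OrdConnected) (κ : ℝ) (ψ : testSpace I)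
    (h : ∫ t : ℝ, Complex.exp (-(κ * t)) * (ψ : ℝ → ℂ) t = 0) :
    ∃ φ : testSpace I, subDeriv I κ φ = ψ := by
  obtain ⟨a, b, hab, hsupp⟩ : ∃ a b : ℝ, Set.Icc a b ⊆ I ∧
      Function.support (ψ : ℝ → ℂ) ⊆ Set.Icc a b := by
    rcases (tsupport (ψ : ℝ → ℂ)).eq_empty_or_nonempty with h0 | h0
    -- For ψ = 0 the interval [1, 0] is empty.
    · refine ⟨1, 0, by simp, ?_⟩
      rw [tsupport_eq_empty_iff.1 h0]
      simp
    · have hK : IsCompact (tsupport (ψ : ℝ → ℂ)) := testSpace_hasCompactSupport ψ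
      refine ⟨sInf (tsupport (ψ : ℝ → ℂ)), sSup (tsupport (ψ : ℝ → ℂ)),
        hI.out (ψ.2.2.2 (hK.sInf_mem h0)) (ψ.2.2.2 (hK.sSup_mem h0)), fun t ht => ?_⟩
      have ht' := subset_tsupport _ ht
      exact ⟨csInf_le hK.bddBelow ht', le_csSup hK.bddAbove ht'⟩
  set g : ℝ → ℂ := fun t => Complex.exp (-(κ * t)) * (ψ : ℝ → ℂ) t with hg
  have hgs : ContDiff ℝ (⊤ : ℕ∞) g :=
    ((contDiff_const.mul Complex.ofRealCLM.contDiff).neg.cexp).mul (testSpace_contDiff ψ)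
  have hgsupp : ∀ t, t ∉ Set.Icc a b → g t = 0 := fun t ht => by
    have : (ψ : ℝ → ℂ) t = 0 := by
      by_contra h0
      exact ht (hsupp h0)
    simp [hg, this]
  -- The base point a - 1 lies strictly left of [a, b], so the half-open interval of integration
  -- still contains a.
  set G : ℝ → ℂ := fun t => ∫ s in (a - 1)..t, g s with hG
  have hGd : ∀ t, HasDerivAt G (g t) t := fun t =>
    hgs.continuous.integral_hasStrictDerivAt _ _ |>.hasDerivAt
  have hGs : ContDiff ℝ (⊤ : ℕ∞) G := by
    rw [contDiff_infty_iff_deriv]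
    exact ⟨fun t => (hGd t).differentiableAt, by rwa [funext fun t => (hGd t).deriv]⟩
  have hG0 : ∀ t, t ∉ Set.Icc a b → G t = 0 := by
    intro t ht
    by_cases hta : t < a
    · have : Set.EqOn g 0 (Set.uIcc (a - 1) t) := by
        intro s hs
        refine hgsupp s fun hs' => ?_
        rcases Set.mem_uIcc.1 hs with h1 | h1 <;> linarith [h1.2, hs'.1]
      simp only [hG]
      rw [intervalIntegral.integral_congr this]
      simp
    · have hbt : b < t := by
        by_contra h1
        exact ht ⟨not_lt.1 hta, not_lt.1 h1⟩
      simp only [hG]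
      rw [intervalIntegral.integral_eq_integral_of_support_subset, h]
      intro s hs
      have : s ∈ Set.Icc a b := by
        by_contra h1
        exact hs (hgsupp s h1)
      exact ⟨by linarith [this.1], by linarith [this.2]⟩
  set φ : ℝ → ℂ := fun t => -(Complex.exp (κ * t) * G t) with hφ
  have hφ0 : Function.support φ ⊆ Set.Icc a b := fun t ht => by
    by_contra h1
    exact ht (by simp [hφ, hG0 t h1])
  have hφt : tsupport φ ⊆ Set.Icc a b := closure_minimal hφ0 isClosed_Icc
  have hφs : ContDiff ℝ (⊤ : ℕ∞) φ :=
    (((contDiff_const.mul Complex.ofRealCLM.contDiff).cexp).mul hGs).neg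
  refine ⟨⟨φ, hφs, isCompact_Icc.of_isClosed_subset (isClosed_tsupport _) hφt, hφt.trans hab⟩, ?_⟩
  ext t
  rw [subDeriv_apply]
  have h3 : HasDerivAt (fun t : ℝ => Complex.exp (κ * t)) (Complex.exp (κ * t) * κ) t := by
    have h4 : HasDerivAt (fun t : ℝ => (κ : ℂ) * t) κ t := by
      simpa using ((Complex.ofRealCLM.hasDerivAt (x := t)).const_mul (κ : ℂ))
    exact h4.cexp
  have h5 : deriv φ t = _ := ((h3.mul (hGd t)).neg).deriv
  change κ * φ t - deriv φ t = _
  rw [h5]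
  simp only [hφ, hg]
  rw [← mul_assoc (Complex.exp _) (Complex.exp _), ← Complex.exp_add, add_neg_cancel,
    Complex.exp_zero]
  ring

theorem exists_testSpace_integral_ne_zero (hI : IsOpen I) (hne : I.Nonempty) (κ : ℝ) :
    ∃ χ : testSpace I, ∫ t : ℝ, Complex.exp (-(κ * t)) * (χ : ℝ → ℂ) t = 1 := by
  obtain ⟨c, hc⟩ := hne
  obtain ⟨δ, hδ, hball⟩ := Metric.isOpen_iff.1 hI c hc
  let f : ContDiffBump c := ⟨δ / 4, δ / 2, by positivity, by linarith⟩
  have hpos : 0 < ∫ t, f t := f.integral_pos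
  have hcd : ContDiff ℝ (⊤ : ℕ∞) (fun t : ℝ => Complex.exp (κ * t) * (f t : ℂ)) :=
    ((contDiff_const.mul Complex.ofRealCLM.contDiff).cexp).mul
      (Complex.ofRealCLM.contDiff.comp f.contDiff)
  have hts : tsupport (fun t : ℝ => Complex.exp (κ * t) * (f t : ℂ)) ⊆ closedBall c (δ / 2) := by
    refine closure_minimal (fun t ht => ?_) isClosed_closedBall
    have h1 : f t ≠ 0 := fun h => ht (by simp [h])
    have h2 : t ∈ Function.support f := h1
    rw [f.support_eq] at h2
    exact ball_subset_closedBall h2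
  let χ : testSpace I := ⟨_, hcd, (isCompact_closedBall c (δ / 2)).of_isClosed_subset
    (isClosed_tsupport _) hts, hts.trans ((closedBall_subset_ball (by linarith)).trans hball)⟩
  refine ⟨((∫ t, f t : ℝ) : ℂ)⁻¹ • χ, ?_⟩
  have : ∀ t : ℝ, Complex.exp (-(κ * t)) * ((((∫ t, f t : ℝ) : ℂ)⁻¹ • χ : testSpace I) : ℝ → ℂ) t
      = ((∫ t, f t : ℝ) : ℂ)⁻¹ * (f t : ℂ) := by
    intro t
    change Complex.exp (-(κ * t)) * (((∫ t, f t : ℝ) : ℂ)⁻¹ * (Complex.exp (κ * t) * (f t : ℂ))) = _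
    rw [Complex.exp_neg]
    have := Complex.exp_ne_zero (κ * t)
    field_simp
  rw [integral_congr_ae (.of_forall this), integral_const_mul, integral_complex_ofReal,
    inv_mul_cancel₀ (by exact_mod_cast hpos.ne')]

/-- The range of κ - d/dt is the kernel of integration against exp(-κt), a nonzero functional. A
functional vanishing on a hyperplane is a multiple of the one defining it. -/
theorem exists_const_of_subDeriv (hI : IsOpen I) (hI' : I.OrdConnected) (hne : I.Nonempty) (κ : ℝ)
    (T : testSpace I →ₗ[ℂ] ℂ) (hT : ∀ φ, T (subDeriv I κ φ) = 0) :
    ∃ c : ℂ, ∀ ψ : testSpace I, T ψ = c * ∫ t : ℝ, Complex.exp (-(κ * t)) * (ψ : ℝ → ℂ) t := by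
  obtain ⟨χ, hχ⟩ := exists_testSpace_integral_ne_zero hI hne κ
  have hc : Continuous fun t : ℝ => Complex.exp (-(κ * t)) := by fun_prop
  refine ⟨T χ, fun ψ => ?_⟩
  set m := ∫ t : ℝ, Complex.exp (-(κ * t)) * (ψ : ℝ → ℂ) t with hm
  obtain ⟨φ, hφ⟩ := exists_subDeriv_eq hI' κ (ψ - m • χ) (by
    have : ∀ t : ℝ, Complex.exp (-(κ * t)) * ((ψ - m • χ : testSpace I) : ℝ → ℂ) t =
        Complex.exp (-(κ * t)) * (ψ : ℝ → ℂ) t - m * (Complex.exp (-(κ * t)) * (χ : ℝ → ℂ) t) := by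
      intro t
      change _ * ((ψ : ℝ → ℂ) t - m * (χ : ℝ → ℂ) t) = _
      ring
    rw [integral_congr_ae (.of_forall this), integral_sub (integrable_mul_testSpace hc _)
      ((integrable_mul_testSpace hc _).const_mul _), integral_const_mul, hχ, ← hm]
    ring)
  have := hT φ
  rw [hφ, map_sub, map_smul, smul_eq_mul, sub_eq_zero] at this
  rw [this, mul_comm]

/-- Integration against a continuous function as a functional on test functions. -/
def integralAgainst (I : Set ℝ) (u : ℝ → ℂ) (hu : Continuous u) : testSpace I →ₗ[ℂ] ℂ where
  toFun φ := ∫ t, u t * (φ : ℝ → ℂ) t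
  map_add' φ ψ := by
    rw [← integral_add (integrable_mul_testSpace hu _) (integrable_mul_testSpace hu _)]
    refine integral_congr_ae (.of_forall fun t => ?_)
    exact mul_add (u t) ((φ : ℝ → ℂ) t) ((ψ : ℝ → ℂ) t)
  map_smul' c φ := by
    rw [RingHom.id_apply, smul_eq_mul, ← integral_const_mul]
    refine integral_congr_ae (.of_forall fun t => ?_)
    change u t * (c * (φ : ℝ → ℂ) t) = _
    ring

/-- One first-order factor is peeled off at a time. The induction hypothesis describes `T` composed
with that factor, an exponential polynomial solves the resulting transposed equation, and the
difference annihilates the range of the factor, which leaves one free constant. Only linearity of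
`T` is used, no continuity. -/
theorem exists_expPoly_of_mixedDeriv (hI : IsOpen I) (hI' : I.OrdConnected) (hne : I.Nonempty)
    {κ : ℝ} (hκ : κ ≠ 0) (p q : ℕ) :
    ∀ T : testSpace I →ₗ[ℂ] ℂ, (∀ φ, T (mixedDeriv I κ p q φ) = 0) →
      ∃ A ∈ Polynomial.degreeLT ℂ p, ∃ B ∈ Polynomial.degreeLT ℂ q,
        ∀ φ : testSpace I, T φ = ∫ t, expPoly κ A B t * (φ : ℝ → ℂ) t := by
  have hκ' : (κ : ℂ) ≠ 0 := by exact_mod_cast hκ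
  have hadd : ∀ (A B A' B' : Polynomial ℂ) (φ : testSpace I),
      ∫ t, expPoly κ (A + A') (B + B') t * (φ : ℝ → ℂ) t =
        (∫ t, expPoly κ A B t * (φ : ℝ → ℂ) t) + ∫ t, expPoly κ A' B' t * (φ : ℝ → ℂ) t := by
    intro A B A' B' φ
    rw [← integral_add (integrable_mul_testSpace (continuous_expPoly _ _ _) _)
      (integrable_mul_testSpace (continuous_expPoly _ _ _) _)]
    congr 1
    ext t
    simp only [expPoly, Polynomial.eval_add]
    ring
  induction p with
  | zero =>
    induction q with
    | zero =>
      intro T hT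
      refine ⟨0, Submodule.zero_mem _, 0, Submodule.zero_mem _, fun φ => ?_⟩
      simpa [mixedDeriv, expPoly] using hT φ
    | succ q ih =>
      intro T hT
      obtain ⟨A, hA, B, hB, h⟩ := ih (T ∘ₗ subDeriv I κ) fun φ => by
        rw [LinearMap.comp_apply, ← mixedDeriv_succ_right]; exact hT φ
      obtain rfl := degreeLT_zero_eq hA
      obtain ⟨Q, hQ, hQB⟩ := exists_derivative_eq hB
      obtain ⟨c, hc⟩ := exists_const_of_subDeriv hI hI' hne κ
        (T - integralAgainst I (expPoly κ 0 Q) (continuous_expPoly _ _ _)) fun φ => by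
          rw [LinearMap.sub_apply, sub_eq_zero]
          refine (h φ).trans ?_
          refine Eq.trans ?_ (integral_expPoly_mul_subDeriv κ 0 Q φ).symm
          simp [hQB]
      refine ⟨0, Submodule.zero_mem _, Q + Polynomial.C c, Submodule.add_mem _ hQ ?_, fun φ => ?_⟩
      · rw [Polynomial.mem_degreeLT]
        exact Polynomial.degree_C_le.trans_lt (by exact_mod_cast Nat.succ_pos q)
      · have h1 := hc φ
        rw [LinearMap.sub_apply, sub_eq_iff_eq_add'] at h1
        have h2 := hadd 0 Q 0 (Polynomial.C c) φ
        rw [add_zero] at h2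
        rw [h1, h2]
        congr 1
        rw [← integral_const_mul]
        congr 1
        ext t
        simp only [expPoly, Polynomial.eval_zero, Polynomial.eval_C]
        ring
  | succ p ih =>
    intro T hT
    obtain ⟨A, hA, B, hB, h⟩ := ih (T ∘ₗ testDeriv I) fun φ => by
      rw [LinearMap.comp_apply, ← mixedDeriv_succ_left]; exact hT φ
    obtain ⟨Q, hQ, hQA⟩ := exists_derivative_eq (Submodule.neg_mem _ hA)
    -- Here κ ≠ 0 is needed: undoing d/dt on exp(-κt) B must not raise the degree of B.
    obtain ⟨S, hS, hSB⟩ := exists_C_mul_sub_derivative_eq hκ' q B hB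
    -- The factor d/dt is the case κ = 0 up to sign, so the free constant is added to A.
    obtain ⟨c, hc⟩ := exists_const_of_subDeriv hI hI' hne 0
      (T - integralAgainst I (expPoly κ Q S) (continuous_expPoly _ _ _)) fun φ => by
        have h0 : subDeriv I 0 φ = -testDeriv I φ := by simp [subDeriv]
        rw [LinearMap.sub_apply, sub_eq_zero, h0, map_neg, map_neg]
        congr 1
        refine (h φ).trans ?_
        refine Eq.trans ?_ (integral_expPoly_mul_testDeriv κ Q S φ).symm
        rw [← integral_neg]
        congr 1
        ext t
        rw [hQA, ← neg_sub, hSB]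
        simp only [expPoly, Polynomial.eval_neg]
        ring
    refine ⟨Q + Polynomial.C c, Submodule.add_mem _ hQ ?_, S, hS, fun φ => ?_⟩
    · rw [Polynomial.mem_degreeLT]
      exact Polynomial.degree_C_le.trans_lt (by exact_mod_cast Nat.succ_pos p)
    · have h1 := hc φ
      rw [LinearMap.sub_apply, sub_eq_iff_eq_add'] at h1
      rw [h1, ← add_zero S, hadd]
      congr 1
      · simp [integralAgainst]
      · rw [← integral_const_mul]
        congr 1
        ext t
        simp [expPoly]

theorem eqOn_zero_of_integral_testSpace (hI : IsOpen I) {h : ℝ → ℂ} (hh : ContinuousOn h I)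
    (h0 : ∀ φ : testSpace I, ∫ t, h t * (φ : ℝ → ℂ) t = 0) : ∀ t ∈ I, h t = 0 := by
  have h1 := hI.ae_eq_zero_of_integral_contDiff_smul_eq_zero (μ := volume)
    (hh.locallyIntegrableOn hI.measurableSet) fun g hg hgc hgs => by
      have hts : tsupport (fun t => (g t : ℂ)) ⊆ I := by
        refine (closure_mono fun t ht => ?_).trans hgs
        exact fun h => ht (by simp [h])
      have := h0 ⟨fun t => (g t : ℂ), Complex.ofRealCLM.contDiff.comp hg,
        hgc.comp_left (g := ((↑) : ℝ → ℂ)) Complex.ofReal_zero, hts⟩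
      rw [← this]
      congr 1
      ext t
      rw [Complex.real_smul, mul_comm]
  have h2 : h =ᵐ[volume.restrict I] fun _ => 0 := by
    rw [Filter.EventuallyEq, ae_restrict_iff' hI.measurableSet]
    exact h1
  exact Measure.eqOn_open_of_ae_eq h2 hI hh continuousOn_const

end

/-! ### Polynomials in z and z̄: differential calculus and bidegree. -/

section

variable {n : ℕ}

/-! ### Polynomials in `z` and `z̄` -/

/-- Polynomials in `z_j` (the variables `inl j`) and `z̄_j` (the variables `inr j`). -/
abbrev PolyRing (n : ℕ) : Type := MvPolynomial (Fin n ⊕ Fin n) ℂ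

/-- The function on `ℂⁿ` defined by a polynomial in `z` and `z̄`. -/
def ev (p : PolyRing n) (z : Cn n) : ℂ :=
  MvPolynomial.eval (Sum.elim (fun i => z i) (fun i => conj (z i))) p

@[simp] theorem ev_add (p q : PolyRing n) (z : Cn n) : ev (p + q) z = ev p z + ev q z := map_add _ _ _
@[simp] theorem ev_mul (p q : PolyRing n) (z : Cn n) : ev (p * q) z = ev p z * ev q z := map_mul _ _ _
@[simp] theorem ev_pow (p : PolyRing n) (k : ℕ) (z : Cn n) : ev (p ^ k) z = ev p z ^ k := map_pow _ _ _
@[simp] theorem ev_zero (z : Cn n) : ev (0 : PolyRing n) z = 0 := map_zero _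
@[simp] theorem ev_one (z : Cn n) : ev (1 : PolyRing n) z = 1 := map_one _
@[simp] theorem ev_C (c : ℂ) (z : Cn n) : ev (MvPolynomial.C c : PolyRing n) z = c :=
  MvPolynomial.eval_C _
@[simp] theorem ev_X_inl (j : Fin n) (z : Cn n) : ev (MvPolynomial.X (.inl j) : PolyRing n) z = z j :=
  MvPolynomial.eval_X _
@[simp] theorem ev_X_inr (j : Fin n) (z : Cn n) :
    ev (MvPolynomial.X (.inr j) : PolyRing n) z = conj (z j) :=
  MvPolynomial.eval_X _
@[simp] theorem ev_sum {ι : Type*} (s : Finset ι) (p : ι → PolyRing n) (z : Cn n) :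
    ev (∑ i ∈ s, p i) z = ∑ i ∈ s, ev (p i) z := map_sum (MvPolynomial.eval _) _ _
@[simp] theorem ev_smul (c : ℂ) (p : PolyRing n) (z : Cn n) : ev (c • p) z = c * ev p z :=
  MvPolynomial.smul_eval _ _ _

/-- The derivative `∂/∂z_j`. -/
abbrev dz (j : Fin n) : Derivation ℂ (PolyRing n) (PolyRing n) := MvPolynomial.pderiv (.inl j)

/-- The derivative `∂/∂z̄_j`. -/
abbrev dzb (j : Fin n) : Derivation ℂ (PolyRing n) (PolyRing n) := MvPolynomial.pderiv (.inr j)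

/-- The derivative in the real direction `v`. -/
def dirDeriv (v : Cn n) : Derivation ℂ (PolyRing n) (PolyRing n) :=
  ∑ j, (v j • dz j + conj (v j) • dzb j)

theorem dirDeriv_apply (v : Cn n) (p : PolyRing n) :
    dirDeriv v p = ∑ j, (v j • dz j p + conj (v j) • dzb j p) := by
  have h := congrFun (map_sum (Derivation.coeFnAddMonoidHom (R := ℂ) (A := PolyRing n)
    (M := PolyRing n)) (fun j => v j • dz j + conj (v j) • dzb j) Finset.univ) p
  rw [Finset.sum_apply] at h
  exact h

/-- This links formal derivations to real derivatives. Both satisfy the Leibniz rule, so agreement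
on the variables suffices. -/
theorem exists_hasFDerivAt_ev (p : PolyRing n) (z : Cn n) :
    ∃ L : Cn n →L[ℝ] ℂ, HasFDerivAt (ev p) L z ∧ ∀ v, L v = ev (dirDeriv v p) z := by
  induction p using MvPolynomial.induction_on with
  | C a =>
    refine ⟨0, ?_, fun v => ?_⟩
    · rw [funext (ev_C a)]
      exact hasFDerivAt_const a z
    · simp
  | add p q hp hq =>
    obtain ⟨L, hL, hL'⟩ := hp
    obtain ⟨M, hM, hM'⟩ := hq
    refine ⟨L + M, ?_, fun v => ?_⟩
    · rw [funext (ev_add p q)]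
      exact hL.add hM
    · simp [hL', hM']
  | mul_X p i hp =>
    obtain ⟨L, hL, hL'⟩ := hp
    obtain ⟨M, hM, hM'⟩ : ∃ M : Cn n →L[ℝ] ℂ,
        HasFDerivAt (ev (MvPolynomial.X i : PolyRing n)) M z ∧
          ∀ v, M v = ev (dirDeriv v (MvPolynomial.X i)) z := by
      rcases i with i | i
      · refine ⟨(EuclideanSpace.proj i : Cn n →L[ℂ] ℂ).restrictScalars ℝ, ?_, fun v => ?_⟩
        · rw [funext (ev_X_inl i)]
          exact ((EuclideanSpace.proj i : Cn n →L[ℂ] ℂ).restrictScalars ℝ).hasFDerivAt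
        · simp [dirDeriv_apply, MvPolynomial.pderiv_X, Pi.single_apply]
      · refine ⟨(Complex.conjCLE : ℂ →L[ℝ] ℂ).comp
          ((EuclideanSpace.proj i : Cn n →L[ℂ] ℂ).restrictScalars ℝ), ?_, fun v => ?_⟩
        · rw [funext (ev_X_inr i)]
          exact ((Complex.conjCLE : ℂ →L[ℝ] ℂ).comp
            ((EuclideanSpace.proj i : Cn n →L[ℂ] ℂ).restrictScalars ℝ)).hasFDerivAt
        · simp [dirDeriv_apply, MvPolynomial.pderiv_X, Pi.single_apply]
    refine ⟨ev p z • M + ev (MvPolynomial.X i) z • L, ?_, fun v => ?_⟩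
    · rw [funext (ev_mul p (MvPolynomial.X i))]
      exact hL.mul hM
    · simp [hL', hM', Derivation.leibniz]

theorem hasFDerivAt_ev (p : PolyRing n) (z : Cn n) : HasFDerivAt (ev p) (fderiv ℝ (ev p) z) z := by
  obtain ⟨L, hL, -⟩ := exists_hasFDerivAt_ev p z
  exact hL.differentiableAt.hasFDerivAt

theorem fderiv_ev_apply (p : PolyRing n) (z v : Cn n) :
    fderiv ℝ (ev p) z v = ev (dirDeriv v p) z := by
  obtain ⟨L, hL, hL'⟩ := exists_hasFDerivAt_ev p z
  rw [hL.fderiv, hL']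

theorem contDiff_ev (p : PolyRing n) {m : WithTop ℕ∞} : ContDiff ℝ m (ev p) := by
  induction p using MvPolynomial.induction_on with
  | C a => rw [funext (ev_C a)]; exact contDiff_const
  | add p q hp hq => rw [funext (ev_add p q)]; exact hp.add hq
  | mul_X p i hp =>
    rw [funext (ev_mul p _)]
    refine hp.mul ?_
    have h : ∀ i : Fin n, ContDiff ℝ m (fun z : Cn n => z i) := fun i =>
      ((EuclideanSpace.proj i : Cn n →L[ℂ] ℂ).restrictScalars ℝ).contDiff
    rcases i with i | i
    · rw [funext (ev_X_inl i)]; exact h i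
    · rw [funext (ev_X_inr i)]; exact Complex.conjCLE.contDiff.comp (h i)

@[fun_prop] theorem continuous_ev (p : PolyRing n) : Continuous (ev p) :=
  (contDiff_ev p (m := 0)).continuous

theorem pderiv_comm (i j : Fin n ⊕ Fin n) (p : PolyRing n) :
    MvPolynomial.pderiv i (MvPolynomial.pderiv j p) =
      MvPolynomial.pderiv j (MvPolynomial.pderiv i p) := by
  have h : ⁅(MvPolynomial.pderiv i : Derivation ℂ (PolyRing n) (PolyRing n)),
      (MvPolynomial.pderiv j : Derivation ℂ (PolyRing n) (PolyRing n))⁆ = 0 := by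
    refine MvPolynomial.derivation_ext (R := ℂ) fun k => ?_
    rw [Derivation.commutator_apply, MvPolynomial.pderiv_X, MvPolynomial.pderiv_X]
    simp only [Pi.single_apply]
    split_ifs <;> simp
  have h1 := congrArg (fun D : Derivation ℂ (PolyRing n) (PolyRing n) => D p) h
  simpa [Derivation.commutator_apply, sub_eq_zero] using h1

/-- A quarter of the Laplacian, `∑ ∂²/∂z_j∂z̄_j`. -/
def lap (p : PolyRing n) : PolyRing n := ∑ j, dz j (dzb j p)

theorem lap_eq (p : PolyRing n) : lap p = ∑ j, dzb j (dz j p) :=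
  Finset.sum_congr rfl fun _ _ => pderiv_comm _ _ _

theorem dirDeriv_single (j : Fin n) (c : ℂ) (p : PolyRing n) :
    dirDeriv (EuclideanSpace.single j c) p = c • dz j p + conj c • dzb j p := by
  rw [dirDeriv_apply, Finset.sum_eq_single j]
  · simp
  · intro k _ hk
    simp [hk]
  · simp

/-- In the real orthonormal basis e_j, i e_j the two second derivatives add to 4 ∂²/∂z_j∂z̄_j; the
pure ∂² and ∂̄² terms cancel because i² = -1. -/
theorem laplacian_ev (p : PolyRing n) (z : Cn n) : Δ (ev p) z = 4 * ev (lap p) z := by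
  have hsecond : ∀ v : Cn n, iteratedFDeriv ℝ 2 (ev p) z ![v, v] =
      ev (dirDeriv v (dirDeriv v p)) z := by
    intro v
    rw [iteratedFDeriv_two_apply]
    have h1 : DifferentiableAt ℝ (fderiv ℝ (ev p)) z :=
      ((contDiff_ev p (m := 2)).fderiv_right (m := 1) (by norm_num)).differentiable (by norm_num) z
    have h2 : fderiv ℝ (fun y => fderiv ℝ (ev p) y v) z = (fderiv ℝ (fderiv ℝ (ev p)) z).flip v := by
      ext w
      rw [fderiv_clm_apply h1 (differentiableAt_const v)]
      simp
    have h4 := congrArg (fun L : Cn n →L[ℝ] ℂ => L v) h2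
    simp only [fderiv_ev_apply, ContinuousLinearMap.flip_apply] at h4
    simpa using h4.symm
  rw [laplacian_eq_iteratedFDeriv_orthonormalBasis _
    (Pi.orthonormalBasis fun _ : Fin n => Complex.orthonormalBasisOneI)]
  simp only [hsecond]
  rw [Fintype.sum_sigma, lap, ev_sum, Finset.mul_sum]
  refine Finset.sum_congr rfl fun j _ => ?_
  rw [Fin.sum_univ_two]
  have e0 : (Pi.orthonormalBasis fun _ : Fin n => Complex.orthonormalBasisOneI) ⟨j, 0⟩ =
      EuclideanSpace.single j (1 : ℂ) := by
    simp [EuclideanSpace.single]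
  have e1 : (Pi.orthonormalBasis fun _ : Fin n => Complex.orthonormalBasisOneI) ⟨j, 1⟩ =
      EuclideanSpace.single j Complex.I := by
    simp [EuclideanSpace.single]
  rw [e0, e1]
  have hcomm : dzb j (dz j p) = dz j (dzb j p) := pderiv_comm _ _ _
  simp only [dirDeriv_single, map_add, Derivation.map_smul, smul_add, smul_smul, ev_add, ev_smul,
    hcomm, map_one, Complex.conj_I]
  linear_combination (ev (dz j (dz j p)) z + ev (dzb j (dzb j p)) z - 2 * ev (dz j (dzb j p)) z) * Complex.I_mul_I

/-! ### Bihomogeneous polynomials -/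

/-- The weights giving the bidegree in `(z, z̄)`. -/
def biweight (n : ℕ) : Fin n ⊕ Fin n → ℕ × ℕ := Sum.elim (fun _ => (1, 0)) (fun _ => (0, 1))

/-- Polynomials of degree `a` in `z` and `b` in `z̄`. -/
def IsBihom (p : PolyRing n) (a b : ℕ) : Prop :=
  MvPolynomial.IsWeightedHomogeneous (biweight n) p (a, b)

theorem IsBihom.mul {p q : PolyRing n} {a b a' b' : ℕ} (hp : IsBihom p a b) (hq : IsBihom q a' b') :
    IsBihom (p * q) (a + a') (b + b') :=
  MvPolynomial.IsWeightedHomogeneous.mul hp hq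

theorem IsBihom.add {p q : PolyRing n} {a b : ℕ} (hp : IsBihom p a b) (hq : IsBihom q a b) :
    IsBihom (p + q) a b :=
  (MvPolynomial.weightedHomogeneousSubmodule ℂ (biweight n) (a, b)).add_mem hp hq

theorem IsBihom.smul {p : PolyRing n} {a b : ℕ} (c : ℂ) (hp : IsBihom p a b) :
    IsBihom (c • p) a b :=
  (MvPolynomial.weightedHomogeneousSubmodule ℂ (biweight n) (a, b)).smul_mem c hp

theorem IsBihom.sub {p q : PolyRing n} {a b : ℕ} (hp : IsBihom p a b) (hq : IsBihom q a b) :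
    IsBihom (p - q) a b :=
  (MvPolynomial.weightedHomogeneousSubmodule ℂ (biweight n) (a, b)).sub_mem hp hq

theorem IsBihom.sum {ι : Type*} {s : Finset ι} {p : ι → PolyRing n} {a b : ℕ}
    (hp : ∀ i ∈ s, IsBihom (p i) a b) : IsBihom (∑ i ∈ s, p i) a b :=
  (MvPolynomial.weightedHomogeneousSubmodule ℂ (biweight n) (a, b)).sum_mem hp

theorem isBihom_zero (a b : ℕ) : IsBihom (0 : PolyRing n) a b :=
  MvPolynomial.isWeightedHomogeneous_zero _ _ _

theorem isBihom_one : IsBihom (1 : PolyRing n) 0 0 :=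
  MvPolynomial.isWeightedHomogeneous_one _ _

theorem isBihom_X_inl (j : Fin n) : IsBihom (MvPolynomial.X (.inl j) : PolyRing n) 1 0 :=
  MvPolynomial.isWeightedHomogeneous_X _ _ _

theorem isBihom_X_inr (j : Fin n) : IsBihom (MvPolynomial.X (.inr j) : PolyRing n) 0 1 :=
  MvPolynomial.isWeightedHomogeneous_X _ _ _

theorem IsBihom.pow {p : PolyRing n} {a b : ℕ} (hp : IsBihom p a b) (k : ℕ) :
    IsBihom (p ^ k) (k * a) (k * b) := by
  have := MvPolynomial.IsWeightedHomogeneous.pow hp k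
  simpa [IsBihom] using this

theorem IsBihom.fst {p : PolyRing n} {a b : ℕ} (hp : IsBihom p a b) :
    MvPolynomial.IsWeightedHomogeneous (fun i => (biweight n i).1) p a := by
  intro d hd
  have := congrArg Prod.fst (hp hd)
  rw [Finsupp.weight_apply, Finsupp.sum, Prod.fst_sum] at this
  rw [Finsupp.weight_apply, Finsupp.sum]
  exact this

theorem IsBihom.snd {p : PolyRing n} {a b : ℕ} (hp : IsBihom p a b) :
    MvPolynomial.IsWeightedHomogeneous (fun i => (biweight n i).2) p b := by
  intro d hd
  have := congrArg Prod.snd (hp hd)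
  rw [Finsupp.weight_apply, Finsupp.sum, Prod.snd_sum] at this
  rw [Finsupp.weight_apply, Finsupp.sum]
  exact this

theorem IsBihom.euler_z {p : PolyRing n} {a b : ℕ} (hp : IsBihom p a b) :
    ∑ j, MvPolynomial.X (.inl j) * dz j p = (a : ℂ) • p := by
  have := hp.fst.sum_weight_X_mul_pderiv
  rw [Fintype.sum_sum_type] at this
  simpa [biweight, ← Nat.cast_smul_eq_nsmul ℂ] using this

theorem IsBihom.euler_zb {p : PolyRing n} {a b : ℕ} (hp : IsBihom p a b) :
    ∑ j, MvPolynomial.X (.inr j) * dzb j p = (b : ℂ) • p := by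
  have := hp.snd.sum_weight_X_mul_pderiv
  rw [Fintype.sum_sum_type] at this
  simpa [biweight, ← Nat.cast_smul_eq_nsmul ℂ] using this

theorem pderiv_eq_zero_of_forall_support {p : PolyRing n} {i : Fin n ⊕ Fin n}
    (h : ∀ d ∈ p.support, d i = 0) : MvPolynomial.pderiv i p = 0 := by
  rw [p.as_sum, map_sum]
  refine Finset.sum_eq_zero fun d hd => ?_
  rw [MvPolynomial.pderiv_monomial, h d hd]
  simp

theorem IsBihom.dz_eq_zero {p : PolyRing n} {b : ℕ} (hp : IsBihom p 0 b) (j : Fin n) :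
    dz j p = 0 := by
  refine pderiv_eq_zero_of_forall_support fun d hd => ?_
  have h1 := hp.fst (MvPolynomial.mem_support_iff.1 hd)
  rw [Finsupp.weight_apply, Finsupp.sum_fintype _ _ (by simp), Fintype.sum_sum_type] at h1
  simp only [biweight, Sum.elim_inl, Sum.elim_inr, smul_eq_mul, mul_one, mul_zero,
    Finset.sum_const_zero, add_zero, Finset.sum_eq_zero_iff] at h1
  exact h1 j (Finset.mem_univ j)

theorem IsBihom.dzb_eq_zero {p : PolyRing n} {a : ℕ} (hp : IsBihom p a 0) (j : Fin n) :
    dzb j p = 0 := by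
  refine pderiv_eq_zero_of_forall_support fun d hd => ?_
  have h1 := hp.snd (MvPolynomial.mem_support_iff.1 hd)
  rw [Finsupp.weight_apply, Finsupp.sum_fintype _ _ (by simp), Fintype.sum_sum_type] at h1
  simp only [biweight, Sum.elim_inl, Sum.elim_inr, smul_eq_mul, mul_one, mul_zero,
    Finset.sum_const_zero, zero_add, Finset.sum_eq_zero_iff] at h1
  exact h1 j (Finset.mem_univ j)

theorem IsBihom.dz {p : PolyRing n} {a b : ℕ} (hp : IsBihom p a b) (j : Fin n) :
    IsBihom (dz j p) (a - 1) b := by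
  rcases a with _ | a
  · rw [hp.dz_eq_zero]; exact isBihom_zero _ _
  · exact MvPolynomial.IsWeightedHomogeneous.pderiv hp (by simp [biweight])

theorem IsBihom.dzb {p : PolyRing n} {a b : ℕ} (hp : IsBihom p a b) (j : Fin n) :
    IsBihom (dzb j p) a (b - 1) := by
  rcases b with _ | b
  · rw [hp.dzb_eq_zero]; exact isBihom_zero _ _
  · exact MvPolynomial.IsWeightedHomogeneous.pderiv hp (by simp [biweight])

theorem IsBihom.lap {p : PolyRing n} {a b : ℕ} (hp : IsBihom p a b) :
    IsBihom (lap p) (a - 1) (b - 1) := IsBihom.sum fun j _ => (hp.dzb j).dz j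

theorem IsBihom.lap_eq_zero_left {p : PolyRing n} {b : ℕ} (hp : IsBihom p 0 b) :
    TwistedMeans.lap p = 0 := Finset.sum_eq_zero fun j _ => (hp.dzb j).dz_eq_zero j

theorem IsBihom.lap_eq_zero_right {p : PolyRing n} {a : ℕ} (hp : IsBihom p a 0) :
    TwistedMeans.lap p = 0 := Finset.sum_eq_zero fun j _ => by rw [hp.dzb_eq_zero, map_zero]

theorem IsBihom.eq_C {p : PolyRing n} (hp : IsBihom p 0 0) : ∃ c : ℂ, p = MvPolynomial.C c := by
  refine ⟨MvPolynomial.coeff 0 p, MvPolynomial.ext _ _ fun d => ?_⟩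
  rw [MvPolynomial.coeff_C]
  split_ifs with h
  · rw [h]
  · by_contra hd
    refine h ?_
    have h1 := hp.fst hd
    have h2 := hp.snd hd
    rw [Finsupp.weight_apply, Finsupp.sum_fintype _ _ (by simp), Fintype.sum_sum_type] at h1 h2
    simp only [biweight, Sum.elim_inl, Sum.elim_inr, smul_eq_mul, mul_one, mul_zero,
      Finset.sum_const_zero, zero_add, add_zero, Finset.sum_eq_zero_iff] at h1 h2
    ext (j | j)
    · exact (h1 j (Finset.mem_univ j)).symm
    · exact (h2 j (Finset.mem_univ j)).symm

theorem IsBihom.ev_smul {p : PolyRing n} {a b : ℕ} (hp : IsBihom p a b) (ρ : ℝ) (z : Cn n) :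
    ev p (ρ • z) = (ρ : ℂ) ^ (a + b) * ev p z := by
  rw [ev, ev, MvPolynomial.eval_eq, MvPolynomial.eval_eq, Finset.mul_sum]
  refine Finset.sum_congr rfl fun d hd => ?_
  have h1 := hp.fst (MvPolynomial.mem_support_iff.1 hd)
  have h2 := hp.snd (MvPolynomial.mem_support_iff.1 hd)
  rw [Finsupp.weight_apply, Finsupp.sum_fintype _ _ (by simp), Fintype.sum_sum_type] at h1 h2
  simp only [biweight, Sum.elim_inl, Sum.elim_inr, smul_eq_mul, mul_one, mul_zero,
      Finset.sum_const_zero, zero_add, add_zero] at h1 h2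
  have h3 : ∏ i : Fin n ⊕ Fin n, (ρ : ℂ) ^ d i = (ρ : ℂ) ^ (a + b) := by
    rw [Finset.prod_pow_eq_pow_sum, Fintype.sum_sum_type, h1, h2]
  have h4 : ∀ i, Sum.elim (fun i => (ρ • z) i) (fun i => conj ((ρ • z) i)) i =
      (ρ : ℂ) * Sum.elim (fun i => z i) (fun i => conj (z i)) i := by
    rintro (i | i) <;> simp
  have h5 : ∏ i ∈ d.support, (ρ : ℂ) ^ d i = ∏ i, (ρ : ℂ) ^ d i := by
    refine Finset.prod_subset (Finset.subset_univ _) fun i _ hi => ?_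
    rw [Finsupp.notMem_support_iff.1 hi, pow_zero]
  simp only [h4, mul_pow, Finset.prod_mul_distrib]
  rw [← h3, h5]
  ring

end

/-! ### Gaussian integrals: transposition rules, orthogonality and the reproducing property. -/

section

variable {n : ℕ}

/-! ### The Gaussian functional -/

/-- The polynomial `∑ z_j z̄_j`. -/
def nrm (n : ℕ) : PolyRing n := ∑ j, MvPolynomial.X (.inl j) * MvPolynomial.X (.inr j)

theorem isBihom_nrm : IsBihom (nrm n) 1 1 :=
  IsBihom.sum fun j _ => (isBihom_X_inl j).mul (isBihom_X_inr j)

theorem ev_nrm (z : Cn n) : ev (nrm n) z = ((‖z‖ ^ 2 : ℝ) : ℂ) := by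
  rw [nrm, ev_sum, EuclideanSpace.norm_sq_eq]
  push_cast
  refine Finset.sum_congr rfl fun j _ => ?_
  rw [ev_mul, ev_X_inl, ev_X_inr, Complex.mul_conj']

theorem exists_norm_ev_le (p : PolyRing n) :
    ∃ (C : ℝ) (N : ℕ), 0 ≤ C ∧ ∀ z, ‖ev p z‖ ≤ C * (1 + ‖z‖) ^ N := by
  induction p using MvPolynomial.induction_on with
  | C a => exact ⟨‖a‖, 0, norm_nonneg _, fun z => by simp⟩
  | add p q hp hq =>
    obtain ⟨C, N, hC, h⟩ := hp
    obtain ⟨C', N', hC', h'⟩ := hq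
    refine ⟨C + C', N + N', by positivity, fun z => ?_⟩
    rw [ev_add, add_mul]
    have h1 : (1 : ℝ) ≤ 1 + ‖z‖ := by linarith [norm_nonneg z]
    refine (norm_add_le _ _).trans (add_le_add ((h z).trans ?_) ((h' z).trans ?_))
    · gcongr
      lia
    · gcongr
      lia
  | mul_X p i hp =>
    obtain ⟨C, N, hC, h⟩ := hp
    refine ⟨C, N + 1, hC, fun z => ?_⟩
    rw [ev_mul, norm_mul, pow_succ, ← mul_assoc]
    have h2 : ∀ j, ‖z j‖ ≤ 1 + ‖z‖ := fun j => by linarith [PiLp.norm_apply_le z j]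
    refine mul_le_mul (h z) ?_ (norm_nonneg _) (by positivity)
    rcases i with i | i
    · rw [ev_X_inl]; exact h2 i
    · rw [ev_X_inr, RCLike.norm_conj]; exact h2 i

theorem integrable_ev_mul_gaussian (p : PolyRing n) :
    Integrable fun z : Cn n => ev p z * Complex.exp (-ev (nrm n) z) := by
  obtain ⟨C, N, hC, h⟩ := exists_norm_ev_le p
  have h0 := GaussianFourier.integrable_cexp_neg_mul_sq_norm_add (V := Cn n) (b := (1 / 2 : ℂ))
    (by norm_num) 0 0
  refine (h0.norm.const_mul (C * N.factorial * Real.exp 2)).mono' ?_ (.of_forall fun z => ?_)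
  · exact ((continuous_ev p).mul (continuous_ev _).neg.cexp).aestronglyMeasurable
  · rw [norm_mul, ev_nrm, Complex.norm_exp, Complex.norm_exp]
    have h1 : (1 + ‖z‖) ^ N ≤ N.factorial * Real.exp (1 + ‖z‖) := by
      have := Real.pow_div_factorial_le_exp (1 + ‖z‖) (by positivity) N
      rwa [div_le_iff₀' (by positivity)] at this
    have h2 : (-(((‖z‖ ^ 2 : ℝ) : ℂ))).re = -‖z‖ ^ 2 := by
      rw [← Complex.ofReal_neg, Complex.ofReal_re]
    have h3 : (-(1 / 2 : ℂ) * (‖z‖ : ℂ) ^ 2 + 0 * ((⟪(0 : Cn n), z⟫_ℝ : ℝ) : ℂ)).re =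
        -(‖z‖ ^ 2 / 2) := by
      rw [zero_mul, add_zero, show -(1 / 2 : ℂ) * (‖z‖ : ℂ) ^ 2 = ((-(‖z‖ ^ 2 / 2) : ℝ) : ℂ) by
        push_cast; ring, Complex.ofReal_re]
    rw [h2, h3]
    calc ‖ev p z‖ * Real.exp (-‖z‖ ^ 2)
        ≤ C * (N.factorial * Real.exp (1 + ‖z‖)) * Real.exp (-‖z‖ ^ 2) := by
          gcongr
          exact (h z).trans (by gcongr)
      _ = C * N.factorial * Real.exp (1 + ‖z‖ - ‖z‖ ^ 2) := by
          rw [sub_eq_add_neg, Real.exp_add (1 + ‖z‖)]; ring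
      -- With x = |z|, the difference of the exponents is ((x - 1)² + 1)/2.
      _ ≤ C * N.factorial * Real.exp (2 + -(‖z‖ ^ 2 / 2)) := by
          gcongr
          nlinarith [sq_nonneg (‖z‖ - 1)]
      _ = _ := by rw [Real.exp_add]; ring

/-- The integral of a polynomial against the Gaussian weight `exp(-|z|²)`. -/
def gaussInt (n : ℕ) : PolyRing n →ₗ[ℂ] ℂ where
  toFun p := ∫ z, ev p z * Complex.exp (-ev (nrm n) z)
  map_add' p q := by
    rw [← integral_add (integrable_ev_mul_gaussian p) (integrable_ev_mul_gaussian q)]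
    simp only [ev_add, add_mul]
  map_smul' c p := by
    rw [RingHom.id_apply, smul_eq_mul, ← integral_const_mul]
    simp only [ev_smul, mul_assoc]

theorem gaussInt_congr {p q : PolyRing n} (h : ∀ z, ev p z = ev q z) :
    gaussInt n p = gaussInt n q := by
  change ∫ z, ev p z * _ = ∫ z, ev q z * _
  simp only [h]

theorem gaussInt_dirDeriv (v : Cn n) (p : PolyRing n) :
    gaussInt n (dirDeriv v p) = gaussInt n (p * dirDeriv v (nrm n)) := by
  have hE : ∀ z, HasFDerivAt (fun z : Cn n => Complex.exp (-ev (nrm n) z))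
      (Complex.exp (-ev (nrm n) z) • -(fderiv ℝ (ev (nrm n)) z)) z := fun z =>
    (hasFDerivAt_ev (nrm n) z).neg.cexp
  have hE' : ∀ z, ev p z * fderiv ℝ (fun z : Cn n => Complex.exp (-ev (nrm n) z)) z v =
      -(ev (p * dirDeriv v (nrm n)) z * Complex.exp (-ev (nrm n) z)) := by
    intro z
    rw [(hE z).fderiv, smul_apply, neg_apply,
      fderiv_ev_apply, ev_mul, smul_eq_mul]
    ring
  have key := integral_mul_fderiv_eq_neg_fderiv_mul_of_integrable (μ := (volume : Measure (Cn n)))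
    (f := ev p) (g := fun z : Cn n => Complex.exp (-ev (nrm n) z)) (v := v)
    (by simp only [fderiv_ev_apply]; exact integrable_ev_mul_gaussian _)
    (by simp only [hE']; exact (integrable_ev_mul_gaussian _).neg)
    (integrable_ev_mul_gaussian p)
    (fun z _ => (hasFDerivAt_ev p z).differentiableAt) (fun z _ => (hE z).differentiableAt)
  simp only [hE', fderiv_ev_apply, integral_neg, neg_inj] at key
  exact key.symm

theorem dz_nrm (j : Fin n) : dz j (nrm n) = MvPolynomial.X (.inr j) := by
  rw [nrm, map_sum, Finset.sum_eq_single j]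
  · simp [Derivation.leibniz, MvPolynomial.pderiv_X]
  · intro k _ hk
    simp [Derivation.leibniz, MvPolynomial.pderiv_X, hk]
  · simp

theorem dzb_nrm (j : Fin n) : dzb j (nrm n) = MvPolynomial.X (.inl j) := by
  rw [nrm, map_sum, Finset.sum_eq_single j]
  · simp [Derivation.leibniz, MvPolynomial.pderiv_X]
  · intro k _ hk
    simp [Derivation.leibniz, MvPolynomial.pderiv_X, hk]
  · simp

/-- Integration by parts in the real directions e_j and i e_j; their complex combinations isolate
∂/∂z_j and ∂/∂z̄_j. These rules replace all direct computation of Gaussian integrals below. -/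
theorem gaussInt_dz_and_dzb (j : Fin n) (p : PolyRing n) :
    gaussInt n (dz j p) = gaussInt n (MvPolynomial.X (.inr j) * p) ∧
      gaussInt n (dzb j p) = gaussInt n (MvPolynomial.X (.inl j) * p) := by
  have h1 := gaussInt_dirDeriv (EuclideanSpace.single j (1 : ℂ)) p
  have h2 := gaussInt_dirDeriv (EuclideanSpace.single j Complex.I) p
  simp only [dirDeriv_single, dz_nrm, dzb_nrm, mul_add, mul_smul_comm, map_add, map_smul, map_one,
    Complex.conj_I, smul_eq_mul, one_mul] at h1 h2
  rw [mul_comm _ p, mul_comm _ p]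
  have hI := Complex.I_mul_I
  constructor
  · linear_combination (1 / 2 : ℂ) * h1 - (Complex.I / 2) * h2 +
      (gaussInt n (dz j p) - gaussInt n (dzb j p) + gaussInt n (p * MvPolynomial.X (.inl j)) -
        gaussInt n (p * MvPolynomial.X (.inr j))) / 2 * hI
  · linear_combination (1 / 2 : ℂ) * h1 + (Complex.I / 2) * h2 -
      (gaussInt n (dz j p) - gaussInt n (dzb j p) + gaussInt n (p * MvPolynomial.X (.inl j)) -
        gaussInt n (p * MvPolynomial.X (.inr j))) / 2 * hI

theorem gaussInt_X_inr_mul (j : Fin n) (p : PolyRing n) :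
    gaussInt n (MvPolynomial.X (.inr j) * p) = gaussInt n (dz j p) :=
  (gaussInt_dz_and_dzb j p).1.symm

theorem gaussInt_X_inl_mul (j : Fin n) (p : PolyRing n) :
    gaussInt n (MvPolynomial.X (.inl j) * p) = gaussInt n (dzb j p) :=
  (gaussInt_dz_and_dzb j p).2.symm

/-! ### Harmonic polynomials -/

/-- The function defined by `p` is harmonic. -/
def IsHarm (p : PolyRing n) : Prop := ∀ z, ev (lap p) z = 0

theorem ev_dirDeriv_eq_zero {p : PolyRing n} (h : ∀ z, ev p z = 0) (v z : Cn n) :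
    ev (dirDeriv v p) z = 0 := by
  rw [← fderiv_ev_apply, show ev p = fun _ => 0 from funext h]
  simp

theorem ev_dz_and_dzb_eq_zero {p : PolyRing n} (h : ∀ z, ev p z = 0) (j : Fin n) (z : Cn n) :
    ev (dz j p) z = 0 ∧ ev (dzb j p) z = 0 := by
  have h1 := ev_dirDeriv_eq_zero h (EuclideanSpace.single j (1 : ℂ)) z
  have h2 := ev_dirDeriv_eq_zero h (EuclideanSpace.single j Complex.I) z
  simp only [dirDeriv_single, ev_add, ev_smul, map_one, Complex.conj_I, one_mul] at h1 h2
  have hI := Complex.I_mul_I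
  constructor
  · linear_combination (1 / 2 : ℂ) * h1 - (Complex.I / 2) * h2 +
      (ev (dz j p) z - ev (dzb j p) z) / 2 * hI
  · linear_combination (1 / 2 : ℂ) * h1 + (Complex.I / 2) * h2 -
      (ev (dz j p) z - ev (dzb j p) z) / 2 * hI

theorem lap_pderiv (p : PolyRing n) (i : Fin n ⊕ Fin n) :
    lap (MvPolynomial.pderiv i p) = MvPolynomial.pderiv i (lap p) := by
  rw [lap, lap, map_sum]
  refine Finset.sum_congr rfl fun j _ => ?_
  rw [pderiv_comm (.inr j) i p, pderiv_comm (.inl j) i]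

theorem IsHarm.dz {p : PolyRing n} (h : IsHarm p) (j : Fin n) : IsHarm (dz j p) := fun z => by
  rw [lap_pderiv]; exact (ev_dz_and_dzb_eq_zero h j z).1

theorem IsHarm.dzb {p : PolyRing n} (h : IsHarm p) (j : Fin n) : IsHarm (dzb j p) := fun z => by
  rw [lap_pderiv]; exact (ev_dz_and_dzb_eq_zero h j z).2

theorem lap_smul (c : ℂ) (p : PolyRing n) : lap (c • p) = c • lap p := by
  simp [lap, Finset.smul_sum]

theorem lap_add (p q : PolyRing n) : lap (p + q) = lap p + lap q := by
  simp [lap, Finset.sum_add_distrib]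

theorem lap_zero : lap (0 : PolyRing n) = 0 := by simp [lap]

theorem lap_sum {ι : Type*} (s : Finset ι) (p : ι → PolyRing n) :
    lap (∑ i ∈ s, p i) = ∑ i ∈ s, lap (p i) := by
  classical
  induction s using Finset.induction_on with
  | empty => simp [lap_zero]
  | insert a s ha ih => rw [Finset.sum_insert ha, Finset.sum_insert ha, lap_add, ih]

/-- By Euler's identities and transposition, both a and b times the Gaussian integral of p equal
that of ∑ ∂_j∂̄_j p. -/
theorem gaussInt_eq_zero_of_ne {p : PolyRing n} {a b : ℕ} (hp : IsBihom p a b) (h : a ≠ b) :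
    gaussInt n p = 0 := by
  have h1 := congrArg (gaussInt n) hp.euler_z
  have h2 := congrArg (gaussInt n) hp.euler_zb
  simp only [map_sum, gaussInt_X_inl_mul, gaussInt_X_inr_mul, map_smul, smul_eq_mul] at h1 h2
  have h3 : ∑ j, gaussInt n (dzb j (dz j p)) = ∑ j, gaussInt n (dz j (dzb j p)) :=
    Finset.sum_congr rfl fun j _ => by rw [pderiv_comm]
  have h4 : ((a : ℂ) - b) * gaussInt n p = 0 := by
    rw [sub_mul, ← h1, ← h2, h3, sub_self]
  refine (mul_eq_zero.1 h4).resolve_left (sub_ne_zero.2 ?_)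
  exact_mod_cast h

theorem gaussInt_harm_eq_zero {p : PolyRing n} {a b : ℕ} (hp : IsBihom p a b) (hh : IsHarm p)
    (h : a ≠ 0 ∨ b ≠ 0) : gaussInt n p = 0 := by
  by_cases hab : a = b
  · have h1 := congrArg (gaussInt n) hp.euler_z
    simp only [map_sum, gaussInt_X_inl_mul, map_smul, smul_eq_mul] at h1
    have h2 : gaussInt n (lap p) = 0 := by
      rw [gaussInt_congr (q := 0) fun z => (hh z).trans (ev_zero z).symm, map_zero]
    rw [← map_sum, ← lap_eq, h2] at h1
    refine (mul_eq_zero.1 h1.symm).resolve_left ?_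
    have : a ≠ 0 := by lia
    exact_mod_cast this
  · exact gaussInt_eq_zero_of_ne hp hab

/-- A harmonic polynomial of bidegree `(a, b)` is orthogonal to the polynomials of bidegree
`(a', b')` with `a' < b` or `b' < a`. -/
theorem gaussInt_harm_mul_eq_zero (N : ℕ) :
    ∀ (a b a' b' : ℕ) (p q : PolyRing n), a' + b' = N → IsBihom p a b → IsHarm p →
      IsBihom q a' b' → (a' < b ∨ b' < a) → gaussInt n (p * q) = 0 := by
  induction N using Nat.strong_induction_on with
  | _ N ih =>
    intro a b a' b' p q hN hp hh hq hlt
    have hdzbp : ∀ (j : Fin n) (r : PolyRing n) (c d : ℕ), IsBihom r c d → c + d < N →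
        (c < b - 1 ∨ d < a ∨ b = 0) → gaussInt n (dzb j p * r) = 0 := by
      intro j r c d hr hcd h
      rcases Nat.eq_zero_or_pos b with rfl | hb
      · rw [hp.dzb_eq_zero]; simp
      · exact ih _ hcd _ _ _ _ _ _ rfl (hp.dzb j) (hh.dzb j) hr (by lia)
    have hdzp : ∀ (j : Fin n) (r : PolyRing n) (c d : ℕ), IsBihom r c d → c + d < N →
        (c < b ∨ d < a - 1 ∨ a = 0) → gaussInt n (dz j p * r) = 0 := by
      intro j r c d hr hcd h
      rcases Nat.eq_zero_or_pos a with rfl | ha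
      · rw [hp.dz_eq_zero]; simp
      · exact ih _ hcd _ _ _ _ _ _ rfl (hp.dz j) (hh.dz j) hr (by lia)
    rcases Nat.eq_zero_or_pos a' with rfl | ha'
    · rcases Nat.eq_zero_or_pos b' with rfl | hb'
      · obtain ⟨c, rfl⟩ := hq.eq_C
        rw [mul_comm, ← MvPolynomial.smul_eq_C_mul, map_smul,
          gaussInt_harm_eq_zero hp hh (by lia), smul_zero]
      · have h1 : (b' : ℂ) * gaussInt n (p * q) = 0 := by
          rw [← smul_eq_mul, ← map_smul, ← mul_smul_comm, ← hq.euler_zb, Finset.mul_sum, map_sum]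
          refine Finset.sum_eq_zero fun j _ => ?_
          rw [mul_left_comm, gaussInt_X_inr_mul, Derivation.leibniz, (hq.dzb j).dz_eq_zero,
            smul_zero, zero_add, smul_eq_mul, mul_comm]
          exact hdzp j _ _ _ (hq.dzb j) (by lia) (by lia)
        refine (mul_eq_zero.1 h1).resolve_left ?_
        exact_mod_cast hb'.ne'
    · have h1 : (a' : ℂ) * gaussInt n (p * q) = 0 := by
        rw [← smul_eq_mul, ← map_smul, ← mul_smul_comm, ← hq.euler_z, Finset.mul_sum, map_sum]
        -- Moving z_j across as ∂/∂z̄_j produces (∂̄_j p)(∂_j q) and p ∂̄_j∂_j q. The first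
        -- integrates to zero by induction: ∂̄_j p is harmonic, and both b and the z-degree of q
        -- drop by one.
        have h2 : ∀ j, gaussInt n (p * (MvPolynomial.X (.inl j) * dz j q)) =
            gaussInt n (p * dzb j (dz j q)) := by
          intro j
          rw [mul_left_comm, gaussInt_X_inl_mul, Derivation.leibniz, map_add, smul_eq_mul,
            smul_eq_mul, mul_comm (dz j q), hdzbp j _ _ _ (hq.dz j) (by lia) (by lia), add_zero]
        rw [Finset.sum_congr rfl fun j _ => h2 j]
        refine Finset.sum_eq_zero fun j _ => ?_
        rcases Nat.eq_zero_or_pos b' with rfl | hb'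
        · rw [pderiv_comm, hq.dzb_eq_zero]; simp
        · exact ih _ (by lia) _ _ _ _ _ _ rfl hp hh ((hq.dz j).dzb j) (by lia)
      refine (mul_eq_zero.1 h1).resolve_left ?_
      exact_mod_cast ha'.ne'

/-- The polynomial `ζ ↦ ∑ ζ_j ū_j`. -/
def linZ (u : Cn n) : PolyRing n := ∑ j, conj (u j) • MvPolynomial.X (.inl j)

/-- The polynomial `ζ ↦ ∑ u_j ζ̄_j`. -/
def linZb (u : Cn n) : PolyRing n := ∑ j, u j • MvPolynomial.X (.inr j)

theorem isBihom_linZ (u : Cn n) : IsBihom (linZ u) 1 0 :=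
  IsBihom.sum fun j _ => (isBihom_X_inl j).smul _

theorem isBihom_linZb (u : Cn n) : IsBihom (linZb u) 0 1 :=
  IsBihom.sum fun j _ => (isBihom_X_inr j).smul _

theorem ev_linZ (u z : Cn n) : ev (linZ u) z = pairing z u := by
  simp [linZ, pairing, mul_comm]

theorem ev_linZb (u z : Cn n) : ev (linZb u) z = pairing u z := by
  simp [linZb, pairing]

theorem isBihom_linZ_pow_mul (u : Cn n) (l m : ℕ) : IsBihom (linZ u ^ l * linZb u ^ m) l m := by
  simpa using ((isBihom_linZ u).pow l).mul ((isBihom_linZb u).pow m)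

/-- The reproducing property of the kernels `(ζ·ū)^b (ζ̄·u)^a` on harmonic polynomials. -/
theorem gaussInt_harm_mul_linZ (u : Cn n) (a : ℕ) :
    ∀ (b : ℕ) (p : PolyRing n), IsBihom p a b → IsHarm p →
      gaussInt n (p * (linZ u ^ b * linZb u ^ a)) =
        (a.factorial : ℂ) * (b.factorial : ℂ) * ev p u * gaussInt n 1 := by
  have dz_linZb : ∀ (j : Fin n) (m : ℕ), dz j (linZb u ^ m) = 0 := fun j m =>
    IsBihom.dz_eq_zero (b := m) (by simpa using (isBihom_linZb u).pow m) j
  have dzb_linZ : ∀ (j : Fin n) (m : ℕ), dzb j (linZ u ^ m) = 0 := fun j m =>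
    IsBihom.dzb_eq_zero (a := m) (by simpa using (isBihom_linZ u).pow m) j
  induction a with
  | zero =>
    intro b
    induction b with
    | zero =>
      intro p hp _
      obtain ⟨c, rfl⟩ := hp.eq_C
      rw [pow_zero, pow_zero, mul_one, mul_one, ← mul_one (MvPolynomial.C c),
        ← MvPolynomial.smul_eq_C_mul, map_smul]
      simp
    | succ b ih =>
      intro p hp hh
      set D : PolyRing n := ∑ j, conj (u j) • dzb j p with hD
      have hDb : IsBihom D 0 b := IsBihom.sum fun j _ => (hp.dzb j).smul _
      have hDh : IsHarm D := fun z => by rw [hDb.lap_eq_zero_left, ev_zero]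
      have h1 : gaussInt n (p * (linZ u ^ (b + 1) * linZb u ^ 0)) =
          gaussInt n (D * (linZ u ^ b * linZb u ^ 0)) := by
        have : p * (linZ u ^ (b + 1) * linZb u ^ 0) =
            ∑ j, conj (u j) • (MvPolynomial.X (.inl j) * (p * linZ u ^ b)) := by
          simp only [← smul_mul_assoc]
          rw [← Finset.sum_mul, ← linZ]
          ring
        rw [this, map_sum, hD, pow_zero, mul_one, Finset.sum_mul, map_sum]
        refine Finset.sum_congr rfl fun j _ => ?_
        rw [map_smul, gaussInt_X_inl_mul, Derivation.leibniz, dzb_linZ, smul_zero, zero_add,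
          smul_mul_assoc, map_smul (gaussInt n) (conj (u j)), smul_eq_mul (a := linZ u ^ b),
          mul_comm (linZ u ^ b)]
      have h2 : ev D u = ((b + 1 : ℕ) : ℂ) * ev p u := by
        rw [← ev_smul, ← hp.euler_zb, hD, ev_sum, ev_sum]
        exact Finset.sum_congr rfl fun j _ => by simp
      rw [h1, ih D hDb hDh, h2, Nat.factorial_succ]
      push_cast
      ring
  | succ a ih =>
    intro b p hp hh
    set D : PolyRing n := ∑ j, u j • dz j p with hD
    have hDb : IsBihom D a b := IsBihom.sum fun j _ => (hp.dz j).smul _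
    have hDh : IsHarm D := fun z => by
      rw [hD, lap_sum, ev_sum]
      refine Finset.sum_eq_zero fun j _ => ?_
      rw [lap_smul, ev_smul, hh.dz j z, mul_zero]
    have h1 : gaussInt n (p * (linZ u ^ b * linZb u ^ (a + 1))) =
        gaussInt n (D * (linZ u ^ b * linZb u ^ a)) := by
      have : p * (linZ u ^ b * linZb u ^ (a + 1)) =
          ∑ j, u j • (MvPolynomial.X (.inr j) * (p * (linZ u ^ b * linZb u ^ a))) := by
        simp only [← smul_mul_assoc]
        rw [← Finset.sum_mul, ← linZb]
        ring
      rw [this, map_sum, hD, Finset.sum_mul, map_sum]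
      refine Finset.sum_congr rfl fun j _ => ?_
      rw [map_smul, gaussInt_X_inr_mul, Derivation.leibniz, map_add, smul_eq_mul (a := p),
        smul_eq_mul (a := linZ u ^ b * linZb u ^ a), mul_comm _ (dz j p), smul_mul_assoc,
        map_smul (gaussInt n) (u j)]
      -- The kernel factor has z̄-degree a, below the z-degree a + 1 of p, so the derivative falling
      -- on the kernel contributes nothing, whatever b is.
      have h3 : gaussInt n (p * dz j (linZ u ^ b * linZb u ^ a)) = 0 :=
        gaussInt_harm_mul_eq_zero _ _ _ _ _ _ _ rfl hp hh ((isBihom_linZ_pow_mul u b a).dz j)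
          (by lia)
      rw [h3, zero_add]
    have h2 : ev D u = ((a + 1 : ℕ) : ℂ) * ev p u := by
      rw [← ev_smul, ← hp.euler_z, hD, ev_sum, ev_sum]
      exact Finset.sum_congr rfl fun j _ => by simp
    rw [h1, ih b D hDb hDh, h2, Nat.factorial_succ]
    push_cast
    ring

end

/-! ### From Gaussian integrals to the sphere, and completeness of bigraded harmonics. -/

section

variable {n : ℕ}

/-! ### Polar coordinates -/

theorem finrank_Cn : Module.finrank ℝ (Cn n) = 2 * n := by
  rw [← Module.finrank_mul_finrank ℝ ℂ (Cn n)]; simp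

/-- The total mass of the surface measure of the unit sphere. -/
def surf (n : ℕ) : ℝ := (volume : Measure (Cn n)).toSphere.real Set.univ

theorem surf_pos [NeZero n] : 0 < surf n := by
  rw [surf, Measure.toSphere_real_apply_univ, finrank_Cn]
  have h1 : 0 < (volume : Measure (Cn n)).real (ball 0 1) :=
    ENNReal.toReal_pos (measure_ball_pos _ _ one_pos).ne' measure_ball_lt_top.ne
  have h2 : (0 : ℝ) < ((2 * n : ℕ) : ℝ) := by
    exact_mod_cast Nat.mul_pos two_pos (Nat.pos_of_ne_zero (NeZero.ne n))
  positivity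

theorem toSphere_eq [NeZero n] : (volume : Measure (Cn n)).toSphere =
    (volume : Measure (Cn n)).toSphere Set.univ • unitSphereMeasure n := by
  rw [unitSphereMeasure, smul_smul, ENNReal.mul_inv_cancel, one_smul]
  · exact fun h => Measure.toSphere_ne_zero (volume : Measure (Cn n)) (Measure.measure_univ_eq_zero.1 h)
  · exact measure_ne_top _ _

instance isProbabilityMeasure_unitSphereMeasure [NeZero n] :
    IsProbabilityMeasure (unitSphereMeasure n) := by
  refine ⟨?_⟩
  rw [unitSphereMeasure, Measure.smul_apply, smul_eq_mul, ENNReal.inv_mul_cancel]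
  · exact fun h => Measure.toSphere_ne_zero (volume : Measure (Cn n)) (Measure.measure_univ_eq_zero.1 h)
  · exact measure_ne_top _ _

theorem integral_toSphere [NeZero n] (g : sphere (0 : Cn n) 1 → ℂ) :
    ∫ ω, g ω ∂(volume : Measure (Cn n)).toSphere = surf n • ∫ ω, g ω ∂unitSphereMeasure n := by
  rw [toSphere_eq, integral_smul_measure]
  rfl

theorem integral_polar_radius [NeZero n] {F : Cn n → ℂ} (hF : Integrable F) :
    ∫ z, F z = ∫ ρ in Set.Ioi (0 : ℝ), ρ ^ (2 * n - 1) •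
      (surf n • ∫ ω, F (ρ • (ω : Cn n)) ∂unitSphereMeasure n) := by
  have hmp := (volume : Measure (Cn n)).measurePreserving_homeomorphUnitSphereProd
  have hemb := (homeomorphUnitSphereProd (Cn n)).measurableEmbedding
  set G : sphere (0 : Cn n) 1 × Set.Ioi (0 : ℝ) → ℂ := fun x => F ((x.2 : ℝ) • (x.1 : Cn n)) with hG
  have hGF : ∀ x : ({(0 : Cn n)}ᶜ : Set (Cn n)), G (homeomorphUnitSphereProd (Cn n) x) = F x := by
    intro x
    have := homeomorphUnitSphereProd_symm_apply_coe (Cn n) (homeomorphUnitSphereProd (Cn n) x)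
    rw [Homeomorph.symm_apply_apply] at this
    rw [hG, this]
  have hGint : Integrable G
      ((volume : Measure (Cn n)).toSphere.prod (.volumeIoiPow (Module.finrank ℝ (Cn n) - 1))) := by
    rw [← hmp.integrable_comp_emb hemb]
    have h1 : (G ∘ homeomorphUnitSphereProd (Cn n)) = F ∘ ((↑) : ({(0 : Cn n)}ᶜ : Set (Cn n)) → Cn n) :=
      funext hGF
    rw [h1, ← integrableOn_iff_comap_subtypeVal (measurableSet_singleton _).compl]
    exact hF.integrableOn
  calc ∫ z, F z = ∫ x : ({(0 : Cn n)}ᶜ : Set (Cn n)), F x ∂((volume : Measure (Cn n)).comap (↑)) := by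
        rw [integral_subtype_comap (measurableSet_singleton _).compl F, restrict_compl_singleton]
    _ = ∫ x, G x ∂((volume : Measure (Cn n)).toSphere.prod
          (.volumeIoiPow (Module.finrank ℝ (Cn n) - 1))) := by
        rw [← hmp.integral_comp hemb]
        simp only [hGF]
    _ = ∫ ρ, ∫ ω, G (ω, ρ) ∂(volume : Measure (Cn n)).toSphere
          ∂(.volumeIoiPow (Module.finrank ℝ (Cn n) - 1)) := integral_prod_symm G hGint
    _ = _ := by
        simp only [integral_toSphere, hG, finrank_Cn, Measure.volumeIoiPow, ENNReal.ofReal]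
        rw [integral_withDensity_eq_integral_smul]
        · rw [integral_subtype_comap measurableSet_Ioi fun a : ℝ => Real.toNNReal (a ^ (2 * n - 1)) •
            (surf n • ∫ ω, F (a • (ω : Cn n)) ∂unitSphereMeasure n)]
          refine setIntegral_congr_fun measurableSet_Ioi fun x hx => ?_
          rw [NNReal.smul_def, Real.coe_toNNReal _ (pow_nonneg hx.out.le _)]
        · exact (measurable_subtype_coe.pow_const _).real_toNNReal

/-- Polar coordinates with `t = |z|²` as radial variable. -/
theorem integral_polar [NeZero n] {F : Cn n → ℂ} (hF : Integrable F) :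
    ∫ z, F z = (surf n / 2 : ℝ) * ∫ t in Set.Ioi (0 : ℝ), (t : ℂ) ^ (n - 1) *
      ∫ ω, F (Real.sqrt t • (ω : Cn n)) ∂unitSphereMeasure n := by
  have h0 := integral_comp_rpow_Ioi_of_pos (p := 2) two_pos (g := fun t : ℝ =>
    ((surf n / 2 : ℝ) : ℂ) * ((t : ℂ) ^ (n - 1) *
      ∫ ω, F (Real.sqrt t • (ω : Cn n)) ∂unitSphereMeasure n))
  rw [integral_polar_radius hF, ← integral_const_mul, ← h0]
  refine setIntegral_congr_fun measurableSet_Ioi fun ρ hρ => ?_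
  have hρ0 : (0 : ℝ) < ρ := hρ
  have h1 : (2 : ℝ) - 1 = 1 := by norm_num
  have h2 : ρ ^ (2 * n - 1) = (ρ ^ 2) ^ (n - 1) * ρ := by
    rw [← pow_mul, ← pow_succ]
    congr 1
    have := Nat.pos_of_ne_zero (NeZero.ne n)
    lia
  simp only [h1, Real.rpow_one, Real.rpow_two, Real.sqrt_sq hρ0.le, Complex.real_smul, h2]
  push_cast
  ring

/-- The integral over the unit sphere of a bihomogeneous polynomial is a nonzero multiple of
its Gaussian integral. -/
theorem exists_gaussInt_eq [NeZero n] (k : ℕ) : ∃ W : ℂ, W ≠ 0 ∧ ∀ (a b : ℕ) (q : PolyRing n),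
    IsBihom q a b → a + b = k → gaussInt n q = W * ∫ ω, ev q (ω : Cn n) ∂unitSphereMeasure n := by
  have hs : (0 : ℝ) < n + k / 2 := by
    have : (0 : ℝ) < n := by exact_mod_cast Nat.pos_of_ne_zero (NeZero.ne n)
    positivity
  -- Homogeneity of degree k leaves the radial integral of t^(n-1+k/2) exp(-t), a Gamma value; half
  -- the surface area comes from the variable t = |z|².
  refine ⟨((surf n / 2 : ℝ) : ℂ) * (Real.Gamma (n + k / 2) : ℂ), ?_, fun a b q hq hab => ?_⟩
  · exact mul_ne_zero (by exact_mod_cast (half_pos surf_pos).ne')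
      (by exact_mod_cast (Real.Gamma_pos_of_pos hs).ne')
  · change ∫ z, ev q z * Complex.exp (-ev (nrm n) z) = _
    rw [integral_polar (integrable_ev_mul_gaussian q), Real.Gamma_eq_integral hs, mul_assoc]
    congr 1
    rw [← integral_complex_ofReal, ← integral_mul_const]
    refine setIntegral_congr_fun measurableSet_Ioi fun t ht => ?_
    have ht0 : (0 : ℝ) < t := ht
    have h1 : ∀ ω : sphere (0 : Cn n) 1, ev q (Real.sqrt t • (ω : Cn n)) *
        Complex.exp (-ev (nrm n) (Real.sqrt t • (ω : Cn n))) =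
        ((Real.sqrt t : ℂ) ^ k * Complex.exp (-t)) * ev q (ω : Cn n) := by
      intro ω
      rw [hq.ev_smul, hab, ev_nrm, norm_smul, norm_eq_of_mem_sphere, mul_one, Real.norm_eq_abs,
        sq_abs, Real.sq_sqrt ht0.le]
      ring
    simp only [h1]
    rw [integral_const_mul, ← mul_assoc]
    congr 1
    have h2 : t ^ ((n : ℝ) + k / 2 - 1) = t ^ (n - 1) * Real.sqrt t ^ k := by
      rw [Real.sqrt_eq_rpow, ← Real.rpow_natCast, ← Real.rpow_natCast, ← Real.rpow_mul ht0.le,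
        ← Real.rpow_add ht0, Nat.cast_sub (Nat.one_le_iff_ne_zero.2 (NeZero.ne n))]
      congr 1
      push_cast
      ring
    rw [h2]
    push_cast
    ring

theorem gaussInt_one_ne_zero [NeZero n] : gaussInt n 1 ≠ 0 := by
  obtain ⟨W, hW, h⟩ := exists_gaussInt_eq (n := n) 0
  rw [h 0 0 1 isBihom_one rfl]
  simpa using hW

theorem integral_sphere_eq_zero_iff [NeZero n] {q : PolyRing n} {a b : ℕ} (hq : IsBihom q a b) :
    ∫ ω, ev q (ω : Cn n) ∂unitSphereMeasure n = 0 ↔ gaussInt n q = 0 := by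
  obtain ⟨W, hW, h⟩ := exists_gaussInt_eq (n := n) (a + b)
  rw [h a b q hq rfl]
  simp [hW]

/-! ### Complex conjugation of polynomials -/

/-- The polynomial whose values are the complex conjugates of those of `p`. -/
def cj (p : PolyRing n) : PolyRing n :=
  MvPolynomial.rename Sum.swap (MvPolynomial.map (starRingEnd ℂ) p)

theorem ev_cj (p : PolyRing n) (z : Cn n) : ev (cj p) z = conj (ev p z) := by
  induction p using MvPolynomial.induction_on with
  | C a => simp [cj]
  | add p q hp hq =>
    have : cj (p + q) = cj p + cj q := by simp [cj]
    rw [this, ev_add, hp, hq, ev_add, map_add]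
  | mul_X p i hp =>
    have : cj (p * MvPolynomial.X i) = cj p * MvPolynomial.X i.swap := by simp [cj]
    rw [this, ev_mul, hp, ev_mul, map_mul]
    rcases i with i | i <;> simp

theorem cj_cj (p : PolyRing n) : cj (cj p) = p := by
  have h : (starRingEnd ℂ).comp (starRingEnd ℂ) = RingHom.id ℂ := RingHom.ext fun x => by simp
  rw [cj, cj, MvPolynomial.map_rename, MvPolynomial.rename_rename, MvPolynomial.map_map, h,
    Sum.swap_swap_eq, MvPolynomial.map_id, MvPolynomial.rename_id]
  rfl

theorem IsBihom.cj {p : PolyRing n} {a b : ℕ} (hp : IsBihom p a b) : IsBihom (cj p) b a := by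
  intro d hd
  obtain ⟨u, rfl, hu⟩ := MvPolynomial.coeff_rename_ne_zero _ _ _ hd
  have hu' : MvPolynomial.coeff u p ≠ 0 := fun h => hu (by rw [MvPolynomial.coeff_map, h, map_zero])
  have h := hp hu'
  rw [Finsupp.weight_apply, Finsupp.sum_fintype _ (fun (i : Fin n ⊕ Fin n) (c : ℕ) => c • biweight n i)
    (fun _ => zero_smul ℕ _), Fintype.sum_sum_type] at h
  rw [Finsupp.weight_apply, Finsupp.sum_mapDomain_index (h := fun i (c : ℕ) => c • biweight n i)
    (fun _ => zero_smul ℕ _) (fun _ _ _ => add_smul _ _ _),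
    Finsupp.sum_fintype _ (fun (i : Fin n ⊕ Fin n) (c : ℕ) => c • biweight n i.swap)
    (fun _ => zero_smul ℕ _), Fintype.sum_sum_type]
  simp only [biweight, Sum.elim_inl, Sum.elim_inr, Prod.ext_iff, Sum.swap_inl, Sum.swap_inr,
    Prod.fst_add, Prod.snd_add, Prod.fst_sum, Prod.snd_sum, Prod.smul_fst, Prod.smul_snd,
    smul_eq_mul, mul_one, mul_zero, Finset.sum_const_zero, zero_add, add_zero] at h ⊢
  exact h.symm

theorem dz_cj (j : Fin n) (p : PolyRing n) : dz j (cj p) = cj (dzb j p) := by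
  rw [cj, cj, ← MvPolynomial.pderiv_map,
    ← MvPolynomial.pderiv_rename (Sum.swap_leftInverse.injective)]
  rfl

theorem dzb_cj (j : Fin n) (p : PolyRing n) : dzb j (cj p) = cj (dz j p) := by
  rw [cj, cj, ← MvPolynomial.pderiv_map,
    ← MvPolynomial.pderiv_rename (Sum.swap_leftInverse.injective)]
  rfl

theorem lap_cj (p : PolyRing n) : lap (cj p) = cj (lap p) := by
  rw [lap_eq, lap]
  simp only [dz_cj, dzb_cj]
  simp [cj]

theorem IsHarm.cj {p : PolyRing n} (h : IsHarm p) : IsHarm (cj p) := fun z => by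
  rw [lap_cj, ev_cj, h z, map_zero]

/-! ### Completeness of the spherical harmonics -/

/-- The restriction of a polynomial to the unit sphere. -/
def sphPoly (n : ℕ) : PolyRing n →ₐ[ℂ] C(sphere (0 : Cn n) 1, ℂ) where
  toFun p := ⟨fun ω => ev p (ω : Cn n), by fun_prop⟩
  map_one' := by ext; simp
  map_mul' p q := by ext; simp
  map_zero' := by ext; simp
  map_add' p q := by ext; simp
  commutes' c := by ext; simp [MvPolynomial.algebraMap_eq]

theorem sphPoly_apply (p : PolyRing n) (ω : sphere (0 : Cn n) 1) :
    sphPoly n p ω = ev p (ω : Cn n) := rfl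

/-- The class in `L²` of the unit sphere of a polynomial. -/
def lpPoly (n : ℕ) [NeZero n] : PolyRing n →ₗ[ℂ] Lp ℂ 2 (unitSphereMeasure n) :=
  (ContinuousMap.toLp 2 (unitSphereMeasure n) ℂ).toLinearMap ∘ₗ (sphPoly n).toLinearMap

theorem inner_lpPoly [NeZero n] (p q : PolyRing n) :
    ⟪lpPoly n p, lpPoly n q⟫_ℂ = ∫ ω, ev (q * cj p) (ω : Cn n) ∂unitSphereMeasure n := by
  refine (ContinuousMap.inner_toLp (unitSphereMeasure n) _ _).trans ?_
  refine integral_congr_ae (.of_forall fun ω => ?_)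
  simp [ev_cj, sphPoly_apply]

theorem lpPoly_nrm_mul [NeZero n] (p : PolyRing n) : lpPoly n (nrm n * p) = lpPoly n p := by
  change ContinuousMap.toLp 2 _ ℂ (sphPoly n (nrm n * p)) = ContinuousMap.toLp 2 _ ℂ (sphPoly n p)
  congr 1
  ext ω
  rw [sphPoly_apply, sphPoly_apply, ev_mul, ev_nrm, norm_eq_of_mem_sphere]
  simp

/-- Transposing the Laplacian shows that the Gaussian integral of (lap q)·r vanishes for every r of
bidegree (b, a). Taking r to be the conjugate of lap q makes the Gaussian integral of |lap q|² zero.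
-/
theorem isHarm_of_orthogonal [NeZero n] {q : PolyRing n} {a b : ℕ} (hq : IsBihom q (a + 1) (b + 1))
    (h : ∀ s, IsBihom s a b → ⟪lpPoly n s, lpPoly n q⟫_ℂ = 0) : IsHarm q := by
  have h1 : ∀ r, IsBihom r b a → gaussInt n (q * r) = 0 := by
    intro r hr
    have := h (cj r) hr.cj
    rw [inner_lpPoly, cj_cj] at this
    exact (integral_sphere_eq_zero_iff (hq.mul hr)).1 this
  -- The bidegree of `lap r` is too small for `h1`, but on the sphere it agrees with |z|² `lap r`,
  -- whose bidegree is (b, a).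
  have h2 : ∀ r, IsBihom r b a → gaussInt n (q * lap r) = 0 := by
    intro r hr
    rcases Nat.eq_zero_or_pos b with rfl | hb
    · rw [hr.lap_eq_zero_left]; simp
    rcases Nat.eq_zero_or_pos a with rfl | ha
    · rw [hr.lap_eq_zero_right]; simp
    have hb' : IsBihom (nrm n * lap r) b a := by
      have := (isBihom_nrm (n := n)).mul hr.lap
      rwa [show 1 + (b - 1) = b by lia, show 1 + (a - 1) = a by lia] at this
    rw [← integral_sphere_eq_zero_iff (hq.mul hr.lap)]
    have h3 := (integral_sphere_eq_zero_iff (hq.mul hb')).2 (h1 _ hb')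
    rw [← h3]
    refine integral_congr_ae (.of_forall fun ω => ?_)
    simp only [ev_mul, ev_nrm, norm_eq_of_mem_sphere]
    simp
  have h3 : ∀ r, IsBihom r b a → gaussInt n (lap q * r) = 0 := by
    intro r hr
    have e1 : ∀ j, gaussInt n (dz j (dzb j q) * r) =
        gaussInt n ((MvPolynomial.X (.inr j) * dzb j q) * r) -
          gaussInt n (q * (MvPolynomial.X (.inl j) * dz j r)) +
            gaussInt n (q * dzb j (dz j r)) := by
      intro j
      have a1 := gaussInt_X_inr_mul j (dzb j q * r)
      have a2 := gaussInt_X_inl_mul j (q * dz j r)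
      rw [Derivation.leibniz, map_add, smul_eq_mul, smul_eq_mul] at a1 a2
      rw [mul_assoc, a1, mul_left_comm q, a2, mul_comm r, mul_comm (dz j r) (dzb j q)]
      ring
    rw [lap, Finset.sum_mul, map_sum, Finset.sum_congr rfl fun j _ => e1 j,
      Finset.sum_add_distrib, Finset.sum_sub_distrib, ← map_sum, ← map_sum, ← map_sum,
      ← Finset.sum_mul, ← Finset.mul_sum, ← Finset.mul_sum, hq.euler_zb, hr.euler_z, ← lap_eq,
      h2 r hr, smul_mul_assoc, mul_smul_comm, map_smul, map_smul, h1 r hr]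
    simp
  have h4 := h3 _ (hq.lap.cj)
  have h5 : ∀ z : Cn n, ev (lap q * cj (lap q)) z * Complex.exp (-ev (nrm n) z) =
      ((‖ev (lap q) z‖ ^ 2 * Real.exp (-‖z‖ ^ 2) : ℝ) : ℂ) := by
    intro z
    rw [ev_mul, ev_cj, Complex.mul_conj', ev_nrm]
    push_cast
    ring
  change ∫ z, ev (lap q * cj (lap q)) z * Complex.exp (-ev (nrm n) z) = 0 at h4
  have hint : Integrable fun z : Cn n => ‖ev (lap q) z‖ ^ 2 * Real.exp (-‖z‖ ^ 2) := by
    have := (integrable_ev_mul_gaussian (lap q * cj (lap q))).re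
    simp only [h5] at this
    simpa only [RCLike.ofReal_re, Complex.ofReal_re, RCLike.re_eq_complex_re] using this
  simp only [h5] at h4
  rw [integral_complex_ofReal, Complex.ofReal_eq_zero,
    integral_eq_zero_iff_of_nonneg (fun z => by positivity) hint] at h4
  have h6 := (Continuous.ae_eq_iff_eq volume (by fun_prop) (by exact continuous_const)).1 h4
  intro z
  have h7 : ‖ev (lap q) z‖ ^ 2 * Real.exp (-‖z‖ ^ 2) = 0 := congrFun h6 z
  simpa [Real.exp_ne_zero] using h7

theorem finiteDimensional_bihom (a b : ℕ) : FiniteDimensional ℂ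
    (MvPolynomial.weightedHomogeneousSubmodule ℂ (biweight n) (a, b)) := by
  have h1 : FiniteDimensional ℂ (MvPolynomial.weightedHomogeneousSubmodule ℂ
      (fun i => (biweight n i).1 + (biweight n i).2) (a + b)) :=
    Module.Finite.iff_fg.2 (MvPolynomial.weightedHomogeneousSubmodule_fg ℂ _
      (by rintro (i | i) <;> simp [biweight]) _)
  refine Submodule.finiteDimensional_of_le (S₂ := MvPolynomial.weightedHomogeneousSubmodule ℂ
      (fun i => (biweight n i).1 + (biweight n i).2) (a + b)) fun p hp d hd => ?_
  have e1 := IsBihom.fst (p := p) hp hd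
  have e2 := IsBihom.snd (p := p) hp hd
  rw [Finsupp.weight_apply, Finsupp.sum] at e1 e2 ⊢
  simp only [smul_add, Finset.sum_add_distrib, e1, e2]

/-- The span in `L²` of the restrictions of the bihomogeneous harmonic polynomials. -/
def harmSpan (n : ℕ) [NeZero n] : Submodule ℂ (Lp ℂ 2 (unitSphereMeasure n)) :=
  Submodule.span ℂ {x | ∃ a b h, IsBihom h a b ∧ IsHarm h ∧ x = lpPoly n h}

/-- Subtract |z|² t, where t restricts to the orthogonal projection of q onto the polynomials of
bidegree one lower in each variable. The difference is harmonic by orthogonality, and on the sphere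
|z|² t equals t, to which induction applies. -/
theorem lpPoly_mem_harmSpan_of_isBihom [NeZero n] (a : ℕ) :
    ∀ (b : ℕ) (q : PolyRing n), IsBihom q a b → lpPoly n q ∈ harmSpan n := by
  induction a with
  | zero =>
    intro b q hq
    exact Submodule.subset_span ⟨0, b, q, hq, fun z => by rw [hq.lap_eq_zero_left, ev_zero], rfl⟩
  | succ a ih =>
    intro b q hq
    rcases b with _ | b
    · exact Submodule.subset_span
        ⟨a + 1, 0, q, hq, fun z => by rw [hq.lap_eq_zero_right, ev_zero], rfl⟩
    · have := finiteDimensional_bihom (n := n) a b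
      set U := (MvPolynomial.weightedHomogeneousSubmodule ℂ (biweight n) (a, b)).map (lpPoly n)
      obtain ⟨u, hu, v, hv, huv⟩ := U.exists_add_mem_mem_orthogonal (lpPoly n q)
      obtain ⟨t, ht, rfl⟩ := hu
      have ht' : IsBihom t a b := ht
      have hq' : IsBihom (q - nrm n * t) (a + 1) (b + 1) := by
        refine hq.sub ?_
        have := (isBihom_nrm (n := n)).mul ht'
        rwa [add_comm 1 a, add_comm 1 b] at this
      have hv' : lpPoly n (q - nrm n * t) = v := by
        rw [map_sub, lpPoly_nrm_mul, huv]
        simp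
      have hharm : IsHarm (q - nrm n * t) := isHarm_of_orthogonal hq' fun s hs => by
        rw [hv']
        exact (Submodule.mem_orthogonal _ _).1 hv _ ⟨s, hs, rfl⟩
      rw [huv, ← hv']
      exact Submodule.add_mem _ (ih b t ht')
        (Submodule.subset_span ⟨_, _, _, hq', hharm, rfl⟩)

theorem lpPoly_mem_harmSpan [NeZero n] (p : PolyRing n) : lpPoly n p ∈ harmSpan n := by
  rw [p.as_sum, map_sum]
  refine Submodule.sum_mem _ fun d _ => ?_
  obtain ⟨⟨a, b⟩, hab⟩ : ∃ m : ℕ × ℕ, Finsupp.weight (biweight n) d = m := ⟨_, rfl⟩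
  exact lpPoly_mem_harmSpan_of_isBihom a b _
    (MvPolynomial.isWeightedHomogeneous_monomial _ _ _ hab)

/-- Stone–Weierstrass: the coordinates separate points, and `cj` supplies closure under conjugation.
-/
theorem dense_range_sphPoly : DenseRange (sphPoly n) := by
  let A : StarSubalgebra ℂ C(sphere (0 : Cn n) 1, ℂ) :=
    { (sphPoly n).range with
      star_mem' := by
        rintro _ ⟨p, rfl⟩
        refine ⟨cj p, ?_⟩
        ext ω
        exact ev_cj p _ }
  have hA : A.SeparatesPoints := by
    intro x y hxy
    have : ∃ j, (x : Cn n) j ≠ (y : Cn n) j := by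
      by_contra! h
      exact hxy (Subtype.ext (PiLp.ext h))
    obtain ⟨j, hj⟩ := this
    refine ⟨_, ⟨sphPoly n (MvPolynomial.X (.inl j)), ⟨_, rfl⟩, rfl⟩, ?_⟩
    simpa [sphPoly_apply] using hj
  have h := ContinuousMap.starSubalgebra_topologicalClosure_eq_top_of_separatesPoints A hA
  intro f
  have hf : f ∈ A.topologicalClosure := by rw [h]; trivial
  exact hf

theorem harmSpan_dense [NeZero n] : (harmSpan n).topologicalClosure = ⊤ := by
  rw [← Submodule.dense_iff_topologicalClosure_eq_top]
  have h1 : DenseRange (lpPoly n) :=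
    (ContinuousMap.toLp_denseRange ℂ (unitSphereMeasure n) ℂ (p := 2) (by simp)).comp
      dense_range_sphPoly (ContinuousMap.toLp 2 (unitSphereMeasure n) ℂ).continuous
  refine h1.mono ?_
  rintro _ ⟨p, rfl⟩
  exact lpPoly_mem_harmSpan p

/-- Conjugation swaps the two degrees. For distinct bidegrees, one of h' and the conjugate of h can
play the harmonic factor in `gaussInt_harm_mul_eq_zero` with the other as the polynomial of too
small a degree. -/
theorem inner_lpPoly_eq_zero [NeZero n] {h h' : PolyRing n} {a b a' b' : ℕ} (hb : IsBihom h a b)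
    (hh : IsHarm h) (hb' : IsBihom h' a' b') (hh' : IsHarm h') (hne : (a, b) ≠ (a', b')) :
    ⟪lpPoly n h, lpPoly n h'⟫_ℂ = 0 := by
  rw [inner_lpPoly, integral_sphere_eq_zero_iff (hb'.mul hb.cj)]
  by_cases h1 : b < b' ∨ a < a'
  · exact gaussInt_harm_mul_eq_zero _ _ _ _ _ _ _ rfl hb' hh' hb.cj h1
  by_cases h2 : a' < a ∨ b' < b
  · rw [mul_comm]
    exact gaussInt_harm_mul_eq_zero _ _ _ _ _ _ _ rfl hb.cj hh.cj hb' h2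
  · exact absurd (Prod.ext (by lia) (by lia)) hne

end

/-! ### Solid harmonics as polynomials, and the orthonormal basis of the sphere. -/

section

variable {n : ℕ}

theorem exists_isBihom_of_mem {p q : ℕ} {F : Cn n → ℂ} (hF : F ∈ bihomogeneous n p q) :
    ∃ h : PolyRing n, IsBihom h p q ∧ ev h = F := by
  induction hF using Submodule.span_induction with
  | mem m hm =>
    obtain ⟨α, β, hα, hβ, rfl⟩ := hm
    refine ⟨(∏ i, MvPolynomial.X (.inl i) ^ α i) * ∏ i, MvPolynomial.X (.inr i) ^ β i, ?_, ?_⟩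
    · have h1 := MvPolynomial.IsWeightedHomogeneous.prod (R := ℂ) (w := biweight n) Finset.univ
        (fun i : Fin n => (MvPolynomial.X (.inl i) : PolyRing n) ^ α i) (fun i => (α i, 0))
        fun i _ => by simpa [IsBihom] using (isBihom_X_inl i).pow (α i)
      have h2 := MvPolynomial.IsWeightedHomogeneous.prod (R := ℂ) (w := biweight n) Finset.univ
        (fun i : Fin n => (MvPolynomial.X (.inr i) : PolyRing n) ^ β i) (fun i => (0, β i))
        fun i _ => by simpa [IsBihom] using (isBihom_X_inr i).pow (β i)
      have h3 := h1.mul h2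
      have e : (∑ i : Fin n, ((α i, 0) : ℕ × ℕ)) + ∑ i : Fin n, ((0, β i) : ℕ × ℕ) = (p, q) := by
        ext <;> simp [Prod.fst_sum, Prod.snd_sum, hα, hβ]
      rwa [e] at h3
    · ext z
      rw [ev_mul]
      simp [ev, map_prod]
  | zero => exact ⟨0, isBihom_zero _ _, funext ev_zero⟩
  | add f g _ _ hf hg =>
    obtain ⟨h, hh, rfl⟩ := hf
    obtain ⟨k, hk, rfl⟩ := hg
    exact ⟨h + k, hh.add hk, funext (ev_add h k)⟩
  | smul c f _ hf =>
    obtain ⟨h, hh, rfl⟩ := hf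
    exact ⟨c • h, hh.smul c, funext (ev_smul c h)⟩

theorem IsBihom.ev_mem {h : PolyRing n} {p q : ℕ} (hh : IsBihom h p q) :
    ev h ∈ bihomogeneous n p q := by
  have h1 : ev h = ∑ d ∈ h.support, MvPolynomial.coeff d h •
      fun z : Cn n => (∏ i, z i ^ d (.inl i)) * ∏ i, conj (z i) ^ d (.inr i) := by
    ext z
    rw [ev, MvPolynomial.eval_eq', Finset.sum_apply]
    refine Finset.sum_congr rfl fun d _ => ?_
    rw [Fintype.prod_sum_type]
    rfl
  rw [h1]
  refine Submodule.sum_mem _ fun d hd => Submodule.smul_mem _ _ (Submodule.subset_span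
    ⟨fun i => d (.inl i), fun i => d (.inr i), ?_, ?_, rfl⟩)
  · have h2 := hh.fst (MvPolynomial.mem_support_iff.1 hd)
    rw [Finsupp.weight_apply, Finsupp.sum_fintype _ _ (by simp), Fintype.sum_sum_type] at h2
    simpa [biweight] using h2
  · have h2 := hh.snd (MvPolynomial.mem_support_iff.1 hd)
    rw [Finsupp.weight_apply, Finsupp.sum_fintype _ _ (by simp), Fintype.sum_sum_type] at h2
    simpa [biweight] using h2

/-- This is the bridge between the function space of the statement and the formal polynomials used
in the computations. -/
theorem mem_solidHarmonics_iff {p q : ℕ} {F : Cn n → ℂ} :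
    F ∈ solidHarmonics n p q ↔ ∃ h : PolyRing n, IsBihom h p q ∧ IsHarm h ∧ ev h = F := by
  constructor
  · rintro ⟨h1, h2⟩
    obtain ⟨h, hh, rfl⟩ := exists_isBihom_of_mem h1
    refine ⟨h, hh, fun z => ?_, rfl⟩
    have := h2 z
    rw [laplacian_ev] at this
    exact (mul_eq_zero.1 this).resolve_left (by norm_num)
  · rintro ⟨h, hh, hharm, rfl⟩
    exact ⟨hh.ev_mem, fun z => by rw [laplacian_ev, hharm z, mul_zero]⟩

/-- Polynomials representing the elements of a basis of solid harmonics. -/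
def basisPoly (P : HarmonicBases n) (p q : ℕ) (j : Fin (dimH n p q)) : PolyRing n :=
  (mem_solidHarmonics_iff.1 (P p q j).2).choose

theorem isBihom_basisPoly (P : HarmonicBases n) (p q : ℕ) (j : Fin (dimH n p q)) :
    IsBihom (basisPoly P p q j) p q :=
  (mem_solidHarmonics_iff.1 (P p q j).2).choose_spec.1

theorem isHarm_basisPoly (P : HarmonicBases n) (p q : ℕ) (j : Fin (dimH n p q)) :
    IsHarm (basisPoly P p q j) :=
  (mem_solidHarmonics_iff.1 (P p q j).2).choose_spec.2.1

theorem ev_basisPoly (P : HarmonicBases n) (p q : ℕ) (j : Fin (dimH n p q)) :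
    ev (basisPoly P p q j) = P p q j :=
  (mem_solidHarmonics_iff.1 (P p q j).2).choose_spec.2.2

/-- The index set of all spherical harmonics. -/
abbrev HarmIndex (n : ℕ) : Type := Σ m : ℕ × ℕ, Fin (dimH n m.1 m.2)

theorem lpPoly_congr [NeZero n] {p q : PolyRing n} (h : ∀ z, ev p z = ev q z) :
    lpPoly n p = lpPoly n q := by
  change ContinuousMap.toLp 2 _ ℂ (sphPoly n p) = ContinuousMap.toLp 2 _ ℂ (sphPoly n q)
  congr 1
  ext ω
  exact h _

theorem orthonormal_basisPoly [NeZero n] {P : HarmonicBases n} (hP : IsOrthonormalOnSphere P) :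
    Orthonormal ℂ fun i : HarmIndex n => lpPoly n (basisPoly P i.1.1 i.1.2 i.2) := by
  classical
  rw [orthonormal_iff_ite]
  rintro ⟨⟨p, q⟩, i⟩ ⟨⟨p', q'⟩, j⟩
  by_cases h : (p, q) = (p', q')
  · obtain ⟨rfl, rfl⟩ := Prod.ext_iff.1 h
    have h1 := hP p q j i
    simp only [inner_lpPoly, ev_mul, ev_cj, ev_basisPoly]
    rw [h1]
    by_cases hij : i = j
    · simp [hij]
    · rw [if_neg (Ne.symm hij), if_neg]
      intro h2
      exact hij (by simpa using h2)
  · rw [if_neg fun h2 => h (congrArg Sigma.fst h2)]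
    exact inner_lpPoly_eq_zero (isBihom_basisPoly P _ _ _) (isHarm_basisPoly P _ _ _)
      (isBihom_basisPoly P _ _ _) (isHarm_basisPoly P _ _ _) h

theorem harmSpan_le [NeZero n] (P : HarmonicBases n) : harmSpan n ≤ Submodule.span ℂ
    (Set.range fun i : HarmIndex n => lpPoly n (basisPoly P i.1.1 i.1.2 i.2)) := by
  refine Submodule.span_le.2 ?_
  rintro _ ⟨a, b, h, hb, hh, rfl⟩
  set F : solidHarmonics n a b := ⟨ev h, mem_solidHarmonics_iff.2 ⟨h, hb, hh, rfl⟩⟩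
  have h1 : lpPoly n h = lpPoly n (∑ j, (P a b).repr F j • basisPoly P a b j) := by
    refine lpPoly_congr fun z => ?_
    have h2 := congrArg (fun G : solidHarmonics n a b => (G : Cn n → ℂ) z) ((P a b).sum_repr F)
    simp only [ev_sum, ev_smul, ev_basisPoly]
    rw [← show (F : Cn n → ℂ) z = ev h z from rfl, ← h2, Submodule.coe_sum, Finset.sum_apply]
    rfl
  rw [h1, map_sum]
  refine Submodule.sum_mem _ fun j _ => ?_
  rw [map_smul]
  exact Submodule.smul_mem _ _ (Submodule.subset_span ⟨⟨(a, b), j⟩, rfl⟩)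

/-- Parseval's identity for the expansion in spherical harmonics. -/
theorem hasSum_sphere [NeZero n] {P : HarmonicBases n} (hP : IsOrthonormalOnSphere P)
    {f k : sphere (0 : Cn n) 1 → ℂ} (hf : Continuous f) (hk : Continuous k) :
    HasSum (fun i : HarmIndex n =>
      (∫ ω, f ω * conj ((P i.1.1 i.1.2 i.2 : Cn n → ℂ) ω) ∂unitSphereMeasure n) *
        ∫ ω, (P i.1.1 i.1.2 i.2 : Cn n → ℂ) ω * k ω ∂unitSphereMeasure n)
      (∫ ω, f ω * k ω ∂unitSphereMeasure n) := by
  have hdense : ⊤ ≤ (Submodule.span ℂ (Set.range fun i : HarmIndex n =>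
      lpPoly n (basisPoly P i.1.1 i.1.2 i.2))).topologicalClosure := by
    rw [← harmSpan_dense]
    exact Submodule.topologicalClosure_mono (harmSpan_le P)
  set b := HilbertBasis.mk (orthonormal_basisPoly hP) hdense
  have hb : ∀ i : HarmIndex n, b i = ContinuousMap.toLp 2 (unitSphereMeasure n) ℂ
      (sphPoly n (basisPoly P i.1.1 i.1.2 i.2)) := fun i => by
    rw [HilbertBasis.coe_mk]; rfl
  have key := b.hasSum_inner_mul_inner
    (ContinuousMap.toLp 2 (unitSphereMeasure n) ℂ ⟨fun ω => conj (k ω), by fun_prop⟩)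
    (ContinuousMap.toLp 2 (unitSphereMeasure n) ℂ ⟨f, hf⟩)
  simp only [hb, ContinuousMap.inner_toLp] at key
  simp only [ContinuousMap.coe_mk, Complex.conj_conj, sphPoly_apply, ev_basisPoly] at key
  simpa only [mul_comm] using key

end

/-! ### Twisted means as exponentially weighted means, and their weak form. -/

section

variable {n : ℕ}

/-! ### The hermitian pairing -/

theorem pairing_eq_inner (z w : Cn n) : pairing z w = ⟪w, z⟫_ℂ := by
  rw [PiLp.inner_apply]
  rfl

theorem conj_pairing (z w : Cn n) : conj (pairing z w) = pairing w z := by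
  rw [pairing_eq_inner, pairing_eq_inner, inner_conj_symm]

theorem pairing_self (z : Cn n) : pairing z z = ((‖z‖ ^ 2 : ℝ) : ℂ) := by
  rw [pairing_eq_inner, inner_self_eq_norm_sq_to_K]
  push_cast
  rfl

theorem norm_pairing_le (z w : Cn n) : ‖pairing z w‖ ≤ ‖z‖ * ‖w‖ := by
  rw [pairing_eq_inner, mul_comm]
  exact norm_inner_le_norm w z

theorem pairing_sub_left (z z' w : Cn n) : pairing (z - z') w = pairing z w - pairing z' w := by
  simp only [pairing_eq_inner, inner_sub_right]

theorem pairing_sub_right (z w w' : Cn n) : pairing z (w - w') = pairing z w - pairing z w' := by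
  simp only [pairing_eq_inner, inner_sub_left]

theorem pairing_smul_left (c : ℝ) (z w : Cn n) : pairing (c • z) w = c * pairing z w := by
  simp only [pairing, PiLp.smul_apply, Complex.real_smul, Finset.mul_sum, mul_assoc]

theorem pairing_smul_right (c : ℝ) (z w : Cn n) : pairing z (c • w) = c * pairing z w := by
  rw [← conj_pairing, pairing_smul_left, map_mul, Complex.conj_ofReal, conj_pairing]

theorem pairing_add_pairing (z u : Cn n) :
    pairing z u + pairing u z = ((2 * (pairing u z).re : ℝ) : ℂ) := by
  rw [← conj_pairing u z, add_comm, Complex.add_conj]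

theorem norm_sub_sq_eq (u z : Cn n) :
    ‖u - z‖ ^ 2 = ‖u‖ ^ 2 + ‖z‖ ^ 2 - 2 * (pairing u z).re := by
  have h : ((‖u - z‖ ^ 2 : ℝ) : ℂ) = ((‖u‖ ^ 2 + ‖z‖ ^ 2 - 2 * (pairing u z).re : ℝ) : ℂ) := by
    rw [← pairing_self, pairing_sub_left, pairing_sub_right, pairing_sub_right, pairing_self,
      pairing_self, Complex.ofReal_sub, ← pairing_add_pairing, Complex.ofReal_add]
    ring
  exact_mod_cast h

theorem continuous_pairing : Continuous fun x : Cn n × Cn n => pairing x.1 x.2 := by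
  unfold pairing
  fun_prop

@[fun_prop] theorem continuous_pairing_left (z : Cn n) : Continuous fun u => pairing u z :=
  continuous_pairing.comp (by fun_prop : Continuous fun u : Cn n => (u, z))

@[fun_prop] theorem continuous_pairing_right (z : Cn n) : Continuous fun u => pairing z u :=
  continuous_pairing.comp (by fun_prop : Continuous fun u : Cn n => (z, u))

/-! ### Twisted means as weighted means over spheres -/

/-- The function `f` multiplied by `exp(-κ|u|²/2)`. -/
def weighted (κ : ℝ) (f : Cn n → ℂ) (u : Cn n) : ℂ :=
  f u * Complex.exp (-(κ * (‖u‖ ^ 2 : ℝ) / 2))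

/-- The mean over the sphere of centre `z` and radius `s` of
`f(u) exp(-κ|u|²/2) exp(κ z̄·u)`. -/
def sphMean (κ : ℝ) (f : Cn n → ℂ) (z : Cn n) (s : ℝ) : ℂ :=
  ∫ ω, weighted κ f (z - s • (ω : Cn n)) *
    Complex.exp (κ * pairing (z - s • (ω : Cn n)) z) ∂unitSphereMeasure n

theorem integral_sphereMeasure {s : ℝ} (hs : 0 < s) (g : Cn n → ℂ) :
    ∫ w, g w ∂sphereMeasure n s = ∫ ω, g (s • (ω : Cn n)) ∂unitSphereMeasure n := by
  refine MeasurableEmbedding.integral_map ?_ g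
  exact (MeasurableEquiv.smul₀ s hs.ne').measurableEmbedding.comp
    (MeasurableEmbedding.subtype_coe isClosed_sphere.measurableSet)

theorem I_mul_im_eq (z : ℂ) : Complex.I / 2 * (z.im : ℂ) = (z - conj z) / 4 := by
  rw [Complex.sub_conj]
  push_cast
  ring

theorem pairing_sphere_relation (z : Cn n) (s : ℝ) (ω : sphere (0 : Cn n) 1) :
    pairing z (z - s • (ω : Cn n)) + pairing (z - s • (ω : Cn n)) z =
      (‖z - s • (ω : Cn n)‖ ^ 2 : ℝ) + (‖z‖ ^ 2 : ℝ) - (s ^ 2 : ℝ) := by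
  have h := norm_sub_sq_eq (z - s • (ω : Cn n)) z
  have h1 : ‖z - s • (ω : Cn n) - z‖ ^ 2 = s ^ 2 := by
    rw [sub_sub_cancel_left, norm_neg, norm_smul, norm_eq_of_mem_sphere, mul_one, Real.norm_eq_abs,
      sq_abs]
  rw [pairing_add_pairing, ← Complex.ofReal_add, ← Complex.ofReal_sub]
  congr 1
  linarith

/-- With u = z - w, the phase exponent is (u·z̄ - z·ū)/4. The sphere relation eliminates z·ū,
leaving u·z̄/2 - |u|²/4 and a term independent of u. -/
theorem twistedConvRight_eq (f : Cn n → ℂ) (z : Cn n) {s : ℝ} (hs : 0 < s) :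
    twistedConvRight f (sphereMeasure n s) z =
      Complex.exp (-((‖z‖ ^ 2 : ℝ) - (s ^ 2 : ℝ)) / 4) * sphMean (1 / 2) f z s := by
  rw [twistedConvRight, integral_sphereMeasure hs, sphMean, ← integral_const_mul]
  refine integral_congr_ae (.of_forall fun ω => ?_)
  simp only [weighted]
  rw [mul_assoc (f _), ← Complex.exp_add, mul_left_comm, ← Complex.exp_add]
  congr 2
  rw [I_mul_im_eq, conj_pairing]
  have h := pairing_sphere_relation z s ω
  simp only [pairing_sub_left, pairing_sub_right, pairing_self] at h ⊢
  push_cast at h ⊢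
  linear_combination (-1 / 4 : ℂ) * h

/-- The phase is the inverse of that of the right mean; eliminating the same pairing z·ū now gives κ
= -1/2. -/
theorem twistedConvLeft_eq (f : Cn n → ℂ) (z : Cn n) {s : ℝ} (hs : 0 < s) :
    twistedConvLeft (sphereMeasure n s) f z =
      Complex.exp (((‖z‖ ^ 2 : ℝ) - (s ^ 2 : ℝ)) / 4) * sphMean (-1 / 2) f z s := by
  rw [twistedConvLeft, integral_sphereMeasure hs, sphMean, ← integral_const_mul]
  refine integral_congr_ae (.of_forall fun ω => ?_)
  simp only [weighted]
  rw [mul_assoc (f _), ← Complex.exp_add, mul_left_comm, ← Complex.exp_add]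
  congr 2
  rw [I_mul_im_eq, conj_pairing]
  have h := pairing_sphere_relation z s ω
  simp only [pairing_sub_left, pairing_sub_right, pairing_self] at h ⊢
  push_cast at h ⊢
  linear_combination (1 / 4 : ℂ) * h

/-! ### Admissible spheres -/

theorem exists_unit_vector [NeZero n] (z : Cn n) : ∃ v : Cn n, ‖v‖ = 1 ∧ z = ‖z‖ • v := by
  rcases eq_or_ne z 0 with rfl | hz
  · obtain ⟨v, hv⟩ := exists_norm_eq (Cn n) (zero_le_one (α := ℝ))
    exact ⟨v, hv, by simp⟩
  · refine ⟨‖z‖⁻¹ • z, ?_, ?_⟩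
    · rw [norm_smul, norm_inv, norm_norm, inv_mul_cancel₀ (norm_ne_zero_iff.2 hz)]
    · rw [smul_smul, mul_inv_cancel₀ (norm_ne_zero_iff.2 hz), one_smul]

theorem of_sphere_subset_Ann [NeZero n] {r : ℝ} {R : EReal} {z : Cn n} {s : ℝ} (hs : 0 < s)
    (h : sphere z s ⊆ Ann n r R) : r < |‖z‖ - s| ∧ ((s + ‖z‖ : ℝ) : EReal) < R := by
  obtain ⟨v, hv, hz⟩ := exists_unit_vector z
  have h1 : z + s • v ∈ sphere z s := by
    rw [mem_sphere_iff_norm, add_sub_cancel_left, norm_smul, hv, mul_one, Real.norm_eq_abs,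
      abs_of_pos hs]
  have h2 : z - s • v ∈ sphere z s := by
    rw [mem_sphere_iff_norm, sub_sub_cancel_left, norm_neg, norm_smul, hv, mul_one,
      Real.norm_eq_abs, abs_of_pos hs]
  have n1 : ‖z + s • v‖ = s + ‖z‖ := by
    conv_lhs => rw [hz, ← add_smul]
    rw [norm_smul, hv, mul_one, Real.norm_eq_abs, abs_of_nonneg (by positivity), add_comm]
  have n2 : ‖z - s • v‖ = |‖z‖ - s| := by
    conv_lhs => rw [hz, ← sub_smul]
    rw [norm_smul, hv, mul_one, Real.norm_eq_abs]
  have h3 := (h h1).2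
  have h4 := (h h2).1
  rw [n1] at h3
  rw [n2] at h4
  exact ⟨h4, h3⟩

/-- The extreme norms on the sphere, s + |z| and |s - |z||, occur on the line through 0 and z.
Containing the ball of radius r excludes the case |z| - s > r. -/
theorem admissible_iff [NeZero n] {r : ℝ} (hr : 0 ≤ r) {R : EReal} (z : Cn n) {s : ℝ} (hs : 0 < s) :
    (sphere z s ⊆ Ann n r R ∧ closedBall (0 : Cn n) r ⊆ closedBall z s) ↔
      r + ‖z‖ < s ∧ ((s + ‖z‖ : ℝ) : EReal) < R := by
  constructor
  · rintro ⟨h1, h2⟩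
    obtain ⟨h3, h4⟩ := of_sphere_subset_Ann hs h1
    refine ⟨?_, h4⟩
    obtain ⟨v, hv, hz⟩ := exists_unit_vector z
    have h5 : -(r • v) ∈ closedBall (0 : Cn n) r := by
      rw [mem_closedBall_zero_iff, norm_neg, norm_smul, hv, mul_one, Real.norm_eq_abs,
        abs_of_nonneg hr]
    have h6 := h2 h5
    have n1 : ‖-(r • v) - z‖ = r + ‖z‖ := by
      conv_lhs => rw [hz, ← neg_smul, ← sub_smul]
      rw [norm_smul, hv, mul_one, Real.norm_eq_abs, abs_of_nonpos (by linarith [norm_nonneg z])]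
      ring
    rw [mem_closedBall_iff_norm, n1] at h6
    rcases lt_abs.1 h3 with h | h <;> linarith [norm_nonneg z]
  · rintro ⟨h1, h2⟩
    constructor
    · intro w hw
      rw [mem_sphere_iff_norm] at hw
      constructor
      · have := norm_sub_le w z
        linarith
      · refine lt_of_le_of_lt ?_ h2
        rw [EReal.coe_le_coe_iff]
        have := norm_add_le (w - z) z
        rwa [sub_add_cancel, hw] at this
    · intro w hw
      rw [mem_closedBall_zero_iff] at hw
      rw [mem_closedBall_iff_norm]
      have := norm_sub_le w z
      linarith

/-- All admissible weighted means of `f` vanish. -/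
def MeansVanish (κ r : ℝ) (R : EReal) (f : Cn n → ℂ) : Prop :=
  ∀ (z : Cn n) (s : ℝ), r + ‖z‖ < s → ((s + ‖z‖ : ℝ) : EReal) < R → sphMean κ f z s = 0

theorem mem_ZStar_iff [NeZero n] {r : ℝ} (hr : 0 ≤ r) {R : EReal} {f : Cn n → ℂ}
    (hf : ContinuousOn f (Ann n r R)) :
    f ∈ ZStar n r R ↔ MeansVanish (1 / 2) r R f ∧ MeansVanish (-1 / 2) r R f := by
  have key : f ∈ ZStar n r R ↔ ∀ (z : Cn n) (s : ℝ), r + ‖z‖ < s → ((s + ‖z‖ : ℝ) : EReal) < R →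
      sphMean (1 / 2) f z s = 0 ∧ sphMean (-1 / 2) f z s = 0 := by
    constructor
    · rintro ⟨-, h⟩ z s h1 h2
      have hs : 0 < s := by linarith [norm_nonneg z]
      obtain ⟨h3, h4⟩ := (admissible_iff hr z hs).2 ⟨h1, h2⟩
      have := h z s hs h3 h4
      rw [twistedConvRight_eq f z hs, twistedConvLeft_eq f z hs] at this
      simpa [Complex.exp_ne_zero] using this
    · refine fun h => ⟨hf, fun z s hs h3 h4 => ?_⟩
      obtain ⟨h1, h2⟩ := (admissible_iff hr z hs).1 ⟨h3, h4⟩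
      rw [twistedConvRight_eq f z hs, twistedConvLeft_eq f z hs, (h z s h1 h2).1, (h z s h1 h2).2]
      simp
  rw [key]
  exact ⟨fun h => ⟨fun z s h1 h2 => (h z s h1 h2).1, fun z s h1 h2 => (h z s h1 h2).2⟩,
    fun h z s h1 h2 => ⟨h.1 z s h1 h2, h.2 z s h1 h2⟩⟩

/-! ### The weak form -/

theorem isOpen_Ann (r : ℝ) (R : EReal) : IsOpen (Ann n r R) :=
  (isOpen_lt continuous_const continuous_norm).inter
    (isOpen_lt (continuous_coe_real_ereal.comp continuous_norm) continuous_const)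

theorem continuousOn_weighted {κ r : ℝ} {R : EReal} {f : Cn n → ℂ}
    (hf : ContinuousOn f (Ann n r R)) : ContinuousOn (weighted κ f) (Ann n r R) := by
  refine hf.mul (Continuous.continuousOn ?_)
  fun_prop

theorem continuous_mul_of_eq_zero {U K : Set (Cn n)} (hU : IsOpen U) (hK : IsCompact K) (hKU : K ⊆ U)
    {g k : Cn n → ℂ} (hg : ContinuousOn g U) (hk : Continuous k) (h0 : ∀ u, u ∉ K → k u = 0) :
    Continuous (fun u => g u * k u) ∧ HasCompactSupport fun u => g u * k u := by
  have ht : tsupport (fun u => g u * k u) ⊆ K := by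
    refine closure_minimal (fun u hu => ?_) hK.isClosed
    by_contra h
    exact hu (by simp [h0 u h])
  exact ⟨(hg.mul hk.continuousOn).continuous_of_tsupport_subset hU (ht.trans hKU),
    hK.of_isClosed_subset (isClosed_tsupport _) ht⟩

theorem integral_weak_eq [NeZero n] {κ r : ℝ} {R : EReal} {f : Cn n → ℂ}
    (hf : ContinuousOn f (Ann n r R)) {K : Set (Cn n)} (hK : IsCompact K) (hKA : K ⊆ Ann n r R)
    (z : Cn n) {φ : ℝ → ℂ} (hφ : Continuous φ) (h0 : ∀ u, u ∉ K → φ (‖u - z‖ ^ 2) = 0) :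
    ∫ u, weighted κ f u * (φ (‖u - z‖ ^ 2) * Complex.exp (κ * pairing u z)) =
      (surf n / 2 : ℝ) * ∫ t in Set.Ioi (0 : ℝ), (t : ℂ) ^ (n - 1) *
        (φ t * sphMean κ f z (Real.sqrt t)) := by
  have hc := continuous_mul_of_eq_zero (isOpen_Ann r R) hK hKA (continuousOn_weighted (κ := κ) hf)
    (k := fun u => φ (‖u - z‖ ^ 2) * Complex.exp (κ * pairing u z)) (by fun_prop)
    (fun u hu => by rw [h0 u hu, zero_mul])
  rw [← integral_sub_left_eq_self _ _ z, integral_polar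
    ((hc.1.integrable_of_hasCompactSupport hc.2).comp_sub_left z)]
  congr 1
  refine setIntegral_congr_fun measurableSet_Ioi fun t ht => ?_
  have ht0 : (0 : ℝ) < t := ht
  rw [sphMean]
  congr 1
  rw [← integral_const_mul]
  refine integral_congr_ae (.of_forall fun ω => ?_)
  simp only []
  rw [sub_sub_cancel_left, norm_neg, norm_smul, norm_eq_of_mem_sphere, mul_one, Real.norm_eq_abs,
    sq_abs, Real.sq_sqrt ht0.le]
  ring

/-- In polar coordinates about z every sphere charged by φ lies in the annulus; `hz` makes it
enclose the origin, which makes it admissible. -/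
theorem integral_weak_eq_zero [NeZero n] {κ r : ℝ} (hr : 0 ≤ r) {R : EReal} {f : Cn n → ℂ}
    (hf : ContinuousOn f (Ann n r R)) (hv : MeansVanish κ r R f) {K : Set (Cn n)}
    (hK : IsCompact K) (hKA : K ⊆ Ann n r R)
    (z : Cn n) {φ : ℝ → ℂ} (hφ : Continuous φ) (h0 : ∀ u, u ∉ K → φ (‖u - z‖ ^ 2) = 0)
    (hz : ∀ s, 0 < s → φ (s ^ 2) ≠ 0 → ‖z‖ < s) :
    ∫ u, weighted κ f u * (φ (‖u - z‖ ^ 2) * Complex.exp (κ * pairing u z)) = 0 := by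
  rw [integral_weak_eq hf hK hKA z hφ h0]
  suffices h1 : ∫ t in Set.Ioi (0 : ℝ), (t : ℂ) ^ (n - 1) *
      (φ t * sphMean κ f z (Real.sqrt t)) = 0 by
    rw [h1, mul_zero]
  refine setIntegral_eq_zero_of_forall_eq_zero fun t ht => ?_
  have ht0 : (0 : ℝ) < t := ht
  have hs := Real.sqrt_pos.2 ht0
  by_cases h1 : φ t = 0
  · simp [h1]
  have h2 : sphere z (Real.sqrt t) ⊆ Ann n r R := by
    refine fun u hu => hKA ?_
    by_contra h
    have := h0 u h
    rw [mem_sphere_iff_norm.1 hu, Real.sq_sqrt ht0.le] at this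
    exact h1 this
  obtain ⟨h3, h4⟩ := of_sphere_subset_Ann hs h2
  have h5 := hz _ hs (by rwa [Real.sq_sqrt ht0.le])
  rw [hv z _ ?_ h4]
  · simp
  · rcases lt_abs.1 h3 with h | h <;> linarith

/-- The squares of the radii `s` with `r + a < s` and `s + a < R`. -/
def radSet (r : ℝ) (R : EReal) (a : ℝ) : Set ℝ :=
  {t | 0 < t ∧ r + a < Real.sqrt t ∧ ((Real.sqrt t + a : ℝ) : EReal) < R}

theorem isOpen_radSet (r : ℝ) (R : EReal) (a : ℝ) : IsOpen (radSet r R a) := by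
  refine (isOpen_lt continuous_const continuous_id).inter
    ((isOpen_lt continuous_const Real.continuous_sqrt).inter
      (isOpen_lt (continuous_coe_real_ereal.comp ?_) continuous_const))
  fun_prop

theorem ordConnected_radSet (r : ℝ) (R : EReal) (a : ℝ) : (radSet r R a).OrdConnected := by
  refine ⟨fun x hx y hy t ht => ⟨hx.1.trans_le ht.1, hx.2.1.trans_le (Real.sqrt_le_sqrt ht.1),
    lt_of_le_of_lt ?_ hy.2.2⟩⟩
  rw [EReal.coe_le_coe_iff]
  linarith [Real.sqrt_le_sqrt ht.2]

theorem sq_mem_radSet_zero {r : ℝ} {R : EReal} (hr : 0 ≤ r) {ρ : ℝ} (h1 : r < ρ)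
    (h2 : (ρ : EReal) < R) : ρ ^ 2 ∈ radSet r R 0 := by
  have h0 : 0 < ρ := by linarith
  refine ⟨by positivity, ?_, ?_⟩ <;> rw [Real.sqrt_sq h0.le, add_zero] <;> assumption

theorem nonempty_radSet_zero {r : ℝ} {R : EReal} (hr : 0 ≤ r) (hrR : (r : EReal) < R) :
    (radSet r R 0).Nonempty := by
  obtain ⟨ρ, h1, h2⟩ := EReal.lt_iff_exists_real_btwn.1 hrR
  exact ⟨ρ ^ 2, sq_mem_radSet_zero hr (by exact_mod_cast h1) h2⟩

theorem mem_Ann_of_norm_sub_sq_mem {r : ℝ} {R : EReal} {u z : Cn n}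
    (h : ‖u - z‖ ^ 2 ∈ radSet r R ‖z‖) : u ∈ Ann n r R := by
  obtain ⟨-, h1, h2⟩ := h
  rw [Real.sqrt_sq (norm_nonneg _)] at h1 h2
  constructor
  · have := norm_sub_le u z
    linarith
  · refine lt_of_le_of_lt ?_ h2
    rw [EReal.coe_le_coe_iff]
    have := norm_add_le (u - z) z
    rwa [sub_add_cancel] at this

theorem isCompact_norm_sub_sq {S : Set ℝ} (hS : IsCompact S) (z : Cn n) :
    IsCompact {u : Cn n | ‖u - z‖ ^ 2 ∈ S} := by
  obtain ⟨M, hM⟩ := hS.bddAbove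
  refine (isCompact_closedBall z (Real.sqrt M)).of_isClosed_subset
    (hS.isClosed.preimage (by fun_prop)) fun u hu => ?_
  rw [mem_closedBall_iff_norm]
  exact Real.le_sqrt_of_sq_le (hM hu)

theorem continuousOn_integral_sphere [NeZero n] {U : Set ℝ} (hU : IsOpen U)
    {F : ℝ → sphere (0 : Cn n) 1 → ℂ}
    (hF : ContinuousOn (fun x : ℝ × sphere (0 : Cn n) 1 => F x.1 x.2) (U ×ˢ Set.univ)) :
    ContinuousOn (fun t => ∫ ω, F t ω ∂unitSphereMeasure n) U := by
  have := hU.locallyCompactSpace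
  rw [continuousOn_iff_continuous_domRestrict]
  have h1 : Continuous (fun x : U × sphere (0 : Cn n) 1 => F x.1 x.2) :=
    hF.comp_continuous (f := fun x : U × sphere (0 : Cn n) 1 => ((x.1 : ℝ), x.2)) (by fun_prop)
      fun x => ⟨x.1.2, trivial⟩
  have h2 := continuous_parametric_integral_of_continuous (μ := unitSphereMeasure n)
    (f := fun (t : U) ω => F t ω) h1 isCompact_univ
  simp only [Measure.restrict_univ] at h2
  exact h2

/-- The mean is continuous in the squared radius, so vanishing against all test functions forces it
to vanish pointwise. -/
theorem meansVanish_of_integral_weak [NeZero n] {κ r : ℝ} (hr : 0 ≤ r) {R : EReal} {f : Cn n → ℂ}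
    (hf : ContinuousOn f (Ann n r R))
    (h : ∀ (z : Cn n) (φ : testSpace (radSet r R ‖z‖)), ∫ u, weighted κ f u *
      ((φ : ℝ → ℂ) (‖u - z‖ ^ 2) * Complex.exp (κ * pairing u z)) = 0) :
    MeansVanish κ r R f := by
  intro z s h1 h2
  have hs : 0 < s := by linarith [norm_nonneg z]
  have hcont : ContinuousOn (fun t : ℝ => (t : ℂ) ^ (n - 1) * sphMean κ f z (Real.sqrt t))
      (radSet r R ‖z‖) := by
    refine ContinuousOn.mul (by fun_prop) (continuousOn_integral_sphere (isOpen_radSet _ _ _) ?_)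
    refine ContinuousOn.mul ((continuousOn_weighted hf).comp (by fun_prop) fun x hx => ?_) (by fun_prop)
    refine mem_Ann_of_norm_sub_sq_mem (z := z) ?_
    rw [sub_sub_cancel_left, norm_neg, norm_smul, norm_eq_of_mem_sphere, mul_one, Real.norm_eq_abs,
      sq_abs, Real.sq_sqrt hx.1.1.le]
    exact hx.1
  have hzero := eqOn_zero_of_integral_testSpace (isOpen_radSet r R ‖z‖) hcont fun φ => by
    have h3 := h z φ
    rw [integral_weak_eq hf (isCompact_norm_sub_sq (testSpace_hasCompactSupport φ) z)
      (fun u hu => mem_Ann_of_norm_sub_sq_mem (φ.2.2.2 hu)) z (testSpace_continuous φ)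
      (fun u hu => image_eq_zero_of_notMem_tsupport hu)] at h3
    have h4 := (mul_eq_zero.1 h3).resolve_left
      (by exact_mod_cast (half_pos (surf_pos (n := n))).ne')
    rw [← h4, setIntegral_eq_integral_of_forall_compl_eq_zero]
    · congr 1
      ext t
      ring
    · intro t ht
      rw [testSpace_eq_zero φ fun h => ht h.1]
      simp
  have hmem : s ^ 2 ∈ radSet r R ‖z‖ := by
    refine ⟨by positivity, ?_, ?_⟩ <;> rwa [Real.sqrt_sq hs.le]
  have h3 := hzero _ hmem
  rw [Real.sqrt_sq hs.le] at h3
  exact (mul_eq_zero.1 h3).resolve_left (pow_ne_zero _ (by exact_mod_cast (pow_pos hs 2).ne'))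

end

/-! ### Necessity: Taylor coefficients in the centre and the radial equation. -/

section

variable {n : ℕ} {I : Set ℝ}

/-! ### Taylor expansion under the integral sign -/

theorem continuous_taylorTerm (κ : ℝ) (φ : testSpace I) (m : ℕ) :
    Continuous fun x : ℂ × ℂ × ℝ => taylorTerm κ φ m x.1 x.2.1 x.2.2 := by
  unfold taylorTerm
  refine continuous_finsetSum _ fun l _ => ?_
  have := testSpace_continuous (mixedDeriv I κ l (m - l) φ)
  fun_prop

/-- Uniformity in `c` lets `c` depend on ε. Sufficiency uses c = ε²|z|², while necessity takes c =
0. -/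
theorem exists_integral_taylor_bound {G : Cn n → ℂ} {K : Set (Cn n)} (hK : IsCompact K)
    (hG : IntegrableOn G K) (κ : ℝ) (φ : testSpace I) (ζ : Cn n) (N : ℕ) :
    ∃ C, 0 ≤ C ∧ ∀ ε c : ℝ, 0 ≤ ε → ε ≤ 1 →
      ‖(∫ u in K, G u * ((φ : ℝ → ℂ) (‖u‖ ^ 2 + c - ε * (2 * (pairing u ζ).re)) *
          Complex.exp (κ * ε * pairing u ζ))) -
        ∑ m ∈ Finset.range (N + 1), (ε : ℂ) ^ m / (m.factorial : ℂ) *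
          ∫ u in K, G u * taylorTerm κ φ m (pairing ζ u) (pairing u ζ) (‖u‖ ^ 2 + c)‖
        ≤ C * ε ^ (N + 1) := by
  obtain ⟨M, hM⟩ := hK.exists_bound_of_continuousOn continuousOn_id
  obtain ⟨C, hC0, hC⟩ := exists_taylor_bound κ φ N (M * ‖ζ‖)
  refine ⟨(∫ u in K, ‖G u‖) * C, mul_nonneg (integral_nonneg fun _ => norm_nonneg _) hC0,
    fun ε c h0 h1 => ?_⟩
  have hφ := testSpace_continuous φ
  have hi1 : IntegrableOn (fun u => G u * ((φ : ℝ → ℂ) (‖u‖ ^ 2 + c - ε * (2 * (pairing u ζ).re)) *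
      Complex.exp (κ * ε * pairing u ζ))) K :=
    hG.mul_continuousOn (Continuous.continuousOn (by fun_prop)) hK
  have hi2 : ∀ m, IntegrableOn (fun u => G u * taylorTerm κ φ m (pairing ζ u) (pairing u ζ)
      (‖u‖ ^ 2 + c)) K := fun m =>
    hG.mul_continuousOn (((continuous_taylorTerm κ φ m).comp
      (by fun_prop : Continuous fun u : Cn n => (pairing ζ u, pairing u ζ, ‖u‖ ^ 2 + c))).continuousOn)
      hK
  have heq : (∫ u in K, G u * ((φ : ℝ → ℂ) (‖u‖ ^ 2 + c - ε * (2 * (pairing u ζ).re)) *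
          Complex.exp (κ * ε * pairing u ζ))) -
        ∑ m ∈ Finset.range (N + 1), (ε : ℂ) ^ m / (m.factorial : ℂ) *
          ∫ u in K, G u * taylorTerm κ φ m (pairing ζ u) (pairing u ζ) (‖u‖ ^ 2 + c) =
      ∫ u in K, G u * ((φ : ℝ → ℂ) (‖u‖ ^ 2 + c - ε * (2 * (pairing u ζ).re)) *
          Complex.exp (κ * ε * pairing u ζ) - ∑ m ∈ Finset.range (N + 1),
            (ε : ℂ) ^ m / (m.factorial : ℂ) *
              taylorTerm κ φ m (pairing ζ u) (pairing u ζ) (‖u‖ ^ 2 + c)) := by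
    simp_rw [← integral_const_mul]
    rw [← integral_finsetSum _ fun m _ => (hi2 m).const_mul _, ← integral_sub hi1
      (integrable_finsetSum _ fun m _ => (hi2 m).const_mul _)]
    congr 1
    ext u
    rw [mul_sub, Finset.mul_sum]
    congr 1
    exact Finset.sum_congr rfl fun m _ => by ring
  rw [heq, mul_assoc, ← integral_mul_const]
  refine norm_integral_le_of_norm_le (hG.norm.mul_const _)
    ((ae_restrict_mem hK.measurableSet).mono fun u hu => ?_)
  rw [norm_mul]
  refine mul_le_mul_of_nonneg_left ?_ (norm_nonneg _)
  refine hC _ _ _ _ _ (pairing_add_pairing ζ u) ?_ ?_ h0 h1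
  · refine (norm_pairing_le _ _).trans ?_
    rw [mul_comm]
    exact mul_le_mul_of_nonneg_right (hM u hu) (norm_nonneg _)
  · exact (norm_pairing_le _ _).trans (mul_le_mul_of_nonneg_right (hM u hu) (norm_nonneg _))

/-- Once the lower coefficients vanish, dividing the bound by ε^m gives |a_m| ≤ Cε for all small ε.
-/
theorem eq_zero_of_forall_norm_sum_le {a : ℕ → ℂ} (h : ∀ N, ∃ C δ : ℝ, 0 < δ ∧ ∀ ε, 0 < ε → ε < δ →
    ‖∑ m ∈ Finset.range (N + 1), (ε : ℂ) ^ m * a m‖ ≤ C * ε ^ (N + 1)) (m : ℕ) : a m = 0 := by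
  induction m using Nat.strong_induction_on with
  | _ m ih =>
    obtain ⟨C, δ, hδ, hC⟩ := h m
    by_contra hne
    have hpos := norm_pos_iff.2 hne
    set ε := min (δ / 2) (‖a m‖ / (2 * (|C| + 1))) with hε
    have h0 : 0 < ε := by positivity
    have h1 := hC ε h0 ((min_le_left _ _).trans_lt (by linarith))
    rw [Finset.sum_range_succ, Finset.sum_eq_zero (fun k hk => by
      rw [ih k (Finset.mem_range.1 hk), mul_zero]), zero_add, norm_mul, norm_pow, Complex.norm_real,
      Real.norm_eq_abs, abs_of_pos h0, pow_succ, ← mul_assoc, mul_comm C, mul_assoc] at h1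
    have h2 := le_of_mul_le_mul_left h1 (pow_pos h0 m)
    have h3 : ε * (2 * (|C| + 1)) ≤ ‖a m‖ := (le_div_iff₀ (by positivity)).1 (min_le_right _ _)
    nlinarith [le_abs_self C]

theorem setIntegral_taylorTerm_eq_zero {G : Cn n → ℂ} {K : Set (Cn n)} (hK : IsCompact K)
    (hG : IntegrableOn G K) (κ : ℝ) (φ : testSpace I) (ζ : Cn n) {δ : ℝ} (hδ : 0 < δ)
    (h : ∀ ε : ℝ, 0 < ε → ε < δ → ∫ u in K, G u * ((φ : ℝ → ℂ) (‖u‖ ^ 2 - ε *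
      (2 * (pairing u ζ).re)) * Complex.exp (κ * ε * pairing u ζ)) = 0) (m : ℕ) :
    ∫ u in K, G u * taylorTerm κ φ m (pairing ζ u) (pairing u ζ) (‖u‖ ^ 2) = 0 := by
  have key := eq_zero_of_forall_norm_sum_le (a := fun m => (m.factorial : ℂ)⁻¹ *
    ∫ u in K, G u * taylorTerm κ φ m (pairing ζ u) (pairing u ζ) (‖u‖ ^ 2)) (fun N => by
      obtain ⟨C, -, hC⟩ := exists_integral_taylor_bound hK hG κ φ ζ N
      refine ⟨C, min δ 1, by positivity, fun ε h0 h1 => ?_⟩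
      have h2 := hC ε 0 h0.le (h1.le.trans (min_le_right _ _))
      simp only [add_zero] at h2
      rw [h ε h0 (h1.trans_le (min_le_left _ _)), zero_sub, norm_neg] at h2
      simpa only [div_eq_mul_inv, mul_assoc] using h2) m
  exact (mul_eq_zero.1 key).resolve_left
    (inv_ne_zero (by exact_mod_cast Nat.factorial_ne_zero m))

/-! ### Supports of derivatives -/

theorem testDeriv_eq_zero {S : Set ℝ} (hS : IsClosed S) {φ : testSpace I}
    (h : ∀ t, t ∉ S → (φ : ℝ → ℂ) t = 0) {t : ℝ} (ht : t ∉ S) :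
    (testDeriv I φ : ℝ → ℂ) t = 0 := by
  have h1 : (φ : ℝ → ℂ) =ᶠ[nhds t] fun _ => 0 :=
    Filter.eventually_of_mem (hS.isOpen_compl.mem_nhds ht) fun s hs => h s hs
  exact h1.deriv_eq.trans (by simp)

theorem mixedDeriv_eq_zero {S : Set ℝ} (hS : IsClosed S) (κ : ℝ) {φ : testSpace I}
    (h : ∀ t, t ∉ S → (φ : ℝ → ℂ) t = 0) (p q : ℕ) :
    ∀ t, t ∉ S → (mixedDeriv I κ p q φ : ℝ → ℂ) t = 0 := by
  induction p with
  | zero =>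
    induction q with
    | zero => simpa [mixedDeriv] using h
    | succ q ih =>
      intro t ht
      rw [mixedDeriv_succ_right, subDeriv_apply, ih t ht, testDeriv_eq_zero hS ih ht]
      simp
  | succ p ih =>
    intro t ht
    rw [mixedDeriv_succ_left, testDeriv_eq_zero hS ih ht]

theorem mixedDeriv_eq_zero_of_notMem (κ : ℝ) (φ : testSpace I) (p q : ℕ) {t : ℝ}
    (ht : t ∉ tsupport (φ : ℝ → ℂ)) : (mixedDeriv I κ p q φ : ℝ → ℂ) t = 0 :=
  mixedDeriv_eq_zero (isClosed_tsupport _) κ (fun _ h => image_eq_zero_of_notMem_tsupport h) p q t ht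

theorem taylorTerm_eq_zero_of_notMem (κ : ℝ) (φ : testSpace I) (m : ℕ) (x y : ℂ) {t : ℝ}
    (ht : t ∉ tsupport (φ : ℝ → ℂ)) : taylorTerm κ φ m x y t = 0 :=
  Finset.sum_eq_zero fun l _ => by rw [mixedDeriv_eq_zero_of_notMem κ φ _ _ ht, mul_zero]

/-! ### Spherical means of harmonic polynomials against powers of the pairing -/

/-- The first alternative is invariance under rotation by a phase; the other two are orthogonality
of harmonics to polynomials of too small a degree. -/
theorem integral_sphere_harm_mul_eq_zero [NeZero n] {h : PolyRing n} {a b : ℕ} (hb : IsBihom h a b)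
    (hh : IsHarm h) (u : Cn n) {a' b' : ℕ} (hne : a + a' ≠ b + b' ∨ a' < b ∨ b' < a) :
    ∫ ω, ev h (ω : Cn n) * (pairing (ω : Cn n) u ^ a' * pairing u (ω : Cn n) ^ b')
      ∂unitSphereMeasure n = 0 := by
  have h1 := hb.mul (isBihom_linZ_pow_mul u a' b')
  have h2 := (integral_sphere_eq_zero_iff h1).2 (by
    rcases hne with hne | hne
    · exact gaussInt_eq_zero_of_ne h1 hne
    · exact gaussInt_harm_mul_eq_zero _ _ _ _ _ _ _ rfl hb hh (isBihom_linZ_pow_mul u a' b') hne)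
  simpa only [ev_mul, ev_pow, ev_linZ, ev_linZb] using h2

theorem exists_integral_sphere_harm_mul [NeZero n] {h : PolyRing n} {a b : ℕ} (hb : IsBihom h a b)
    (hh : IsHarm h) : ∃ c : ℂ, c ≠ 0 ∧ ∀ u : Cn n,
      ∫ ω, ev h (ω : Cn n) * (pairing (ω : Cn n) u ^ b * pairing u (ω : Cn n) ^ a)
        ∂unitSphereMeasure n = c * ev h u := by
  obtain ⟨W, hW, h1⟩ := exists_gaussInt_eq (n := n) (a + b + (b + a))
  refine ⟨W⁻¹ * ((a.factorial : ℂ) * b.factorial * gaussInt n 1), ?_, fun u => ?_⟩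
  · refine mul_ne_zero (inv_ne_zero hW) (mul_ne_zero (mul_ne_zero ?_ ?_) gaussInt_one_ne_zero)
    · exact_mod_cast Nat.factorial_ne_zero a
    · exact_mod_cast Nat.factorial_ne_zero b
  · have h2 := h1 _ _ _ (hb.mul (isBihom_linZ_pow_mul u b a)) (by ring)
    rw [gaussInt_harm_mul_linZ u a b h hb hh] at h2
    simp only [ev_mul, ev_pow, ev_linZ, ev_linZb] at h2
    rw [mul_assoc, mul_right_comm, h2, inv_mul_cancel_left₀ hW]

/-! ### Necessity -/

variable {κ r : ℝ} {R : EReal} {f : Cn n → ℂ}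

theorem integral_taylorTerm_eq_zero [NeZero n] (hr : 0 ≤ r) (hf : ContinuousOn f (Ann n r R))
    (hv : MeansVanish κ r R f) (φ : testSpace (radSet r R 0)) {ζ : Cn n} (hζ : ‖ζ‖ = 1) (m : ℕ) :
    ∫ u, weighted κ f u * taylorTerm κ φ m (pairing ζ u) (pairing u ζ) (‖u‖ ^ 2) = 0 := by
  obtain ⟨δ, hδ, hsub⟩ := (testSpace_hasCompactSupport φ).isCompact.exists_cthickening_subset_open
    (isOpen_radSet r R 0) φ.2.2.2
  have hK1 : IsCompact (cthickening δ (tsupport (φ : ℝ → ℂ))) :=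
    (testSpace_hasCompactSupport φ).isCompact.cthickening
  set K : Set (Cn n) := {u | ‖u - 0‖ ^ 2 ∈ cthickening δ (tsupport (φ : ℝ → ℂ))} with hKdef
  have hK : IsCompact K := isCompact_norm_sub_sq hK1 0
  have hKA : K ⊆ Ann n r R := fun u hu => mem_Ann_of_norm_sub_sq_mem (z := 0) (by
    rw [norm_zero]; exact hsub hu)
  obtain ⟨M, hM⟩ := (testSpace_hasCompactSupport φ).isCompact.bddAbove
  -- If φ is nonzero there, then |u|² - 2|u| ≤ M, so |u| ≤ 2 + |M|. The argument then differs from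
  -- |u|² by at most 2ε(2 + |M|) < δ.
  have hmem : ∀ (ε : ℝ) (u : Cn n), 0 < ε → ε < min 1 (δ / (2 * (2 + |M|))) → u ∉ K →
      (φ : ℝ → ℂ) (‖u‖ ^ 2 - ε * (2 * (pairing u ζ).re)) = 0 := by
    intro ε u h0 h1 hu
    by_contra hne
    refine hu ?_
    have h2 : ‖u‖ ^ 2 - ε * (2 * (pairing u ζ).re) ∈ tsupport (φ : ℝ → ℂ) :=
      subset_tsupport _ hne
    have h3 := hM h2
    have h4 : |(pairing u ζ).re| ≤ ‖u‖ := by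
      refine (Complex.abs_re_le_norm _).trans ((norm_pairing_le _ _).trans ?_)
      rw [hζ, mul_one]
    have h5 : ε < 1 := h1.trans_le (min_le_left _ _)
    have h6 : ε * (2 * (2 + |M|)) < δ :=
      (lt_div_iff₀ (by positivity)).1 (h1.trans_le (min_le_right _ _))
    have h7 : ε * |(pairing u ζ).re| ≤ ‖u‖ := by nlinarith [abs_nonneg (pairing u ζ).re]
    have h8 : ε * (pairing u ζ).re ≤ ‖u‖ :=
      (mul_le_mul_of_nonneg_left (le_abs_self _) h0.le).trans h7
    have h9 : ‖u‖ ≤ 2 + |M| := by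
      by_contra hlt
      nlinarith [le_abs_self M, abs_nonneg M]
    change ‖u - 0‖ ^ 2 ∈ cthickening δ (tsupport (φ : ℝ → ℂ))
    rw [sub_zero]
    refine mem_cthickening_of_dist_le _ _ _ _ h2 ?_
    rw [Real.dist_eq, sub_sub_cancel, abs_mul, abs_mul, abs_of_pos h0, abs_two]
    nlinarith
  have hG : IntegrableOn (weighted κ f) K :=
    ((continuousOn_weighted hf).mono hKA).integrableOn_compact hK
  have key := setIntegral_taylorTerm_eq_zero hK hG κ φ ζ
    (δ := min 1 (δ / (2 * (2 + |M|)))) (by positivity) (fun ε h0 h1 => by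
      rw [setIntegral_eq_integral_of_forall_compl_eq_zero (fun u hu => by
        rw [hmem ε u h0 h1 hu]; simp)]
      have hφ := testSpace_continuous φ
      have h2 : ∀ u : Cn n, ‖u - ε • ζ‖ ^ 2 - ε ^ 2 = ‖u‖ ^ 2 - ε * (2 * (pairing u ζ).re) := by
        intro u
        rw [norm_sub_sq_eq, norm_smul, hζ, pairing_smul_right, Complex.re_ofReal_mul, mul_one,
          Real.norm_eq_abs, sq_abs]
        ring
      -- Shifting φ by ε² cancels the quadratic term of |u - εζ|², leaving an argument affine in ε.
      have h3 := integral_weak_eq_zero hr hf hv hK hKA (ε • ζ)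
        (φ := fun t => (φ : ℝ → ℂ) (t - ε ^ 2)) (by fun_prop)
        (fun u hu => by simp only [h2]; exact hmem ε u h0 h1 hu) (fun s hs hne => by
          have h4 : s ^ 2 - ε ^ 2 ∈ radSet r R 0 := by
            by_contra h5
            exact hne (testSpace_eq_zero φ h5)
          have h5 := h4.1
          rw [norm_smul, hζ, mul_one, Real.norm_eq_abs, abs_of_pos h0]
          nlinarith)
      simp only [h2, pairing_smul_right, ← mul_assoc] at h3 ⊢
      exact h3) m
  rwa [setIntegral_eq_integral_of_forall_compl_eq_zero (fun u hu => by
    rw [taylorTerm_eq_zero_of_notMem, mul_zero]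
    exact fun h => hu (self_subset_cthickening _ (by rwa [sub_zero]))) ] at key

/-- The Taylor coefficient of order p + q is averaged over the direction ζ of the centre against h.
The reproducing property isolates the one mixed derivative (d/dt)^p (κ - d/dt)^q. -/
theorem integral_mixedDeriv_eq_zero [NeZero n] (hr : 0 ≤ r) (hf : ContinuousOn f (Ann n r R))
    (hv : MeansVanish κ r R f) {p q : ℕ} {h : PolyRing n} (hb : IsBihom h q p) (hh : IsHarm h)
    (φ : testSpace (radSet r R 0)) :
    ∫ u, weighted κ f u * (ev h u * (mixedDeriv _ κ p q φ : ℝ → ℂ) (‖u‖ ^ 2)) = 0 := by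
  obtain ⟨c, hc, hc'⟩ := exists_integral_sphere_harm_mul hb hh
  set K : Set (Cn n) := {u | ‖u - 0‖ ^ 2 ∈ tsupport (φ : ℝ → ℂ)} with hKdef
  have hK : IsCompact K := isCompact_norm_sub_sq (testSpace_hasCompactSupport φ) 0
  have hKA : K ⊆ Ann n r R := fun u hu => mem_Ann_of_norm_sub_sq_mem (z := 0) (by
    rw [norm_zero]; exact φ.2.2.2 hu)
  set g : ℕ → Cn n → ℂ := fun l u => weighted κ f u *
    (mixedDeriv _ κ l (p + q - l) φ : ℝ → ℂ) (‖u‖ ^ 2) with hg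
  have hg0 : ∀ l u, u ∉ K → g l u = 0 := fun l u hu => by
    simp only [hg]
    rw [mixedDeriv_eq_zero_of_notMem, mul_zero]
    exact fun h => hu (by change ‖u - 0‖ ^ 2 ∈ tsupport (φ : ℝ → ℂ); rwa [sub_zero])
  have hgc : ∀ l, Continuous (g l) := fun l => by
    have := testSpace_continuous (mixedDeriv _ κ l (p + q - l) φ)
    refine (continuous_mul_of_eq_zero (isOpen_Ann r R) hK hKA (continuousOn_weighted hf)
      (k := fun u => (mixedDeriv _ κ l (p + q - l) φ : ℝ → ℂ) (‖u‖ ^ 2)) (by fun_prop)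
      fun u hu => ?_).1
    exact mixedDeriv_eq_zero_of_notMem κ φ _ _
      fun h => hu (by change ‖u - 0‖ ^ 2 ∈ tsupport (φ : ℝ → ℂ); rwa [sub_zero])
  set H : sphere (0 : Cn n) 1 → Cn n → ℂ := fun ω u => ∑ l ∈ Finset.range (p + q + 1),
    (((p + q).choose l : ℂ) * (-1) ^ l * g l u) * (ev h (ω : Cn n) *
      (pairing (ω : Cn n) u ^ l * pairing u (ω : Cn n) ^ (p + q - l))) with hH
  have hHc : Continuous (Function.uncurry H) := by
    have h1 : Continuous fun x : sphere (0 : Cn n) 1 × Cn n => pairing (x.1 : Cn n) x.2 :=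
      continuous_pairing.comp (by fun_prop : Continuous fun x : sphere (0 : Cn n) 1 × Cn n =>
        ((x.1 : Cn n), x.2))
    have h2 : Continuous fun x : sphere (0 : Cn n) 1 × Cn n => pairing x.2 (x.1 : Cn n) :=
      continuous_pairing.comp (by fun_prop : Continuous fun x : sphere (0 : Cn n) 1 × Cn n =>
        (x.2, (x.1 : Cn n)))
    refine continuous_finsetSum _ fun l _ => ?_
    have h3 := hgc l
    fun_prop
  have hHs : HasCompactSupport (Function.uncurry H) := by
    refine HasCompactSupport.intro (isCompact_univ.prod hK) fun x hx => ?_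
    refine Finset.sum_eq_zero fun l _ => ?_
    rw [hg0 l x.2 fun h => hx ⟨trivial, h⟩]
    simp
  have hswap := integral_integral_swap_of_hasCompactSupport hHc hHs
    (μ := unitSphereMeasure n) (ν := volume)
  have hleft : ∀ ω : sphere (0 : Cn n) 1, ∫ u, H ω u = 0 := by
    intro ω
    have h1 := integral_taylorTerm_eq_zero hr hf hv φ (norm_eq_of_mem_sphere ω) (p + q)
    have h2 : ∀ u, H ω u = ev h (ω : Cn n) * (weighted κ f u * taylorTerm κ φ (p + q)
        (pairing (ω : Cn n) u) (pairing u (ω : Cn n)) (‖u‖ ^ 2)) := by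
      intro u
      simp only [hH, taylorTerm, hg, Finset.mul_sum]
      refine Finset.sum_congr rfl fun l _ => ?_
      rw [neg_pow (pairing (ω : Cn n) u)]
      ring
    simp only [h2]
    rw [integral_const_mul, h1, mul_zero]
  have hright : ∀ u, ∫ ω, H ω u ∂unitSphereMeasure n =
      (((p + q).choose p : ℂ) * (-1) ^ p * c) * (weighted κ f u *
        (ev h u * (mixedDeriv _ κ p q φ : ℝ → ℂ) (‖u‖ ^ 2))) := by
    intro u
    simp only [hH]
    rw [integral_finsetSum]
    · rw [Finset.sum_eq_single p]
      · rw [integral_const_mul, Nat.add_sub_cancel_left, hc']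
        simp only [hg, Nat.add_sub_cancel_left]
        ring
      · intro l hl hne
        rw [integral_const_mul, integral_sphere_harm_mul_eq_zero hb hh, mul_zero]
        -- For l ≠ p either l < p, or the other exponent p + q - l is below q.
        right
        have := Finset.mem_range.1 hl
        omega
      · intro hp
        exact absurd (Finset.mem_range.2 (by omega)) hp
    · intro l _
      refine Continuous.integrable_of_hasCompactSupport ?_ (HasCompactSupport.of_compactSpace _)
      fun_prop
  simp only [hleft, hright, integral_zero] at hswap
  rw [integral_const_mul] at hswap
  refine (mul_eq_zero.1 hswap.symm).resolve_left (mul_ne_zero (mul_ne_zero ?_ ?_) hc)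
  · exact_mod_cast (Nat.choose_pos (Nat.le_add_right p q)).ne'
  · exact pow_ne_zero _ (by norm_num)

theorem expPoly_C_mul (κ : ℝ) (c : ℂ) (A B : Polynomial ℂ) (t : ℝ) :
    expPoly κ (Polynomial.C c * A) (Polynomial.C c * B) t = c * expPoly κ A B t := by
  simp only [expPoly, Polynomial.eval_mul, Polynomial.eval_C]
  ring

theorem continuousOn_radial_mean [NeZero n] (hf : ContinuousOn f (Ann n r R)) (κ : ℝ)
    {k : Cn n → ℂ} (hk : Continuous k) :
    ContinuousOn (fun t : ℝ => ∫ ω, weighted κ f (Real.sqrt t • (ω : Cn n)) *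
      k (Real.sqrt t • (ω : Cn n)) ∂unitSphereMeasure n) (radSet r R 0) := by
  refine continuousOn_integral_sphere (isOpen_radSet _ _ _) ?_
  refine ContinuousOn.mul ((continuousOn_weighted hf).comp (by fun_prop) fun x hx => ?_) (by fun_prop)
  refine mem_Ann_of_norm_sub_sq_mem (z := 0) ?_
  rw [sub_zero, norm_zero, norm_smul, norm_eq_of_mem_sphere, mul_one, Real.norm_eq_abs,
    sq_abs, Real.sq_sqrt hx.1.1.le]
  exact hx.1

/-- The functional φ ↦ ∫ F h φ(|u|²) is an exponential polynomial by `exists_expPoly_of_mixedDeriv`.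
Polar coordinates give its density as the radial profile, and continuity upgrades equality as
functionals to equality at each t. -/
theorem exists_expPoly_of_meansVanish [NeZero n] (hr : 0 ≤ r) (hrR : (r : EReal) < R)
    (hf : ContinuousOn f (Ann n r R)) (hκ : κ ≠ 0) (hv : MeansVanish κ r R f) {p q : ℕ}
    {h : PolyRing n} (hb : IsBihom h q p) (hh : IsHarm h) :
    ∃ A ∈ Polynomial.degreeLT ℂ p, ∃ B ∈ Polynomial.degreeLT ℂ q, ∀ t ∈ radSet r R 0,
      (t : ℂ) ^ (n - 1) * ∫ ω, weighted κ f (Real.sqrt t • (ω : Cn n)) *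
        ev h (Real.sqrt t • (ω : Cn n)) ∂unitSphereMeasure n = expPoly κ A B t := by
  have hcs : ∀ φ : testSpace (radSet r R 0),
      Continuous (fun u => weighted κ f u * (ev h u * (φ : ℝ → ℂ) (‖u‖ ^ 2))) ∧
      HasCompactSupport fun u => weighted κ f u * (ev h u * (φ : ℝ → ℂ) (‖u‖ ^ 2)) := by
    intro φ
    have hφ := testSpace_continuous φ
    refine continuous_mul_of_eq_zero (isOpen_Ann r R)
      (isCompact_norm_sub_sq (testSpace_hasCompactSupport φ) 0) (fun u hu => ?_)
      (continuousOn_weighted hf)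
      (k := fun u => ev h u * (φ : ℝ → ℂ) (‖u‖ ^ 2)) (by fun_prop) fun u hu => ?_
    · exact mem_Ann_of_norm_sub_sq_mem (z := 0) (by rw [norm_zero]; exact φ.2.2.2 hu)
    · rw [image_eq_zero_of_notMem_tsupport (f := (φ : ℝ → ℂ)), mul_zero]
      exact fun h => hu (by change ‖u - 0‖ ^ 2 ∈ tsupport (φ : ℝ → ℂ); rwa [sub_zero])
  have hint := fun φ => (hcs φ).1.integrable_of_hasCompactSupport (μ := volume) (hcs φ).2
  let T : testSpace (radSet r R 0) →ₗ[ℂ] ℂ :=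
    { toFun := fun φ => ∫ u, weighted κ f u * (ev h u * (φ : ℝ → ℂ) (‖u‖ ^ 2))
      map_add' := fun φ ψ => by
        rw [← integral_add (hint φ) (hint ψ)]
        refine integral_congr_ae (.of_forall fun u => ?_)
        simp only [Submodule.coe_add, Pi.add_apply]
        ring
      map_smul' := fun c φ => by
        rw [RingHom.id_apply, smul_eq_mul, ← integral_const_mul]
        refine integral_congr_ae (.of_forall fun u => ?_)
        simp only [Submodule.coe_smul, Pi.smul_apply, smul_eq_mul]
        ring }
  obtain ⟨A, hA, B, hB, hAB⟩ := exists_expPoly_of_mixedDeriv (isOpen_radSet r R 0)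
    (ordConnected_radSet r R 0) (nonempty_radSet_zero hr hrR) hκ p q T
    (integral_mixedDeriv_eq_zero hr hf hv hb hh)
  have hs0 : ((surf n / 2 : ℝ) : ℂ) ≠ 0 := by exact_mod_cast (half_pos (surf_pos (n := n))).ne'
  refine ⟨Polynomial.C ((surf n / 2 : ℝ) : ℂ)⁻¹ * A, C_mul_mem_degreeLT _ hA,
    Polynomial.C ((surf n / 2 : ℝ) : ℂ)⁻¹ * B, C_mul_mem_degreeLT _ hB, fun t ht => ?_⟩
  rw [expPoly_C_mul, eq_inv_mul_iff_mul_eq₀ hs0, ← sub_eq_zero]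
  have hw : ContinuousOn (fun t : ℝ => ((surf n / 2 : ℝ) : ℂ) * ((t : ℂ) ^ (n - 1) *
      ∫ ω, weighted κ f (Real.sqrt t • (ω : Cn n)) * ev h (Real.sqrt t • (ω : Cn n))
        ∂unitSphereMeasure n)) (radSet r R 0) :=
    continuousOn_const.mul (ContinuousOn.mul (by fun_prop)
      (continuousOn_radial_mean hf κ (continuous_ev h)))
  refine eqOn_zero_of_integral_testSpace (isOpen_radSet r R 0)
    (hw.sub (continuous_expPoly κ A B).continuousOn) (fun φ => ?_) t ht
  simp only [Pi.sub_apply, sub_mul]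
  have hi : Integrable fun t : ℝ => ((surf n / 2 : ℝ) : ℂ) * ((t : ℂ) ^ (n - 1) *
      ∫ ω, weighted κ f (Real.sqrt t • (ω : Cn n)) * ev h (Real.sqrt t • (ω : Cn n))
        ∂unitSphereMeasure n) * (φ : ℝ → ℂ) t :=
    ((hw.mul (testSpace_continuous φ).continuousOn).continuous_of_tsupport_subset
      (isOpen_radSet r R 0) ((tsupport_mul_subset_right).trans φ.2.2.2)).integrable_of_hasCompactSupport
      (testSpace_hasCompactSupport φ).mul_left
  rw [integral_sub hi (integrable_mul_testSpace (continuous_expPoly _ _ _) φ), ← hAB, sub_eq_zero]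
  change _ = ∫ u, weighted κ f u * (ev h u * (φ : ℝ → ℂ) (‖u‖ ^ 2))
  rw [integral_polar (hint φ), ← integral_const_mul, setIntegral_eq_integral_of_forall_compl_eq_zero]
  · refine integral_congr_ae (.of_forall fun t => ?_)
    simp only []
    by_cases ht : t ∈ radSet r R 0
    · have h1 : ∀ ω : sphere (0 : Cn n) 1, ‖Real.sqrt t • (ω : Cn n)‖ ^ 2 = t := fun ω => by
        rw [norm_smul, norm_eq_of_mem_sphere, mul_one, Real.norm_eq_abs, sq_abs,
          Real.sq_sqrt ht.1.le]
      simp only [h1, ← mul_assoc]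
      rw [integral_mul_const]
      ring
    · rw [testSpace_eq_zero φ ht, mul_zero]
      by_cases h0 : 0 ≤ t
      · have h1 : ∀ ω : sphere (0 : Cn n) 1, ‖Real.sqrt t • (ω : Cn n)‖ ^ 2 = t := fun ω => by
          rw [norm_smul, norm_eq_of_mem_sphere, mul_one, Real.norm_eq_abs, sq_abs,
            Real.sq_sqrt h0]
        simp [h1, testSpace_eq_zero φ ht]
      -- For negative t the root has the default value 0, whose square lies outside the support of
      -- φ.
      · have h1 : (0 : ℝ) ∉ radSet r R 0 := fun h => lt_irrefl _ h.1
        simp [Real.sqrt_eq_zero_of_nonpos (not_le.1 h0).le, testSpace_eq_zero φ h1]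
  · intro t ht
    have h1 : (0 : ℝ) ∉ radSet r R 0 := fun h => lt_irrefl _ h.1
    simp [Real.sqrt_eq_zero_of_nonpos (not_lt.1 ht), testSpace_eq_zero φ h1]

end

/-! ### Sufficiency for one component: holomorphic translation and vanishing Taylor terms. -/

section

variable {n : ℕ} {I : Set ℝ}

/-! ### Holomorphic dependence of integrals on a parameter -/

/-- Cauchy's estimate on discs of radius ε/2 turns a bound for k on a compact set into a bound for
its τ-derivative, so dominated differentiation applies. -/
theorem differentiableOn_setIntegral {U : Set ℂ} (hU : IsOpen U) {K : Set (Cn n)} (hK : IsCompact K)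
    {k : ℂ → Cn n → ℂ} (hc : ContinuousOn (fun x : ℂ × Cn n => k x.1 x.2) (U ×ˢ K))
    (hd : ∀ w ∈ K, DifferentiableOn ℂ (fun τ => k τ w) U) :
    DifferentiableOn ℂ (fun τ => ∫ w in K, k τ w) U := by
  intro τ hτ
  obtain ⟨ε, hε, hball⟩ := Metric.nhds_basis_closedBall.mem_iff.1 (hU.mem_nhds hτ)
  obtain ⟨M, hM⟩ := ((isCompact_closedBall τ ε).prod hK).exists_bound_of_continuousOn
    (hc.mono (Set.prod_mono hball subset_rfl))
  have hcw : ∀ s ∈ U, ContinuousOn (k s) K := fun s hs =>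
    hc.comp (f := fun w => (s, w)) (by fun_prop) fun w hw => ⟨hs, hw⟩
  have hmeas : ∀ s ∈ U, AEStronglyMeasurable (k s) (volume.restrict K) := fun s hs =>
    (hcw s hs).aestronglyMeasurable hK.measurableSet
  have hderiv : ∀ w ∈ K, ∀ s ∈ U, HasDerivAt (fun s => k s w) (deriv (fun s => k s w) s) s :=
    fun w hw s hs => ((hd w hw).differentiableAt (hU.mem_nhds hs)).hasDerivAt
  have hhalf : ∀ s ∈ ball τ (ε / 2), closedBall s (ε / 2) ⊆ closedBall τ ε := fun s hs =>
    closedBall_subset_closedBall' (by linarith [mem_ball.1 hs])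
  refine (hasDerivAt_integral_of_dominated_loc_of_deriv_le (s := ball τ (ε / 2))
    (F' := fun s w => deriv (fun s => k s w) s) (bound := fun _ => M / (ε / 2))
    (ball_mem_nhds τ (by positivity)) (Filter.eventually_of_mem (hU.mem_nhds hτ) hmeas)
    ((hcw τ hτ).integrableOn_compact hK) ?_ ?_ ?_ ?_).2.differentiableAt.differentiableWithinAt
  -- The τ-derivative is measurable in w as a limit of difference quotients with steps ε/(m+1).
  · set e : ℕ → ℂ := fun m => ((ε / (m + 1) : ℝ) : ℂ) with he
    have hem : ∀ m, τ + e m ∈ U := fun m => hball (by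
      rw [mem_closedBall, dist_self_add_left, he, Complex.norm_real, Real.norm_eq_abs,
        abs_of_pos (by positivity)]
      exact div_le_self hε.le (by linarith [Nat.cast_nonneg (α := ℝ) m]))
    have hlim : Filter.Tendsto e Filter.atTop (nhdsWithin 0 {0}ᶜ) := by
      refine tendsto_nhdsWithin_iff.2 ⟨?_, .of_forall fun m => ?_⟩
      · have h1 : Filter.Tendsto (fun m : ℕ => ε / ((m : ℝ) + 1)) Filter.atTop (nhds 0) := by
          simpa [div_eq_mul_inv] using tendsto_one_div_add_atTop_nhds_zero_nat.const_mul ε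
        have h2 := (Complex.continuous_ofReal.tendsto 0).comp h1
        rwa [Complex.ofReal_zero] at h2
      · simp only [he, Set.mem_compl_iff, Set.mem_singleton_iff]
        exact_mod_cast (by positivity : ε / ((m : ℝ) + 1) ≠ 0)
    refine aestronglyMeasurable_of_tendsto_ae Filter.atTop
      (f := fun m w => (e m)⁻¹ • (k (τ + e m) w - k τ w)) (fun m => ?_) ?_
    · exact ((hmeas _ (hem m)).sub (hmeas _ hτ)).const_smul ((e m)⁻¹ : ℂ)
    · refine (ae_restrict_mem hK.measurableSet).mono fun w hw => ?_
      exact (hderiv w hw τ hτ).tendsto_slope_zero.comp hlim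
  · refine (ae_restrict_mem hK.measurableSet).mono fun w hw s hs => ?_
    refine Complex.norm_deriv_le_of_forall_mem_sphere_norm_le (by positivity) ?_ fun x hx => ?_
    · exact ((hd w hw).mono ((hhalf s hs).trans hball)).diffContOnCl_ball subset_rfl
    · exact hM (x, w) ⟨hhalf s hs (sphere_subset_closedBall hx), hw⟩
  · exact integrableOn_const hK.measure_lt_top.ne
  · refine (ae_restrict_mem hK.measurableSet).mono fun w hw s hs => hderiv w hw s ?_
    exact hball (hhalf s hs (mem_closedBall_self (by positivity)))

/-- A nonzero analytic germ at 0 is τ^N times a unit, which contradicts decay of order N + 1 along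
the positive reals. -/
theorem eqOn_zero_of_forall_norm_le_pow {U : Set ℂ} (hU : IsOpen U) (hU' : IsPreconnected U)
    (h0 : (0 : ℂ) ∈ U) {F : ℂ → ℂ} (hF : DifferentiableOn ℂ F U)
    (h : ∀ N : ℕ, ∃ C δ : ℝ, 0 < δ ∧ ∀ ε : ℝ, 0 < ε → ε < δ → ‖F ε‖ ≤ C * ε ^ (N + 1)) :
    Set.EqOn F 0 U := by
  have ha := hF.analyticOnNhd hU
  refine ha.eqOn_zero_of_preconnected_of_eventuallyEq_zero hU' h0 ?_
  by_contra hne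
  obtain ⟨N, g, hg, hg0, hFg⟩ := (ha 0 h0).exists_eventuallyEq_pow_smul_nonzero_iff.2 hne
  obtain ⟨C, δ, hδ, hC⟩ := h N
  have hcoe : Filter.Tendsto (fun ε : ℝ => (ε : ℂ)) (nhdsWithin 0 (Set.Ioi 0)) (nhds 0) := by
    have h1 := Complex.continuous_ofReal.tendsto 0
    rw [Complex.ofReal_zero] at h1
    exact h1.mono_left nhdsWithin_le_nhds
  have h1 : Filter.Tendsto (fun ε : ℝ => ‖g ε‖) (nhdsWithin 0 (Set.Ioi 0)) (nhds ‖g 0‖) :=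
    (hg.continuousAt.tendsto.comp hcoe).norm
  have h2 : Filter.Tendsto (fun ε : ℝ => C * ε) (nhdsWithin 0 (Set.Ioi 0)) (nhds 0) := by
    have h3 : Filter.Tendsto (fun ε : ℝ => C * ε) (nhds 0) (nhds (C * 0)) :=
      (continuous_const.mul continuous_id).tendsto 0
    rw [mul_zero] at h3
    exact h3.mono_left nhdsWithin_le_nhds
  have h3 : ∀ᶠ ε : ℝ in nhdsWithin 0 (Set.Ioi 0), ‖g ε‖ ≤ C * ε := by
    filter_upwards [hcoe.eventually hFg, Ioo_mem_nhdsGT hδ] with ε h4 h5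
    have h6 := hC ε h5.1 h5.2
    rw [h4, sub_zero, norm_smul, norm_pow, Complex.norm_real, Real.norm_eq_abs, abs_of_pos h5.1,
      pow_succ, mul_left_comm] at h6
    exact le_of_mul_le_mul_left h6 (pow_pos h5.1 N)
  exact hg0 (norm_le_zero_iff.1 (le_of_tendsto_of_tendsto h1 h2 h3))

/-! ### Complexified translations -/

/-- The holomorphic extension in `τ` of `|w + τ z|²`. -/
def normSqC (z w : Cn n) (τ : ℂ) : ℂ :=
  ((‖w‖ ^ 2 : ℝ) : ℂ) + τ * (pairing w z + pairing z w) + τ ^ 2 * ((‖z‖ ^ 2 : ℝ) : ℂ)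

/-- The holomorphic extension in `τ` of `p (w + τ z)`. -/
def evC (p : PolyRing n) (z w : Cn n) (τ : ℂ) : ℂ :=
  MvPolynomial.eval (Sum.elim (fun i => w i + τ * z i) (fun i => conj (w i) + τ * conj (z i))) p

theorem normSqC_ofReal (z w : Cn n) (ε : ℝ) : normSqC z w ε = ((‖w + ε • z‖ ^ 2 : ℝ) : ℂ) := by
  have h := norm_sub_sq_eq w (-(ε • z))
  rw [sub_neg_eq_add, norm_neg, norm_smul, ← neg_smul, pairing_smul_right, Complex.re_ofReal_mul,
    mul_pow, Real.norm_eq_abs, sq_abs] at h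
  rw [h, normSqC, add_comm (pairing w z), pairing_add_pairing]
  push_cast
  ring

theorem evC_ofReal (p : PolyRing n) (z w : Cn n) (ε : ℝ) : evC p z w ε = ev p (w + ε • z) := by
  rw [evC, ev]
  congr 2
  ext (i | i) <;> simp

/-- For z ≠ 0 this is a real quadratic in τ whose discriminant is nonpositive by Cauchy–Schwarz, so
its roots are conjugate with |τ||z| = |w|. The proof separates real and non-real τ. -/
theorem normSqC_ne_zero {z w : Cn n} {τ : ℂ} (h : ‖τ‖ * ‖z‖ < ‖w‖) : normSqC z w τ ≠ 0 := by
  intro h0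
  rw [normSqC, add_comm (pairing w z), pairing_add_pairing] at h0
  have hre := congrArg Complex.re h0
  have him := congrArg Complex.im h0
  simp [pow_two, Complex.mul_re, Complex.mul_im] at hre him
  set b := (pairing w z).re with hb
  have hbl : |b| ≤ ‖w‖ * ‖z‖ := (Complex.abs_re_le_norm _).trans (norm_pairing_le _ _)
  have hsq : ‖τ‖ ^ 2 = τ.re ^ 2 + τ.im ^ 2 := by
    rw [← Complex.normSq_eq_norm_sq, Complex.normSq_apply]; ring
  have hlt : ‖τ‖ ^ 2 * ‖z‖ ^ 2 < ‖w‖ ^ 2 := by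
    rw [← mul_pow]
    exact pow_lt_pow_left₀ h (by positivity) two_ne_zero
  by_cases hy : τ.im = 0
  · rw [hy] at hre hsq
    have h1 : |τ.re| = ‖τ‖ := by
      rw [← sq_eq_sq₀ (abs_nonneg _) (norm_nonneg _), sq_abs, hsq]; ring
    have h2 : |τ.re * b| ≤ ‖τ‖ * (‖w‖ * ‖z‖) := by
      rw [abs_mul, h1]
      exact mul_le_mul_of_nonneg_left hbl (norm_nonneg _)
    have h3 := (abs_le.1 h2).1
    have h4 : 0 < (‖w‖ - ‖τ‖ * ‖z‖) ^ 2 := pow_pos (by linarith) 2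
    nlinarith
  · have h1 : b + τ.re * ‖z‖ ^ 2 = 0 := by
      have : τ.im * (2 * (b + τ.re * ‖z‖ ^ 2)) = 0 := by linarith
      have := (mul_eq_zero.1 this).resolve_left hy
      linarith
    have h2 : b = -(τ.re * ‖z‖ ^ 2) := by linarith
    rw [h2] at hre
    rw [hsq] at hlt
    nlinarith

theorem continuous_normSqC (z : Cn n) : Continuous fun x : ℂ × Cn n => normSqC z x.2 x.1 := by
  unfold normSqC
  have h1 : Continuous fun x : ℂ × Cn n => pairing x.2 z :=
    (continuous_pairing_left z).comp continuous_snd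
  have h2 : Continuous fun x : ℂ × Cn n => pairing z x.2 :=
    (continuous_pairing_right z).comp continuous_snd
  fun_prop

theorem continuous_evC (p : PolyRing n) (z : Cn n) :
    Continuous fun x : ℂ × Cn n => evC p z x.2 x.1 := by
  unfold evC
  simp only [MvPolynomial.eval_eq', Fintype.prod_sum_type, Sum.elim_inl, Sum.elim_inr]
  fun_prop

theorem differentiable_normSqC (z w : Cn n) : Differentiable ℂ (normSqC z w) := by
  unfold normSqC
  fun_prop

theorem differentiable_evC (p : PolyRing n) (z w : Cn n) : Differentiable ℂ (evC p z w) := by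
  unfold evC
  simp only [MvPolynomial.eval_eq', Fintype.prod_sum_type, Sum.elim_inl, Sum.elim_inr]
  fun_prop

/-! ### Vanishing of the weak means of a single component -/

/-- The function `|u|^{-2N} (A(|u|²) + exp(-κ|u|²) B(|u|²)) h(u)`. -/
def radComp (κ : ℝ) (N : ℕ) (A B : Polynomial ℂ) (h : PolyRing n) (u : Cn n) : ℂ :=
  (((‖u‖ ^ 2 : ℝ) : ℂ) ^ N)⁻¹ * (expPoly κ A B (‖u‖ ^ 2) * ev h u)

/-- The holomorphic extension in `τ` of `radComp (w + τ z) exp (κ τ (w + τ z) · z̄)`. -/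
def radCompC (κ : ℝ) (N : ℕ) (A B : Polynomial ℂ) (h : PolyRing n) (z w : Cn n) (τ : ℂ) : ℂ :=
  (normSqC z w τ ^ N)⁻¹ * ((A.eval (normSqC z w τ) +
    Complex.exp (-(κ * normSqC z w τ)) * B.eval (normSqC z w τ)) * evC h z w τ) *
    Complex.exp (κ * τ * (pairing w z + τ * ((‖z‖ ^ 2 : ℝ) : ℂ)))

theorem radCompC_ofReal (κ : ℝ) (N : ℕ) (A B : Polynomial ℂ) (h : PolyRing n) (z w : Cn n) (ε : ℝ) :
    radCompC κ N A B h z w ε =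
      radComp κ N A B h (w + ε • z) * Complex.exp (κ * ε * pairing (w + ε • z) z) := by
  have h1 : pairing (w + ε • z) z = pairing w z + ε * ((‖z‖ ^ 2 : ℝ) : ℂ) := by
    have h2 := pairing_sub_left w (-(ε • z)) z
    rw [sub_neg_eq_add, ← neg_smul, pairing_smul_left, pairing_self] at h2
    rw [h2]
    push_cast
    ring
  rw [radCompC, radComp, normSqC_ofReal, evC_ofReal, expPoly, h1]

theorem continuousOn_radComp (κ : ℝ) (N : ℕ) (A B : Polynomial ℂ) (h : PolyRing n) :
    ContinuousOn (radComp κ N A B h) {0}ᶜ := by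
  have h1 := continuous_expPoly κ A B
  refine ContinuousOn.mul (ContinuousOn.inv₀ (Continuous.continuousOn (by fun_prop)) fun u hu => ?_)
    (Continuous.continuousOn (by fun_prop))
  refine pow_ne_zero _ ?_
  exact_mod_cast (pow_pos (norm_pos_iff.2 hu) 2).ne'

theorem X_pow_mul_mem_degreeLT {p : ℕ} {A : Polynomial ℂ} (hA : A ∈ Polynomial.degreeLT ℂ p)
    (e : ℕ) : Polynomial.X ^ e * A ∈ Polynomial.degreeLT ℂ (p + e) := by
  rw [Polynomial.mem_degreeLT] at *
  rcases eq_or_ne A 0 with rfl | h0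
  · simp
  · rw [Polynomial.degree_mul, Polynomial.degree_X_pow, Polynomial.degree_eq_natDegree h0] at *
    norm_cast at hA ⊢
    omega

/-- The spherical integral vanishes unless l = p + e and m = q + e. All powers of the radius then
combine to t^e, so the weight has degrees below p + e and q + e and annihilates that mixed
derivative. -/
theorem integral_radComp_mul_mixedDeriv [NeZero n] {κ a c : ℝ} (hI : I ⊆ Set.Ioi a)
    (hca : c ≤ a) {p q : ℕ} {h : PolyRing n} (hb : IsBihom h p q) (hh : IsHarm h)
    {A B : Polynomial ℂ} (hA : A ∈ Polynomial.degreeLT ℂ p) (hB : B ∈ Polynomial.degreeLT ℂ q)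
    (z : Cn n) (l m : ℕ) (φ : testSpace I)
    (hi : Integrable fun u : Cn n => radComp κ (n - 1 + p + q) A B h u *
      ((pairing z u ^ l * pairing u z ^ m) * (mixedDeriv I κ l m φ : ℝ → ℂ) (‖u‖ ^ 2 + c))) :
    ∫ u : Cn n, radComp κ (n - 1 + p + q) A B h u *
      ((pairing z u ^ l * pairing u z ^ m) * (mixedDeriv I κ l m φ : ℝ → ℂ) (‖u‖ ^ 2 + c)) = 0 := by
  have hsph : ∀ t : ℝ, 0 < t → ∀ ω : sphere (0 : Cn n) 1, ‖Real.sqrt t • (ω : Cn n)‖ ^ 2 = t :=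
    fun t ht ω => by
      rw [norm_smul, norm_eq_of_mem_sphere, mul_one, Real.norm_eq_abs, sq_abs, Real.sq_sqrt ht.le]
  have hinner : ∀ t : ℝ, 0 < t → ∫ ω, radComp κ (n - 1 + p + q) A B h (Real.sqrt t • (ω : Cn n)) *
      ((pairing z (Real.sqrt t • (ω : Cn n)) ^ l * pairing (Real.sqrt t • (ω : Cn n)) z ^ m) *
        (mixedDeriv I κ l m φ : ℝ → ℂ) (‖Real.sqrt t • (ω : Cn n)‖ ^ 2 + c)) ∂unitSphereMeasure n =
      (((t : ℂ) ^ (n - 1 + p + q))⁻¹ * (Real.sqrt t : ℂ) ^ (p + q + l + m)) *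
        (expPoly κ A B t * (mixedDeriv I κ l m φ : ℝ → ℂ) (t + c)) *
        ∫ ω, ev h (ω : Cn n) * (pairing (ω : Cn n) z ^ m * pairing z (ω : Cn n) ^ l)
          ∂unitSphereMeasure n := by
    intro t ht
    rw [← integral_const_mul]
    refine integral_congr_ae (.of_forall fun ω => ?_)
    simp only [radComp, hsph t ht, hb.ev_smul, pairing_smul_left, pairing_smul_right, mul_pow]
    ring
  rw [integral_polar hi]
  suffices h1 : ∫ t in Set.Ioi (0 : ℝ), (t : ℂ) ^ (n - 1) *
      ∫ ω, radComp κ (n - 1 + p + q) A B h (Real.sqrt t • (ω : Cn n)) *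
      ((pairing z (Real.sqrt t • (ω : Cn n)) ^ l * pairing (Real.sqrt t • (ω : Cn n)) z ^ m) *
        (mixedDeriv I κ l m φ : ℝ → ℂ) (‖Real.sqrt t • (ω : Cn n)‖ ^ 2 + c))
        ∂unitSphereMeasure n = 0 by rw [h1, mul_zero]
  by_cases hcase : p + m ≠ q + l ∨ m < q ∨ l < p
  · refine setIntegral_eq_zero_of_forall_eq_zero fun t ht => ?_
    rw [hinner t ht, integral_sphere_harm_mul_eq_zero hb hh z hcase, mul_zero, mul_zero]
  · push Not at hcase
    obtain ⟨h1, h2, h3⟩ := hcase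
    obtain ⟨e, rfl⟩ := Nat.exists_eq_add_of_le h3
    obtain rfl : m = q + e := by omega
    have h4 := integral_expPoly_mul_mixedDeriv_shift κ (X_pow_mul_mem_degreeLT hA e)
      (X_pow_mul_mem_degreeLT hB e) φ c
    -- Since c ≤ a, the shifted test function lives on t > 0, so the half-line integral equals the
    -- full one.
    rw [← setIntegral_eq_integral_of_forall_compl_eq_zero (s := Set.Ioi 0) (fun t ht => by
      rw [testSpace_eq_zero _ (fun hmem => ?_), mul_zero]
      have h5 : a < t + c := hI hmem
      have h6 : t ≤ 0 := not_lt.1 ht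
      linarith)] at h4
    set s := ∫ ω, ev h (ω : Cn n) * (pairing (ω : Cn n) z ^ (q + e) * pairing z (ω : Cn n) ^ (p + e))
      ∂unitSphereMeasure n with hs
    rw [← zero_mul s, ← h4, ← integral_mul_const]
    refine setIntegral_congr_fun measurableSet_Ioi fun t ht => ?_
    have ht0 : (t : ℂ) ≠ 0 := by exact_mod_cast (show (0 : ℝ) < t from ht).ne'
    have hsq : (Real.sqrt t : ℂ) ^ 2 = t := by
      exact_mod_cast Real.sq_sqrt (show (0 : ℝ) < t from ht).le
    rw [hinner t ht, show p + q + (p + e) + (q + e) = 2 * (p + q + e) by ring, pow_mul, hsq]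
    simp only [expPoly, Polynomial.eval_mul, Polynomial.eval_pow, Polynomial.eval_X, pow_add]
    field_simp

end

/-! ### Weak means of one component and analytic continuation to the full translation. -/

section

variable {n : ℕ} {I : Set ℝ}

theorem norm_sphere_smul_sq {t : ℝ} (ht : 0 ≤ t) (ω : sphere (0 : Cn n) 1) :
    ‖Real.sqrt t • (ω : Cn n)‖ ^ 2 = t := by
  rw [norm_smul, norm_eq_of_mem_sphere, mul_one, Real.norm_eq_abs, sq_abs, Real.sq_sqrt ht]

theorem setIntegral_radComp_mul_taylorTerm [NeZero n] {κ a c : ℝ} (hI : I ⊆ Set.Ioi a)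
    (hca : c ≤ a) {p q : ℕ} {h : PolyRing n} (hb : IsBihom h p q) (hh : IsHarm h)
    {A B : Polynomial ℂ} (hA : A ∈ Polynomial.degreeLT ℂ p) (hB : B ∈ Polynomial.degreeLT ℂ q)
    (z : Cn n) (m : ℕ) (φ : testSpace I) {K : Set (Cn n)} (hK : IsCompact K) (hK0 : K ⊆ {0}ᶜ)
    (h0 : ∀ u, u ∉ K → ‖u‖ ^ 2 + c ∉ tsupport (φ : ℝ → ℂ)) :
    ∫ u in K, radComp κ (n - 1 + p + q) A B h u *
      taylorTerm κ φ m (pairing z u) (pairing u z) (‖u‖ ^ 2 + c) = 0 := by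
  rw [setIntegral_eq_integral_of_forall_compl_eq_zero (fun u hu => by
    rw [taylorTerm_eq_zero_of_notMem κ φ m _ _ (h0 u hu), mul_zero])]
  have hint : ∀ l : ℕ, Integrable fun u : Cn n => radComp κ (n - 1 + p + q) A B h u *
      ((pairing z u ^ l * pairing u z ^ (m - l)) *
        (mixedDeriv I κ l (m - l) φ : ℝ → ℂ) (‖u‖ ^ 2 + c)) := fun l => by
    have hψ := testSpace_continuous (mixedDeriv I κ l (m - l) φ)
    have := continuous_mul_of_eq_zero isOpen_compl_singleton hK hK0
      (continuousOn_radComp κ (n - 1 + p + q) A B h) (k := fun u =>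
      ((pairing z u ^ l * pairing u z ^ (m - l)) *
        (mixedDeriv I κ l (m - l) φ : ℝ → ℂ) (‖u‖ ^ 2 + c))) (by fun_prop)
        (fun u hu => by rw [mixedDeriv_eq_zero_of_notMem κ φ _ _ (h0 u hu), mul_zero])
    exact this.1.integrable_of_hasCompactSupport this.2
  have heq : ∀ u : Cn n, radComp κ (n - 1 + p + q) A B h u *
      taylorTerm κ φ m (pairing z u) (pairing u z) (‖u‖ ^ 2 + c) =
      ∑ l ∈ Finset.range (m + 1), ((m.choose l : ℂ) * (-1) ^ l) *
        (radComp κ (n - 1 + p + q) A B h u * ((pairing z u ^ l * pairing u z ^ (m - l)) *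
        (mixedDeriv I κ l (m - l) φ : ℝ → ℂ) (‖u‖ ^ 2 + c))) := fun u => by
    rw [taylorTerm, Finset.mul_sum]
    refine Finset.sum_congr rfl fun l _ => ?_
    rw [neg_pow (pairing z u)]
    ring
  simp only [heq]
  rw [integral_finsetSum _ fun l _ => (hint l).const_mul _]
  refine Finset.sum_eq_zero fun l _ => ?_
  rw [integral_const_mul, integral_radComp_mul_mixedDeriv hI hca hb hh hA hB z l (m - l) φ
    (hint l), mul_zero]

/-- The Taylor argument works only for centres εz near 0. The spheres have squared radius at least b
> |z|², so the singularity of the component at 0 stays avoided for all complex τ with |τ||z| < √b.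
This connected set contains both 0 and 1. -/
theorem integral_radComp_weak_eq_zero [NeZero n] {κ : ℝ} (hIo : IsOpen I) (z : Cn n)
    (hI : I ⊆ Set.Ioi (‖z‖ ^ 2)) {p q : ℕ} {h : PolyRing n} (hb : IsBihom h p q) (hh : IsHarm h)
    {A B : Polynomial ℂ} (hA : A ∈ Polynomial.degreeLT ℂ p) (hB : B ∈ Polynomial.degreeLT ℂ q)
    (φ : testSpace I) :
    ∫ u, radComp κ (n - 1 + p + q) A B h u *
      ((φ : ℝ → ℂ) (‖u - z‖ ^ 2) * Complex.exp (κ * pairing u z)) = 0 := by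
  have hφ := testSpace_continuous φ
  have hφK := (testSpace_hasCompactSupport φ).isCompact
  obtain ⟨b, hzb, hbt⟩ : ∃ b, ‖z‖ ^ 2 < b ∧ ∀ t ∈ tsupport (φ : ℝ → ℂ), b ≤ t := by
    rcases (tsupport (φ : ℝ → ℂ)).eq_empty_or_nonempty with h0 | h0
    · exact ⟨‖z‖ ^ 2 + 1, by linarith, by simp [h0]⟩
    · obtain ⟨b, hb1, hb2⟩ := hφK.exists_isLeast h0
      exact ⟨b, hI (φ.2.2.2 hb1), fun t ht => hb2 ht⟩
  have hb0 : 0 < b := lt_of_le_of_lt (by positivity) hzb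
  set N := n - 1 + p + q with hN
  -- Written as a sublevel set of a convex function, so that connectedness follows from convexity,
  -- also when z = 0.
  set U : Set ℂ := {τ | τ ∈ Set.univ ∧ (‖z‖ • (norm : ℂ → ℝ)) τ < Real.sqrt b} with hUdef
  have hUmem : ∀ τ, τ ∈ U ↔ ‖τ‖ * ‖z‖ < Real.sqrt b := fun τ => by
    simp [hUdef, mul_comm]
  have hU : IsOpen U := by
    rw [show U = {τ : ℂ | ‖τ‖ * ‖z‖ < Real.sqrt b} from Set.ext hUmem]
    exact isOpen_lt (by fun_prop) continuous_const
  have hUc : IsPreconnected U :=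
    (((convexOn_univ_norm (E := ℂ)).smul (norm_nonneg z)).convex_lt _).isPreconnected
  set K0 : Set (Cn n) := {w | ‖w - 0‖ ^ 2 ∈ tsupport (φ : ℝ → ℂ)} with hK0def
  have hK0 : IsCompact K0 := isCompact_norm_sub_sq hφK 0
  have hK0' : ∀ w, w ∉ K0 → (φ : ℝ → ℂ) (‖w‖ ^ 2) = 0 := fun w hw =>
    image_eq_zero_of_notMem_tsupport fun h => hw
      (by change ‖w - 0‖ ^ 2 ∈ tsupport (φ : ℝ → ℂ); rwa [sub_zero])
  have hTne : ∀ τ ∈ U, ∀ w ∈ K0, normSqC z w τ ≠ 0 := fun τ hτ w hw => by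
    refine normSqC_ne_zero (((hUmem τ).1 hτ).trans_le ?_)
    refine Real.sqrt_le_iff.2 ⟨norm_nonneg w, hbt _ ?_⟩
    have : ‖w - 0‖ ^ 2 ∈ tsupport (φ : ℝ → ℂ) := hw
    rwa [sub_zero] at this
  set k : ℂ → Cn n → ℂ := fun τ w => (φ : ℝ → ℂ) (‖w‖ ^ 2) * radCompC κ N A B h z w τ with hk
  have hkc : ContinuousOn (fun x : ℂ × Cn n => k x.1 x.2) (U ×ˢ K0) := by
    have h1 := continuous_normSqC z
    have h2 := continuous_evC h z
    have h3 : Continuous fun x : ℂ × Cn n => pairing x.2 z :=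
      (continuous_pairing_left z).comp continuous_snd
    have hA' : Continuous fun x : ℂ × Cn n => A.eval (normSqC z x.2 x.1) := A.continuous.comp h1
    have hB' : Continuous fun x : ℂ × Cn n => B.eval (normSqC z x.2 x.1) := B.continuous.comp h1
    refine ContinuousOn.mul (Continuous.continuousOn (by fun_prop)) ?_
    refine ContinuousOn.mul (ContinuousOn.mul (ContinuousOn.inv₀ (h1.pow N).continuousOn
      fun x hx => pow_ne_zero _ (hTne _ hx.1 _ hx.2)) ?_) ?_ <;>
    exact Continuous.continuousOn (by fun_prop)
  have hkd : ∀ w ∈ K0, DifferentiableOn ℂ (fun τ => k τ w) U := by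
    intro w hw
    have h1 := differentiable_normSqC z w
    have h2 := differentiable_evC h z w
    have hA' : Differentiable ℂ fun τ => A.eval (normSqC z w τ) := A.differentiable.comp h1
    have hB' : Differentiable ℂ fun τ => B.eval (normSqC z w τ) := B.differentiable.comp h1
    refine DifferentiableOn.mul (differentiableOn_const _) ?_
    refine DifferentiableOn.mul (DifferentiableOn.mul (DifferentiableOn.inv (h1.pow N).differentiableOn
      fun τ hτ => pow_ne_zero _ (hTne _ hτ _ hw)) ?_) ?_ <;>
    exact Differentiable.differentiableOn (by fun_prop)
  have hFd := differentiableOn_setIntegral hU hK0 hkc hkd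
  -- The translation u = w + εz freezes the argument of the merely smooth φ; only functions with
  -- holomorphic extensions still depend on ε.
  have hFreal : ∀ ε : ℝ, ∫ w in K0, k ε w = ∫ u, radComp κ N A B h u *
      ((φ : ℝ → ℂ) (‖u - ε • z‖ ^ 2) * Complex.exp (κ * ε * pairing u z)) := by
    intro ε
    rw [setIntegral_eq_integral_of_forall_compl_eq_zero (fun w hw => by
      simp only [hk]; rw [hK0' w hw, zero_mul]), ← integral_add_right_eq_self (fun u =>
        radComp κ N A B h u * ((φ : ℝ → ℂ) (‖u - ε • z‖ ^ 2) *
          Complex.exp (κ * ε * pairing u z))) (ε • z)]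
    refine integral_congr_ae (.of_forall fun w => ?_)
    simp only [hk, add_sub_cancel_right]
    rw [radCompC_ofReal]
    ring
  have hzero := eqOn_zero_of_forall_norm_le_pow hU hUc
    ((hUmem 0).2 (by simpa using hb0)) hFd (fun M => ?_)
    ((hUmem 1).2 (by simpa using Real.lt_sqrt_of_sq_lt hzb))
  · have h1 := hFreal 1
    simp only [Complex.ofReal_one, one_smul, mul_one] at h1
    rw [← h1]
    exact hzero
  obtain ⟨δ, hδ, hsub⟩ := hφK.exists_cthickening_subset_open hIo φ.2.2.2
  set K : Set (Cn n) := {u | ‖u - 0‖ ^ 2 ∈ cthickening δ (tsupport (φ : ℝ → ℂ))} with hKdef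
  have hK : IsCompact K := isCompact_norm_sub_sq hφK.cthickening 0
  have hKmem : ∀ u, ‖u‖ ^ 2 ∈ cthickening δ (tsupport (φ : ℝ → ℂ)) → u ∈ K := fun u hu => by
    change ‖u - 0‖ ^ 2 ∈ cthickening δ (tsupport (φ : ℝ → ℂ)); rwa [sub_zero]
  have hKne : K ⊆ {0}ᶜ := fun u hu h0 => by
    have h1 : ‖z‖ ^ 2 < ‖u - 0‖ ^ 2 := hI (hsub hu)
    rw [Set.mem_singleton_iff.1 h0] at h1
    simp at h1
    nlinarith [sq_nonneg ‖z‖]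
  obtain ⟨S, hS⟩ := hφK.bddAbove
  -- L bounds |u| when φ(|u - εz|²) is nonzero, and εD bounds the resulting displacement of |u|².
  set L := 1 + |S| + ‖z‖ with hL
  set D := ‖z‖ ^ 2 + 2 * L * ‖z‖ + 1 with hD
  have hL0 : 0 < L := by positivity
  have hD0 : 0 < D := by positivity
  obtain ⟨C, hC0, hC⟩ := exists_integral_taylor_bound hK
    (((continuousOn_radComp κ N A B h).mono hKne).integrableOn_compact hK) κ φ z M
  refine ⟨C, min 1 (δ / D), by positivity, fun ε h0 h1 => ?_⟩
  have hε1 : ε < 1 := h1.trans_le (min_le_left _ _)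
  have hεD : ε * D < δ := (lt_div_iff₀ hD0).1 (h1.trans_le (min_le_right _ _))
  have hexp : ∀ u : Cn n, ‖u - ε • z‖ ^ 2 =
      ‖u‖ ^ 2 + ε ^ 2 * ‖z‖ ^ 2 - ε * (2 * (pairing u z).re) := by
    intro u
    rw [norm_sub_sq_eq, norm_smul, pairing_smul_right, Complex.re_ofReal_mul,
      Real.norm_eq_abs, mul_pow, sq_abs]
    ring
  have hεε : ε ^ 2 * ‖z‖ ^ 2 ≤ ε * ‖z‖ ^ 2 :=
    mul_le_mul_of_nonneg_right (by nlinarith) (by positivity)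
  have hoff1 : ∀ u, u ∉ K → (φ : ℝ → ℂ) (‖u - ε • z‖ ^ 2) = 0 := by
    intro u hu
    by_contra hne
    have h2 : ‖u - ε • z‖ ^ 2 ∈ tsupport (φ : ℝ → ℂ) := subset_tsupport _ hne
    refine hu (hKmem u (mem_cthickening_of_dist_le _ _ _ _ h2 ?_))
    have h3 := hS h2
    have h4 : ‖u - ε • z‖ ≤ 1 + |S| := by
      by_contra hlt
      nlinarith [le_abs_self S, abs_nonneg S]
    have h5 : ‖u‖ ≤ L := by
      have h6 := norm_add_le (u - ε • z) (ε • z)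
      rw [sub_add_cancel, norm_smul, Real.norm_eq_abs, abs_of_pos h0] at h6
      nlinarith [norm_nonneg z]
    have h7 : |(pairing u z).re| ≤ L * ‖z‖ := (Complex.abs_re_le_norm _).trans
      ((norm_pairing_le _ _).trans (mul_le_mul_of_nonneg_right h5 (norm_nonneg _)))
    rw [hexp, Real.dist_eq, abs_le]
    have h8 := abs_le.1 h7
    have h9 := mul_le_mul_of_nonneg_left h8.1 h0.le
    have h10 := mul_le_mul_of_nonneg_left h8.2 h0.le
    have h11 : 0 ≤ ε ^ 2 * ‖z‖ ^ 2 := by positivity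
    have h12 : 0 ≤ ε * ‖z‖ ^ 2 := by positivity
    constructor <;> nlinarith
  have hoff2 : ∀ u, u ∉ K → ‖u‖ ^ 2 + ε ^ 2 * ‖z‖ ^ 2 ∉ tsupport (φ : ℝ → ℂ) := by
    intro u hu h2
    refine hu (hKmem u (mem_cthickening_of_dist_le _ _ _ _ h2 ?_))
    rw [Real.dist_eq, sub_add_cancel_left, abs_neg, abs_of_nonneg (by positivity)]
    have h3 : 0 ≤ ε * (2 * L * ‖z‖) := by positivity
    nlinarith
  have hmain := hC ε (ε ^ 2 * ‖z‖ ^ 2) h0.le hε1.le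
  rw [Finset.sum_eq_zero (fun m _ => by
    rw [setIntegral_radComp_mul_taylorTerm hI (by nlinarith [sq_nonneg ‖z‖])
      hb hh hA hB z m φ hK hKne hoff2, mul_zero]), sub_zero] at hmain
  rw [hFreal]
  simp only [← hexp] at hmain
  rwa [setIntegral_eq_integral_of_forall_compl_eq_zero (fun u hu => by
    rw [hoff1 u hu, zero_mul, mul_zero])] at hmain

end

/-! ### Sufficiency for f: summing the components by Parseval. -/

section

variable {n : ℕ}

/-! ### Sufficiency -/

theorem hasSum_norm_sq_sphere [NeZero n] {P : HarmonicBases n} (hP : IsOrthonormalOnSphere P)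
    {f : sphere (0 : Cn n) 1 → ℂ} (hf : Continuous f) :
    HasSum (fun i : HarmIndex n =>
      ‖∫ ω, f ω * conj ((P i.1.1 i.1.2 i.2 : Cn n → ℂ) ω) ∂unitSphereMeasure n‖ ^ 2)
      (∫ ω, f ω * conj (f ω) ∂unitSphereMeasure n).re := by
  have h1 := Complex.hasSum_re (hasSum_sphere hP hf (Complex.continuous_conj.comp hf))
  change HasSum _ (∫ ω, f ω * conj (f ω) ∂unitSphereMeasure n).re at h1
  convert h1 using 2 with i
  have h2 : ∫ ω, (P i.1.1 i.1.2 i.2 : Cn n → ℂ) ω * (conj ∘ f) ω ∂unitSphereMeasure n =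
      conj (∫ ω, f ω * conj ((P i.1.1 i.1.2 i.2 : Cn n → ℂ) ω) ∂unitSphereMeasure n) := by
    rw [← integral_conj]
    refine integral_congr_ae (.of_forall fun ω => ?_)
    simp [mul_comm]
  rw [h2, Complex.mul_conj, Complex.ofReal_re, Complex.normSq_eq_norm_sq]

theorem hasSum_norm_sq_sphere' [NeZero n] {P : HarmonicBases n} (hP : IsOrthonormalOnSphere P)
    {f : sphere (0 : Cn n) 1 → ℂ} (hf : Continuous f) :
    HasSum (fun i : HarmIndex n =>
      ‖∫ ω, (P i.1.1 i.1.2 i.2 : Cn n → ℂ) ω * f ω ∂unitSphereMeasure n‖ ^ 2)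
      (∫ ω, f ω * conj (f ω) ∂unitSphereMeasure n).re := by
  have h1 := hasSum_norm_sq_sphere hP (Complex.continuous_conj.comp hf)
  convert h1 using 2 with i
  · have h2 : ∫ ω, (conj ∘ f) ω * conj ((P i.1.1 i.1.2 i.2 : Cn n → ℂ) ω) ∂unitSphereMeasure n =
        conj (∫ ω, (P i.1.1 i.1.2 i.2 : Cn n → ℂ) ω * f ω ∂unitSphereMeasure n) := by
      rw [← integral_conj]
      refine integral_congr_ae (.of_forall fun ω => ?_)
      simp [mul_comm]
    rw [h2, RCLike.norm_conj]
  · refine integral_congr_ae (.of_forall fun ω => ?_)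
    simp [mul_comm]

variable {κ r : ℝ} {R : EReal} {f : Cn n → ℂ}

/-- The radial profile of the weighted component of `f` along the basis vector `P_j^{p,q}` is an
exponential polynomial. -/
def HasExpPolyProfile (κ r : ℝ) (R : EReal) (P : HarmonicBases n) (f : Cn n → ℂ) (p q : ℕ)
    (j : Fin (dimH n p q)) : Prop :=
  ∃ A ∈ Polynomial.degreeLT ℂ p, ∃ B ∈ Polynomial.degreeLT ℂ q, ∀ t ∈ radSet r R 0,
    (t : ℂ) ^ (n - 1) * ((Real.sqrt t : ℂ) ^ (p + q) * ∫ ω, weighted κ f (Real.sqrt t • (ω : Cn n)) *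
      conj ((P p q j : Cn n → ℂ) ω) ∂unitSphereMeasure n) = expPoly κ A B t

/-- The pairing is with the conjugate of P_j^{p,q}, of bidegree (q, p); this is why A gets degree
below p and B below q. -/
theorem hasExpPolyProfile_of_meansVanish [NeZero n] (hr : 0 ≤ r) (hrR : (r : EReal) < R)
    (hf : ContinuousOn f (Ann n r R)) (hκ : κ ≠ 0) (hv : MeansVanish κ r R f) (P : HarmonicBases n)
    (p q : ℕ) (j : Fin (dimH n p q)) : HasExpPolyProfile κ r R P f p q j := by
  obtain ⟨A, hA, B, hB, h⟩ := exists_expPoly_of_meansVanish hr hrR hf hκ hv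
    (isBihom_basisPoly P p q j).cj (isHarm_basisPoly P p q j).cj
  refine ⟨A, hA, B, hB, fun t ht => ?_⟩
  rw [← h t ht, ← integral_const_mul]
  congr 1
  refine integral_congr_ae (.of_forall fun ω => ?_)
  simp only [ev_cj, (isBihom_basisPoly P p q j).ev_smul, ← ev_basisPoly P p q j, map_mul, map_pow,
    Complex.conj_ofReal]
  ring

theorem isCompact_image_norm_sq {K : Set (Cn n)} (hK : IsCompact K) :
    IsCompact ((fun u => ‖u‖ ^ 2) '' K) := hK.image (by fun_prop)

theorem integral_polar_of_eq_zero [NeZero n] {K : Set (Cn n)}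
    (hK0 : (0 : Cn n) ∉ K) {F : Cn n → ℂ} (hF : Integrable F) (h0 : ∀ u, u ∉ K → F u = 0) :
    ∫ z, F z = (surf n / 2 : ℝ) * ∫ t in (fun u : Cn n => ‖u‖ ^ 2) '' K, (t : ℂ) ^ (n - 1) *
      ∫ ω, F (Real.sqrt t • (ω : Cn n)) ∂unitSphereMeasure n := by
  rw [integral_polar hF, setIntegral_eq_of_subset_of_forall_sdiff_eq_zero measurableSet_Ioi]
  · rintro _ ⟨u, hu, rfl⟩
    exact pow_pos (norm_pos_iff.2 fun h => hK0 (h ▸ hu)) 2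
  · rintro t ⟨ht, htK⟩
    have h1 : ∀ ω : sphere (0 : Cn n) 1, F (Real.sqrt t • (ω : Cn n)) = 0 := fun ω =>
      h0 _ fun h => htK ⟨_, h, norm_sphere_smul_sq (show (0 : ℝ) < t from ht).le ω⟩
    simp [h1]

/-- On each sphere about 0, Parseval writes the pairing of the weighted f with the kernel as a sum
over harmonics. Integrated over the compact set of squared radii, each term is the weak mean of a
single component and vanishes. -/
theorem meansVanish_of_hasExpPolyProfile [NeZero n] (hr : 0 ≤ r)
    (hf : ContinuousOn f (Ann n r R)) {P : HarmonicBases n} (hP : IsOrthonormalOnSphere P)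
    (hrad : ∀ p q j, HasExpPolyProfile κ r R P f p q j) : MeansVanish κ r R f := by
  refine meansVanish_of_integral_weak hr hf fun z φ => ?_
  have hφ := testSpace_continuous φ
  set K : Set (Cn n) := {u | ‖u - z‖ ^ 2 ∈ tsupport (φ : ℝ → ℂ)} with hKdef
  have hK : IsCompact K := isCompact_norm_sub_sq (testSpace_hasCompactSupport φ) z
  have hKA : K ⊆ Ann n r R := fun u hu => mem_Ann_of_norm_sub_sq_mem (φ.2.2.2 hu)
  have hpos : ∀ u ∈ K, 0 < ‖u‖ := fun u hu => hr.trans_lt (hKA hu).1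
  have hK0 : (0 : Cn n) ∉ K := fun h => by simpa using hpos 0 h
  set k : Cn n → ℂ := fun u => (φ : ℝ → ℂ) (‖u - z‖ ^ 2) * Complex.exp (κ * pairing u z) with hk
  have hkc : Continuous k := by fun_prop
  have hk0 : ∀ u, u ∉ K → k u = 0 := fun u hu => by
    simp only [hk]
    rw [image_eq_zero_of_notMem_tsupport (f := (φ : ℝ → ℂ)) hu, zero_mul]
  set S : Set ℝ := (fun u : Cn n => ‖u‖ ^ 2) '' K with hS
  have hSc : IsCompact S := isCompact_image_norm_sq hK
  have hSr : S ⊆ radSet r R 0 := by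
    rintro _ ⟨u, hu, rfl⟩
    exact sq_mem_radSet_zero hr (hKA hu).1 (hKA hu).2
  have hcs := continuous_mul_of_eq_zero (isOpen_Ann r R) hK hKA (continuousOn_weighted (κ := κ) hf)
    hkc hk0
  change ∫ u, weighted κ f u * k u = 0
  rw [integral_polar_of_eq_zero hK0 (hcs.1.integrable_of_hasCompactSupport hcs.2)
    fun u hu => by rw [hk0 u hu, mul_zero]]
  rw [← hS]
  have hwj : ContinuousOn (fun x : ℝ × sphere (0 : Cn n) 1 =>
      weighted κ f (Real.sqrt x.1 • (x.2 : Cn n))) (radSet r R 0 ×ˢ Set.univ) := by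
    refine (continuousOn_weighted hf).comp (by fun_prop) fun x hx => ?_
    refine mem_Ann_of_norm_sub_sq_mem (z := 0) ?_
    rw [sub_zero, norm_zero, norm_sphere_smul_sq hx.1.1.le]
    exact hx.1
  have hwt : ∀ t ∈ radSet r R 0, Continuous fun ω : sphere (0 : Cn n) 1 =>
      weighted κ f (Real.sqrt t • (ω : Cn n)) := fun t ht =>
    hwj.comp_continuous (f := fun ω => (t, ω)) (by fun_prop) fun ω => ⟨ht, trivial⟩
  have hkt : ∀ t : ℝ, Continuous fun ω : sphere (0 : Cn n) 1 => k (Real.sqrt t • (ω : Cn n)) :=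
    fun t => by fun_prop
  have hPc : ∀ i : HarmIndex n, Continuous (P i.1.1 i.1.2 i.2 : Cn n → ℂ) := fun i => by
    rw [← ev_basisPoly]
    fun_prop
  set α : HarmIndex n → ℝ → ℂ := fun i t => ∫ ω, weighted κ f (Real.sqrt t • (ω : Cn n)) *
    conj ((P i.1.1 i.1.2 i.2 : Cn n → ℂ) ω) ∂unitSphereMeasure n with hα
  set β : HarmIndex n → ℝ → ℂ := fun i t => ∫ ω, (P i.1.1 i.1.2 i.2 : Cn n → ℂ) ω *
    k (Real.sqrt t • (ω : Cn n)) ∂unitSphereMeasure n with hβ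
  set a : ℝ → ℂ := fun t => ∫ ω, weighted κ f (Real.sqrt t • (ω : Cn n)) *
    conj (weighted κ f (Real.sqrt t • (ω : Cn n))) ∂unitSphereMeasure n with ha
  set b : ℝ → ℂ := fun t => ∫ ω, k (Real.sqrt t • (ω : Cn n)) *
    conj (k (Real.sqrt t • (ω : Cn n))) ∂unitSphereMeasure n with hb
  have hαc : ∀ i, ContinuousOn (α i) (radSet r R 0) := fun i =>
    continuousOn_integral_sphere (isOpen_radSet _ _ _) (hwj.mul (Continuous.continuousOn (by
      have := hPc i
      fun_prop)))
  have hβc : ∀ i, ContinuousOn (β i) (radSet r R 0) := fun i =>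
    continuousOn_integral_sphere (isOpen_radSet _ _ _) (Continuous.continuousOn (by
      have := hPc i
      fun_prop))
  have hac : ContinuousOn a (radSet r R 0) :=
    continuousOn_integral_sphere (isOpen_radSet _ _ _)
      (hwj.mul (Complex.continuous_conj.comp_continuousOn hwj))
  have hbc : ContinuousOn b (radSet r R 0) :=
    continuousOn_integral_sphere (isOpen_radSet _ _ _) (Continuous.continuousOn (by fun_prop))
  have hsum : HasSum (fun i : HarmIndex n => ∫ t in S, (t : ℂ) ^ (n - 1) * (α i t * β i t))
      (∫ t in S, (t : ℂ) ^ (n - 1) * ∫ ω, weighted κ f (Real.sqrt t • (ω : Cn n)) *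
        k (Real.sqrt t • (ω : Cn n)) ∂unitSphereMeasure n) := by
    -- From |αβ| ≤ (|α|² + |β|²)/2: Parseval sums the right side to a continuous function of t,
    -- hence an integrable bound on the compact set.
    have hbd : ∀ t ∈ S, HasSum (fun i : HarmIndex n => t ^ (n - 1) * ((‖α i t‖ ^ 2 + ‖β i t‖ ^ 2) / 2))
        (t ^ (n - 1) * (((a t).re + (b t).re) / 2)) := fun t ht =>
      (((hasSum_norm_sq_sphere hP (hwt t (hSr ht))).add
        (hasSum_norm_sq_sphere' hP (hkt t))).div_const 2).mul_left _
    refine hasSum_integral_of_dominated_convergence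
      (fun i t => t ^ (n - 1) * ((‖α i t‖ ^ 2 + ‖β i t‖ ^ 2) / 2)) (fun i => ?_) (fun i => ?_) ?_ ?_ ?_
    · refine ContinuousOn.aestronglyMeasurable ?_ hSc.measurableSet
      exact ContinuousOn.mul (by fun_prop) (((hαc i).mul (hβc i)).mono hSr)
    · refine (ae_restrict_mem hSc.measurableSet).mono fun t ht => ?_
      rw [norm_mul, norm_mul, norm_pow, Complex.norm_real, Real.norm_eq_abs, abs_of_pos (hSr ht).1]
      refine mul_le_mul_of_nonneg_left ?_ (pow_nonneg (hSr ht).1.le _)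
      nlinarith [sq_nonneg (‖α i t‖ - ‖β i t‖)]
    · exact (ae_restrict_mem hSc.measurableSet).mono fun t ht => (hbd t ht).summable
    · have hi : IntegrableOn (fun t : ℝ => t ^ (n - 1) * (((a t).re + (b t).re) / 2)) S := by
        refine ContinuousOn.integrableOn_compact hSc ?_
        refine ContinuousOn.mul (by fun_prop) (ContinuousOn.div_const (ContinuousOn.add ?_ ?_) 2)
        · exact Complex.continuous_re.comp_continuousOn (hac.mono hSr)
        · exact Complex.continuous_re.comp_continuousOn (hbc.mono hSr)
      refine hi.congr ?_
      exact (ae_restrict_mem hSc.measurableSet).mono fun t ht => (hbd t ht).tsum_eq.symm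
    · exact (ae_restrict_mem hSc.measurableSet).mono fun t ht =>
        (hasSum_sphere hP (hwt t (hSr ht)) (hkt t)).mul_left _
  have hterm : ∀ i : HarmIndex n, ∫ t in S, (t : ℂ) ^ (n - 1) * (α i t * β i t) = 0 := by
    rintro ⟨⟨p, q⟩, j⟩
    obtain ⟨A, hA, B, hB, hAB⟩ := hrad p q j
    have hcomp := integral_radComp_weak_eq_zero (κ := κ) (isOpen_radSet r R ‖z‖) z (fun t ht => by
      have h1 : ‖z‖ < Real.sqrt t := by linarith [ht.2.1]
      have h2 := pow_lt_pow_left₀ h1 (norm_nonneg z) two_ne_zero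
      rwa [Real.sq_sqrt ht.1.le] at h2) (isBihom_basisPoly P p q j) (isHarm_basisPoly P p q j)
      hA hB φ
    have hKne : K ⊆ {0}ᶜ := fun u hu h => hK0 (Set.mem_singleton_iff.1 h ▸ hu)
    have hcs' := continuous_mul_of_eq_zero isOpen_compl_singleton hK hKne
      (continuousOn_radComp κ (n - 1 + p + q) A B (basisPoly P p q j)) hkc hk0
    change ∫ u, radComp κ (n - 1 + p + q) A B (basisPoly P p q j) u * k u = 0 at hcomp
    rw [integral_polar_of_eq_zero hK0 (hcs'.1.integrable_of_hasCompactSupport hcs'.2)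
      fun u hu => by rw [hk0 u hu, mul_zero]] at hcomp
    have h1 := (mul_eq_zero.1 hcomp).resolve_left
      (by exact_mod_cast (half_pos (surf_pos (n := n))).ne')
    rw [← h1]
    refine setIntegral_congr_fun hSc.measurableSet fun t ht => ?_
    have ht0 : 0 < t := (hSr ht).1
    have hs0 : (Real.sqrt t : ℂ) ≠ 0 := by exact_mod_cast (Real.sqrt_pos.2 ht0).ne'
    have hsq : (t : ℂ) = (Real.sqrt t : ℂ) ^ 2 := by exact_mod_cast (Real.sq_sqrt ht0.le).symm
    have h2 := hAB t (hSr ht)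
    have h3 : ∫ ω, radComp κ (n - 1 + p + q) A B (basisPoly P p q j) (Real.sqrt t • (ω : Cn n)) *
        k (Real.sqrt t • (ω : Cn n)) ∂unitSphereMeasure n =
        (((t : ℂ) ^ (n - 1 + p + q))⁻¹ * (expPoly κ A B t * (Real.sqrt t : ℂ) ^ (p + q))) *
          β ⟨(p, q), j⟩ t := by
      simp only [hβ]
      rw [← integral_const_mul]
      refine integral_congr_ae (.of_forall fun ω => ?_)
      simp only [radComp, norm_sphere_smul_sq ht0.le, (isBihom_basisPoly P p q j).ev_smul,
        ev_basisPoly]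
      ring
    rw [h3, ← h2]
    change (t : ℂ) ^ (n - 1) * (α ⟨(p, q), j⟩ t * _) = (t : ℂ) ^ (n - 1) *
      (((t : ℂ) ^ (n - 1 + p + q))⁻¹ * ((t : ℂ) ^ (n - 1) * ((Real.sqrt t : ℂ) ^ (p + q) *
        α ⟨(p, q), j⟩ t) * (Real.sqrt t : ℂ) ^ (p + q)) * _)
    have h4 : (t : ℂ) ^ (n - 1 + p + q) = (t : ℂ) ^ (n - 1) *
        ((Real.sqrt t : ℂ) ^ (p + q) * (Real.sqrt t : ℂ) ^ (p + q)) := by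
      rw [← mul_pow, ← pow_two, ← hsq, ← pow_add, add_assoc]
    have ht1 : (t : ℂ) ^ (n - 1) ≠ 0 := pow_ne_zero _ (by exact_mod_cast ht0.ne')
    have hs1 : (Real.sqrt t : ℂ) ^ (p + q) ≠ 0 := pow_ne_zero _ hs0
    rw [h4]
    field_simp
  simp only [hterm] at hsum
  rw [hsum.unique hasSum_zero, mul_zero]

end

/-! ### Comparison of the two signs of κ and the explicit form of the coefficients. -/

section

variable {n : ℕ} {κ r : ℝ} {R : EReal} {f : Cn n → ℂ}

/-! ### The form of the coefficients -/

/-- With t = ρ², the exponent collects 2(n-1) from t^(n-1), p + q from the solid harmonic, and p + q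
from the normalization of the coefficient. Removing the Gaussian weight makes the two exponentials
symmetric. -/
theorem hasExpPolyProfile_iff (hr : 0 ≤ r) (P : HarmonicBases n) (p q : ℕ)
    (j : Fin (dimH n p q)) : HasExpPolyProfile κ r R P f p q j ↔
      ∃ A ∈ Polynomial.degreeLT ℂ p, ∃ B ∈ Polynomial.degreeLT ℂ q, ∀ ρ : ℝ, r < ρ → (ρ : EReal) < R →
        (ρ : ℂ) ^ (2 * (n - 1 + p + q)) * solidCoeff P f p q j ρ =
          Complex.exp (κ / 2 * (ρ : ℂ) ^ 2) * A.eval ((ρ : ℂ) ^ 2) +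
            Complex.exp (-(κ / 2 * (ρ : ℂ) ^ 2)) * B.eval ((ρ : ℂ) ^ 2) := by
  have key : ∀ (A B : Polynomial ℂ) (ρ : ℝ), 0 < ρ →
      ((((ρ ^ 2 : ℝ) : ℂ) ^ (n - 1) * ((Real.sqrt (ρ ^ 2) : ℂ) ^ (p + q) *
        ∫ ω, weighted κ f (Real.sqrt (ρ ^ 2) • (ω : Cn n)) * conj ((P p q j : Cn n → ℂ) ω)
          ∂unitSphereMeasure n) = expPoly κ A B (ρ ^ 2)) ↔
        (ρ : ℂ) ^ (2 * (n - 1 + p + q)) * solidCoeff P f p q j ρ =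
          Complex.exp (κ / 2 * (ρ : ℂ) ^ 2) * A.eval ((ρ : ℂ) ^ 2) +
            Complex.exp (-(κ / 2 * (ρ : ℂ) ^ 2)) * B.eval ((ρ : ℂ) ^ 2)) := by
    intro A B ρ hρ
    have hρ0 : (ρ : ℂ) ^ (p + q) ≠ 0 := pow_ne_zero _ (by exact_mod_cast hρ.ne')
    set E := Complex.exp (κ / 2 * (ρ : ℂ) ^ 2) with hE
    have hE0 : E ≠ 0 := Complex.exp_ne_zero _
    have hE1 : Complex.exp (-(κ / 2 * (ρ : ℂ) ^ 2)) = E⁻¹ := Complex.exp_neg _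
    have hE2 : Complex.exp (-(κ * ((ρ ^ 2 : ℝ) : ℂ))) = E⁻¹ * E⁻¹ := by
      rw [← hE1, ← Complex.exp_add]
      congr 1
      push_cast
      ring
    have hw : ∫ ω, weighted κ f (ρ • (ω : Cn n)) * conj ((P p q j : Cn n → ℂ) ω)
        ∂unitSphereMeasure n = E⁻¹ * ((ρ : ℂ) ^ (p + q) * solidCoeff P f p q j ρ) := by
      rw [solidCoeff, mul_inv_cancel_left₀ hρ0, sphCoeff, ← integral_const_mul]
      refine integral_congr_ae (.of_forall fun ω => ?_)
      simp only [weighted]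
      have hnorm : ‖ρ • (ω : Cn n)‖ ^ 2 = ρ ^ 2 := by
        rw [norm_smul, norm_eq_of_mem_sphere, mul_one, Real.norm_eq_abs, sq_abs]
      rw [hnorm, ← hE1, show -((κ : ℂ) * ((ρ ^ 2 : ℝ) : ℂ) / 2) = -(κ / 2 * (ρ : ℂ) ^ 2) by
        push_cast; ring]
      ring
    rw [Real.sqrt_sq hρ.le, hw, expPoly, hE2, hE1]
    push_cast
    have h1 : ((ρ : ℂ) ^ 2) ^ (n - 1) * ((ρ : ℂ) ^ (p + q) * (E⁻¹ * ((ρ : ℂ) ^ (p + q) *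
        solidCoeff P f p q j ρ))) = E⁻¹ * ((ρ : ℂ) ^ (2 * (n - 1 + p + q)) *
          solidCoeff P f p q j ρ) := by
      ring
    have h2 : ∀ x y : ℂ, E * (x + E⁻¹ * E⁻¹ * y) = E * x + E⁻¹ * y := fun x y => by field_simp
    rw [h1, inv_mul_eq_iff_eq_mul₀ hE0, h2]
  constructor
  · rintro ⟨A, hA, B, hB, h⟩
    exact ⟨A, hA, B, hB, fun ρ h1 h2 => (key A B ρ (hr.trans_lt h1)).1
      (h _ (sq_mem_radSet_zero hr h1 h2))⟩
  · rintro ⟨A, hA, B, hB, h⟩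
    refine ⟨A, hA, B, hB, fun t ht => ?_⟩
    obtain ⟨ht0, h1, h2⟩ := ht
    rw [add_zero] at h1 h2
    have h3 := (key A B _ (Real.sqrt_pos.2 ht0)).2 (h _ h1 h2)
    rwa [Real.sq_sqrt ht0.le] at h3

/-- The coefficient of `f` along `P_j^{p,q}` is, up to a power of the radius, a combination of
`exp (±ρ²/4)` with polynomials in `ρ²` of degree less than `min p q`. -/
def HasRadialForm (r : ℝ) (R : EReal) (P : HarmonicBases n) (f : Cn n → ℂ) (p q : ℕ)
    (j : Fin (dimH n p q)) : Prop :=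
  ∃ A ∈ Polynomial.degreeLT ℂ (min p q), ∃ B ∈ Polynomial.degreeLT ℂ (min p q), ∀ ρ : ℝ,
    r < ρ → (ρ : EReal) < R → (ρ : ℂ) ^ (2 * (n - 1 + p + q)) * solidCoeff P f p q j ρ =
      (Real.exp (ρ ^ 2 / 4) : ℂ) * A.eval ((ρ : ℂ) ^ 2) +
        (Real.exp (-(ρ ^ 2 / 4)) : ℂ) * B.eval ((ρ : ℂ) ^ 2)

/-- Changing the sign of κ exchanges exp(ρ²/4) and exp(-ρ²/4), so the second profile bounds the same
two polynomials with p and q interchanged. Independence of the exponentials identifies the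
polynomials. -/
theorem hasRadialForm_iff (hr : 0 ≤ r) (hrR : (r : EReal) < R) (P : HarmonicBases n)
    (p q : ℕ) (j : Fin (dimH n p q)) :
    HasRadialForm r R P f p q j ↔
      HasExpPolyProfile (1 / 2) r R P f p q j ∧ HasExpPolyProfile (-1 / 2) r R P f p q j := by
  have e1 : ∀ ρ : ℝ, (Real.exp (ρ ^ 2 / 4) : ℂ) =
      Complex.exp (((1 / 2 : ℝ) : ℂ) / 2 * (ρ : ℂ) ^ 2) := fun ρ => by
    rw [Complex.ofReal_exp]; congr 1; push_cast; ring
  have e2 : ∀ ρ : ℝ, (Real.exp (-(ρ ^ 2 / 4)) : ℂ) =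
      Complex.exp (-(((1 / 2 : ℝ) : ℂ) / 2 * (ρ : ℂ) ^ 2)) := fun ρ => by
    rw [Complex.ofReal_exp]; congr 1; push_cast; ring
  have e3 : ∀ ρ : ℝ, (Real.exp (-(ρ ^ 2 / 4)) : ℂ) =
      Complex.exp (((-1 / 2 : ℝ) : ℂ) / 2 * (ρ : ℂ) ^ 2) := fun ρ => by
    rw [Complex.ofReal_exp]; congr 1; push_cast; ring
  have e4 : ∀ ρ : ℝ, (Real.exp (ρ ^ 2 / 4) : ℂ) =
      Complex.exp (-(((-1 / 2 : ℝ) : ℂ) / 2 * (ρ : ℂ) ^ 2)) := fun ρ => by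
    rw [Complex.ofReal_exp]; congr 1; push_cast; ring
  have hmp := Polynomial.degreeLT_mono (R := ℂ) (min_le_left p q)
  have hmq := Polynomial.degreeLT_mono (R := ℂ) (min_le_right p q)
  rw [hasExpPolyProfile_iff hr, hasExpPolyProfile_iff hr]
  simp only [← e1, ← e2, ← e3, ← e4]
  constructor
  · rintro ⟨A, hA, B, hB, h⟩
    exact ⟨⟨A, hmp hA, B, hmq hB, h⟩, ⟨B, hmp hB, A, hmq hA, fun ρ h1 h2 =>
      (h ρ h1 h2).trans (add_comm _ _)⟩⟩
  · rintro ⟨⟨A, hA, B, hB, h⟩, ⟨A', hA', B', hB', h'⟩⟩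
    have hpp := Polynomial.degreeLT_mono (R := ℂ) (Nat.le_add_right p q)
    have hqq := Polynomial.degreeLT_mono (R := ℂ) (Nat.le_add_left q p)
    -- The bound p + q only provides a common degree class for A and B'.
    have hz := expPoly_eq_zero (κ := 1 / 2) (by norm_num) (isOpen_radSet r R 0)
      (nonempty_radSet_zero hr hrR) (p + q) (A - B') (Submodule.sub_mem _ (hpp hA) (hqq hB'))
      (B - A') (fun t ht => by
        obtain ⟨ht0, h1, h2⟩ := ht
        rw [add_zero] at h1 h2
        have h3 := (h _ h1 h2).symm.trans (h' _ h1 h2)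
        rw [e1, e2] at h3
        have hsq : (Real.sqrt t : ℂ) ^ 2 = t := by exact_mod_cast Real.sq_sqrt ht0.le
        rw [hsq] at h3
        set E := Complex.exp (((1 / 2 : ℝ) : ℂ) / 2 * t) with hE
        have hE0 : E ≠ 0 := Complex.exp_ne_zero _
        have hE1 : Complex.exp (-(((1 / 2 : ℝ) : ℂ) / 2 * t)) = E⁻¹ := Complex.exp_neg _
        have hE2 : Complex.exp (-(((1 / 2 : ℝ) : ℂ) * t)) = E⁻¹ * E⁻¹ := by
          rw [← hE1, ← Complex.exp_add]
          congr 1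
          ring
        rw [hE1] at h3
        rw [expPoly, hE2, Polynomial.eval_sub, Polynomial.eval_sub]
        have h4 : E⁻¹ * (E * A.eval (t : ℂ) + E⁻¹ * B.eval (t : ℂ)) =
          E⁻¹ * (E⁻¹ * A'.eval (t : ℂ) + E * B'.eval (t : ℂ)) := by rw [h3]
        rw [mul_add, mul_add, inv_mul_cancel_left₀ hE0, inv_mul_cancel_left₀ hE0] at h4
        linear_combination h4)
    have hAB : A = B' := sub_eq_zero.1 hz.1
    have hBA : B = A' := sub_eq_zero.1 hz.2
    have hmin : ∀ Q : Polynomial ℂ, Q ∈ Polynomial.degreeLT ℂ p → Q ∈ Polynomial.degreeLT ℂ q →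
        Q ∈ Polynomial.degreeLT ℂ (min p q) := fun Q h1 h2 => by
      rcases min_choice p q with h3 | h3 <;> rwa [h3]
    exact ⟨A, hmin A hA (hAB ▸ hB'), B, hmin B (hBA ▸ hA') hB, h⟩

theorem eval_eq_sum_Icc {m : ℕ} {A : Polynomial ℂ} (hA : A ∈ Polynomial.degreeLT ℂ m) (x : ℂ) :
    A.eval x = ∑ i ∈ Finset.Icc 1 m, A.coeff (i - 1) * x ^ (i - 1) := by
  have h1 : Finset.Icc 1 m = Finset.Ico 1 (m + 1) := by ext; simp
  rw [h1, Finset.sum_Ico_eq_sum_range]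
  simp only [Nat.add_sub_cancel_left, Nat.add_sub_cancel]
  rcases eq_or_ne A 0 with rfl | h0
  · simp
  · refine Polynomial.eval_eq_sum_range' ?_ x
    rw [Polynomial.mem_degreeLT] at hA
    exact (Polynomial.natDegree_lt_iff_degree_lt h0).2 hA

theorem exists_mem_degreeLT_eval_eq (m : ℕ) (c : ℕ → ℂ) : ∃ A ∈ Polynomial.degreeLT ℂ m,
    ∀ x : ℂ, A.eval x = ∑ i ∈ Finset.Icc 1 m, c i * x ^ (i - 1) := by
  refine ⟨∑ i ∈ Finset.Icc 1 m, Polynomial.monomial (i - 1) (c i),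
    Submodule.sum_mem _ fun i hi => ?_, fun x => ?_⟩
  · rw [Polynomial.mem_degreeLT]
    refine (Polynomial.degree_monomial_le _ _).trans_lt ?_
    have := Finset.mem_Icc.1 hi
    exact_mod_cast (by omega : i - 1 < m)
  · simp [Polynomial.eval_finsetSum]

/-- The index i, counted from 1, corresponds to the monomial of degree i - 1 in ρ². -/
theorem zpow_neg_two_mul_eq {x : ℂ} (hx : x ≠ 0) {p q i : ℕ} (hn : 1 ≤ n) (hi : 1 ≤ i) :
    x ^ (-2 * ((p : ℤ) + q + n - i)) = (x ^ (2 * (n - 1 + p + q)))⁻¹ * (x ^ 2) ^ (i - 1) := by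
  obtain ⟨k, rfl⟩ := Nat.exists_eq_add_of_le hi
  obtain ⟨m, rfl⟩ := Nat.exists_eq_add_of_le hn
  rw [Nat.add_sub_cancel_left, Nat.add_sub_cancel_left, ← zpow_natCast x (2 * _), ← zpow_neg,
    ← pow_mul, ← zpow_natCast x (2 * k), ← zpow_add₀ hx]
  congr 1
  push_cast
  ring

theorem hasRadialForm_iff_exists (hn : 1 ≤ n) (hr : 0 ≤ r) (P : HarmonicBases n)
    (p q : ℕ) (j : Fin (dimH n p q)) :
    HasRadialForm r R P f p q j ↔ ∃ c d : ℕ → ℂ, ∀ ρ : ℝ, r < ρ → (ρ : EReal) < R →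
      solidCoeff P f p q j ρ = (∑ i ∈ Finset.Icc 1 (min p q),
          c i * (Real.exp (ρ ^ 2 / 4) : ℂ) * (ρ : ℂ) ^ (-2 * ((p : ℤ) + q + n - i))) +
        ∑ k ∈ Finset.Icc 1 (min p q),
          d k * (Real.exp (-(ρ ^ 2 / 4)) : ℂ) * (ρ : ℂ) ^ (-2 * ((p : ℤ) + q + n - k)) := by
  have hs : ∀ (c : ℕ → ℂ) (e : ℂ) (ρ : ℝ), 0 < ρ → ∑ i ∈ Finset.Icc 1 (min p q),
      c i * e * (ρ : ℂ) ^ (-2 * ((p : ℤ) + q + n - i)) = ((ρ : ℂ) ^ (2 * (n - 1 + p + q)))⁻¹ *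
        (e * ∑ i ∈ Finset.Icc 1 (min p q), c i * ((ρ : ℂ) ^ 2) ^ (i - 1)) := by
    intro c e ρ hρ
    rw [Finset.mul_sum, Finset.mul_sum]
    refine Finset.sum_congr rfl fun i hi => ?_
    rw [zpow_neg_two_mul_eq (by exact_mod_cast hρ.ne') hn (Finset.mem_Icc.1 hi).1]
    ring
  constructor
  · rintro ⟨A, hA, B, hB, h⟩
    refine ⟨fun i => A.coeff (i - 1), fun i => B.coeff (i - 1), fun ρ h1 h2 => ?_⟩
    have hρ := hr.trans_lt h1
    rw [hs _ _ ρ hρ, hs _ _ ρ hρ, ← eval_eq_sum_Icc hA, ← eval_eq_sum_Icc hB, ← mul_add,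
      ← h ρ h1 h2, inv_mul_cancel_left₀ (pow_ne_zero _ (by exact_mod_cast hρ.ne'))]
  · rintro ⟨c, d, h⟩
    obtain ⟨A, hA, hA'⟩ := exists_mem_degreeLT_eval_eq (min p q) c
    obtain ⟨B, hB, hB'⟩ := exists_mem_degreeLT_eval_eq (min p q) d
    refine ⟨A, hA, B, hB, fun ρ h1 h2 => ?_⟩
    have hρ := hr.trans_lt h1
    rw [h ρ h1 h2, hs _ _ ρ hρ, hs _ _ ρ hρ, ← hA', ← hB', ← mul_add,
      mul_inv_cancel_left₀ (pow_ne_zero _ (by exact_mod_cast hρ.ne'))]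

theorem hasRadialForm_iff_eq_zero (hr : 0 ≤ r) (P : HarmonicBases n) {p q : ℕ}
    (hpq : min p q = 0) (j : Fin (dimH n p q)) :
    HasRadialForm r R P f p q j ↔ ∀ ρ : ℝ, r < ρ → (ρ : EReal) < R →
      solidCoeff P f p q j ρ = 0 := by
  constructor
  · rintro ⟨A, hA, B, hB, h⟩ ρ h1 h2
    rw [hpq] at hA hB
    have h3 := h ρ h1 h2
    rw [degreeLT_zero_eq hA, degreeLT_zero_eq hB, Polynomial.eval_zero, mul_zero, mul_zero,
      add_zero] at h3
    exact (mul_eq_zero.1 h3).resolve_left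
      (pow_ne_zero _ (by exact_mod_cast (hr.trans_lt h1).ne'))
  · intro h
    refine ⟨0, Submodule.zero_mem _, 0, Submodule.zero_mem _, fun ρ h1 h2 => ?_⟩
    rw [h ρ h1 h2]
    simp

theorem mem_ZStar_iff_hasRadialForm (hn : 1 ≤ n) (hr : 0 ≤ r) (hrR : (r : EReal) < R)
    {P : HarmonicBases n} (hP : IsOrthonormalOnSphere P) (hf : ContinuousOn f (Ann n r R)) :
    f ∈ ZStar n r R ↔ ∀ p q j, HasRadialForm r R P f p q j := by
  have : NeZero n := ⟨by omega⟩
  simp only [hasRadialForm_iff hr hrR]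
  rw [mem_ZStar_iff hr hf]
  constructor
  · rintro ⟨h1, h2⟩ p q j
    exact ⟨hasExpPolyProfile_of_meansVanish hr hrR hf (by norm_num) h1 P p q j,
      hasExpPolyProfile_of_meansVanish hr hrR hf (by norm_num) h2 P p q j⟩
  · intro h
    exact ⟨meansVanish_of_hasExpPolyProfile hr hf hP fun p q j => (h p q j).1,
      meansVanish_of_hasExpPolyProfile hr hf hP fun p q j => (h p q j).2⟩

end

end TwistedMeans

end

theorem theorem4p4 (n : ℕ) (hn : 1 ≤ n) (r : ℝ) (R : EReal) (hr : 0 ≤ r) (hrR : (r : EReal) < R)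
    (P : TwistedMeans.HarmonicBases n) (hP : TwistedMeans.IsOrthonormalOnSphere P)
    (f : TwistedMeans.Cn n → ℂ) (hf : ContinuousOn f (TwistedMeans.Ann n r R)) :
    f ∈ TwistedMeans.ZStar n r R ↔
      (∀ p q : ℕ, p ≠ 0 → q ≠ 0 → ∀ j : Fin (TwistedMeans.dimH n p q),
        ∃ c d : ℕ → ℂ, ∀ ρ : ℝ, r < ρ → (ρ : EReal) < R →
          TwistedMeans.solidCoeff P f p q j ρ =
            (∑ i ∈ Finset.Icc 1 (min p q),
              c i * (Real.exp (ρ ^ 2 / 4) : ℂ) * (ρ : ℂ) ^ (-2 * ((p : ℤ) + q + n - i))) +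
            ∑ k ∈ Finset.Icc 1 (min p q),
              d k * (Real.exp (-(ρ ^ 2 / 4)) : ℂ) * (ρ : ℂ) ^ (-2 * ((p : ℤ) + q + n - k))) ∧
      (∀ (q : ℕ) (j : Fin (TwistedMeans.dimH n 0 q)) (ρ : ℝ), r < ρ → (ρ : EReal) < R →
        TwistedMeans.solidCoeff P f 0 q j ρ = 0) ∧
      (∀ (p : ℕ) (j : Fin (TwistedMeans.dimH n p 0)) (ρ : ℝ), r < ρ → (ρ : EReal) < R →
        TwistedMeans.solidCoeff P f p 0 j ρ = 0) := by
  rw [TwistedMeans.mem_ZStar_iff_hasRadialForm hn hr hrR hP hf]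
  constructor
  · intro h
    exact ⟨fun p q _ _ j => (TwistedMeans.hasRadialForm_iff_exists hn hr P p q j).1 (h p q j),
      fun q j => (TwistedMeans.hasRadialForm_iff_eq_zero hr P (Nat.zero_min q) j).1 (h 0 q j),
      fun p j => (TwistedMeans.hasRadialForm_iff_eq_zero hr P (Nat.min_zero p) j).1 (h p 0 j)⟩
  · rintro ⟨h1, h2, h3⟩ p q j
    rcases eq_or_ne p 0 with rfl | hp
    · exact (TwistedMeans.hasRadialForm_iff_eq_zero hr P (Nat.zero_min q) j).2 (h2 q j)
    rcases eq_or_ne q 0 with rfl | hq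
    · exact (TwistedMeans.hasRadialForm_iff_eq_zero hr P (Nat.min_zero p) j).2 (h3 p j)
    exact (TwistedMeans.hasRadialForm_iff_exists hn hr P p q j).2 (h1 p q hp hq j)
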